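/- Let $N$ be a complete, simply connected Riemannian surface of constant Gauss curvature $\kappa \le 0$. Let $\Omega,\tilde\Omega \subset N$ be compact strictly convex domains with smooth boundary (the boundary is included in the domain). Let $h:\Omega\to\mathbb{R}$ be a function that is smooth up to the boundary and uniformly convex, i.e. $(\mathrm{Hess}\,h)_p(w,w)\ge\theta|w|^2$ for some constant $\theta>0$ and all $p\in\Omega$, $w\in T_pN$, and that satisfies $h=0$ and $|\nabla h|=1$ along $\partial\Omega$. Let $\tilde h:\tilde\Omega\to\mathbb{R}$ be a function with the same properties on $\tilde\Omega$. A diffeomorphism $f:\Omega\to\tilde\Omega$ (smooth up to the boundary, with inverse smooth up to the boundary) is called a minimal Lagrangian diffeomorphism if it is area-preserving and orientation-preserving, and its graph $\{(p,f(p)):p\in\Omega\}$ is a minimal submanifold of the Riemannian product $N\times N$. Then there exists a constant $C_4$, depending only on $h$ and $\tilde h$ (and on their domains $\Omega,\tilde\Omega\subset N$), such that for every minimal Lagrangian diffeomorphism $f:\Omega\to\tilde\Omega$ $$\det(I + Df_p^*\,Df_p)\le C_4\qquad\text{for all } p\in\Omega,$$ where $Df_p^*:T_{f(p)}N\to T_pN$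 denotes the adjoint of $Df_p$ with respect to the Riemannian metric. -/

import Mathlib

open Set
open Bundle
open scoped Manifold ContDiff Topology

noncomputable section

/-- The model space `ℝ²` of a surface. -/
abbrev Plane : Type := EuclideanSpace ℝ (Fin 2)

/-- The standard basis vectors of `ℝ²`. -/
def stdVec (i : Fin 2) : Plane := EuclideanSpace.single i 1

section Surface

variable {N : Type*} [MetricSpace N] [ChartedSpace Plane N]

/-- The tangent space of the surface `N` at `p`. -/
abbrev Tan (p : N) : Type := TangentSpace 𝓘(ℝ, Plane) p

/-- The `i`-th coordinate vector field of the chart `e`, at the point with coordinates `y`. -/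
def coordVec (e : OpenPartialHomeomorph N Plane) (y : Plane) (i : Fin 2) : Tan (e.symm y) :=
  mfderiv 𝓘(ℝ, Plane) 𝓘(ℝ, Plane) e.symm y (stdVec i)

/-- A continuous nowhere vanishing 2-form, that is, an orientation of the surface `N`. -/
structure IsOrientationForm (τ : ∀ p : N, Tan p →ₗ[ℝ] Tan p →ₗ[ℝ] ℝ) : Prop where
  alternating : ∀ (p : N) (v : Tan p), τ p v v = 0
  nonvanishing : ∀ p : N, τ p ≠ 0
  continuous : ∀ e ∈ atlas Plane N,
    ContinuousOn (fun y => τ (e.symm y) (coordVec e y 0) (coordVec e y 1)) e.target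

/-- The differential `Df_p` of a map that is defined on (a set containing) `Ω`. It only depends on
the restriction of `f` to `Ω`, and it is used at boundary points of `Ω` too. -/
def diffOn (f : N → N) (Ω : Set N) (p : N) : Tan p →L[ℝ] Tan (f p) :=
  mfderivWithin 𝓘(ℝ, Plane) 𝓘(ℝ, Plane) f Ω p

/-- `f` restricts to a diffeomorphism from `Ω` onto `Ω'`, smooth up to the boundary, with an
inverse that is smooth up to the boundary. -/
def IsDiffeoOn (Ω Ω' : Set N) (f : N → N) : Prop :=
  BijOn f Ω Ω' ∧ ContMDiffOn 𝓘(ℝ, Plane) 𝓘(ℝ, Plane) ∞ f Ω ∧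
    ∃ g : N → N, ContMDiffOn 𝓘(ℝ, Plane) 𝓘(ℝ, Plane) ∞ g Ω' ∧ InvOn g f Ω Ω'

/-- `f` preserves the orientation of `N` at the points of `Ω`. The same orientation is used at `p`
and at `f p`, so on a connected orientable surface the choice of the orientation is immaterial. -/
def IsOrientationPreservingOn (Ω : Set N) (f : N → N) : Prop :=
  ∃ τ : ∀ p : N, Tan p →ₗ[ℝ] Tan p →ₗ[ℝ] ℝ, IsOrientationForm τ ∧
    ∀ p ∈ Ω, ∀ v w : Tan p, 0 < τ p v w → 0 < τ (f p) (diffOn f Ω p v) (diffOn f Ω p w)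

/-- `Ω` is a closed region with smooth boundary: near each boundary point it is a sub-level set of
a smooth function with non-vanishing differential. -/
def HasSmoothBoundary (Ω : Set N) : Prop :=
  IsClosed Ω ∧ ∀ p ∈ frontier Ω, ∃ (U : Set N) (ρ : N → ℝ), IsOpen U ∧ p ∈ U ∧
    ContMDiffOn 𝓘(ℝ, Plane) 𝓘(ℝ, ℝ) ∞ ρ U ∧
    mfderiv 𝓘(ℝ, Plane) 𝓘(ℝ, ℝ) ρ p ≠ 0 ∧ Ω ∩ U = {q | ρ q ≤ 0} ∩ U

/-- A strictly convex domain with smooth boundary (the boundary is included in `Ω`). The points `z`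
with `d(p,z) + d(z,q) = d(p,q)` are those of the minimizing geodesics from `p` to `q`. -/
structure IsStrictlyConvexDomain (Ω : Set N) : Prop where
  compact : IsCompact Ω
  connected : IsConnected Ω
  smoothBoundary : HasSmoothBoundary Ω
  strictlyConvex : ∀ p ∈ Ω, ∀ q ∈ Ω, ∀ z : N, dist p z + dist z q = dist p q →
    z ≠ p → z ≠ q → z ∈ interior Ω

variable [Bundle.RiemannianBundle (fun p : N => TangentSpace 𝓘(ℝ, Plane) p)]

instance (p : N) : FiniteDimensional ℝ (Tan p) :=
  inferInstanceAs (FiniteDimensional ℝ Plane)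

instance (p : N) : CompleteSpace (Tan p) := FiniteDimensional.complete ℝ (Tan p)

/-- The coefficients `g_ij` of the Riemannian metric in the chart `e`. -/
def metricCoeff (e : OpenPartialHomeomorph N Plane) (y : Plane) : Matrix (Fin 2) (Fin 2) ℝ :=
  fun i j => inner ℝ (coordVec e y i) (coordVec e y j)

/-- The Christoffel symbols of the Levi-Civita connection in the chart `e`:
`Γ^k_ij = ½ ∑_l g^kl (∂_i g_jl + ∂_j g_il - ∂_l g_ij)`. -/
def christoffel (e : OpenPartialHomeomorph N Plane) (k i j : Fin 2) (y : Plane) : ℝ :=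
  (1 / 2 : ℝ) * ∑ l, (metricCoeff e y)⁻¹ k l *
    (fderiv ℝ (fun z => metricCoeff e z j l) y (stdVec i)
      + fderiv ℝ (fun z => metricCoeff e z i l) y (stdVec j)
      - fderiv ℝ (fun z => metricCoeff e z i j) y (stdVec l))

/-- The coefficients of the curvature tensor: `R(∂_i, ∂_j) ∂_k = ∑_l R^l_kij ∂_l`, where
`R(X, Y) Z = ∇_X ∇_Y Z - ∇_Y ∇_X Z - ∇_[X,Y] Z`. -/
def riemannCoeff (e : OpenPartialHomeomorph N Plane) (l k i j : Fin 2) (y : Plane) : ℝ :=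
  fderiv ℝ (christoffel e l j k) y (stdVec i) - fderiv ℝ (christoffel e l i k) y (stdVec j)
    + ∑ m, (christoffel e l i m y * christoffel e m j k y
      - christoffel e l j m y * christoffel e m i k y)

/-- The Gauss curvature `⟨R(∂_1, ∂_2) ∂_2, ∂_1⟩ / det g` in the chart `e`. -/
def gaussCurvature (e : OpenPartialHomeomorph N Plane) (y : Plane) : ℝ :=
  (∑ l, riemannCoeff e l 1 0 1 y * metricCoeff e y l 0) / (metricCoeff e y).det

variable (N) in
/-- The surface `N` has constant Gauss curvature `κ`. -/
def HasConstantCurvature (κ : ℝ) : Prop :=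
  ∀ e ∈ atlas Plane N, ∀ y ∈ e.target, gaussCurvature e y = κ

/-- The gradient at `p` of a function on `Ω`. -/
def gradOn (h : N → ℝ) (Ω : Set N) (p : N) : Tan p :=
  (InnerProductSpace.toDual ℝ (Tan p)).symm (mfderivWithin 𝓘(ℝ, Plane) 𝓘(ℝ, ℝ) h Ω p)

/-- The domain `Ω` in the coordinates of the chart `e`. -/
def chartImage (e : OpenPartialHomeomorph N Plane) (Ω : Set N) : Set Plane :=
  e.target ∩ e.symm ⁻¹' Ω

/-- The coefficients `(Hess h)_ij = ∂_i ∂_j h - ∑_k Γ^k_ij ∂_k h` of the Hessian of a function on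
`Ω` in the chart `e`. -/
def hessCoeff (e : OpenPartialHomeomorph N Plane) (Ω : Set N) (h : N → ℝ) (i j : Fin 2)
    (y : Plane) : ℝ :=
  fderivWithin ℝ
      (fun z => fderivWithin ℝ (h ∘ e.symm) (chartImage e Ω) z (stdVec j))
      (chartImage e Ω) y (stdVec i)
    - ∑ k, christoffel e k i j y * fderivWithin ℝ (h ∘ e.symm) (chartImage e Ω) y (stdVec k)

/-- `h` is uniformly convex on `Ω`: `Hess h (w, w) ≥ θ |w|²` for some constant `θ > 0`. -/
def IsUniformlyConvexOn (Ω : Set N) (h : N → ℝ) : Prop :=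
  ∃ θ : ℝ, 0 < θ ∧ ∀ e ∈ atlas Plane N, ∀ y ∈ chartImage e Ω, ∀ w : Fin 2 → ℝ,
    θ * ∑ i, ∑ j, metricCoeff e y i j * w i * w j ≤ ∑ i, ∑ j, hessCoeff e Ω h i j y * w i * w j

/-- `h` is a smooth, uniformly convex boundary defining function of `Ω`. -/
structure IsBoundaryDefiningFunction (Ω : Set N) (h : N → ℝ) : Prop where
  smooth : ContMDiffOn 𝓘(ℝ, Plane) 𝓘(ℝ, ℝ) ∞ h Ω
  uniformlyConvex : IsUniformlyConvexOn Ω h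
  eq_zero : ∀ p ∈ frontier Ω, h p = 0
  norm_grad : ∀ p ∈ frontier Ω, ‖gradOn h Ω p‖ = 1

/-- `f` preserves the Riemannian area element at the points of `Ω`: `Df_p` preserves the (squared)
area of parallelograms. -/
def IsAreaPreservingOn (Ω : Set N) (f : N → N) : Prop :=
  ∀ p ∈ Ω, ∀ v w : Tan p,
    ‖diffOn f Ω p v‖ ^ 2 * ‖diffOn f Ω p w‖ ^ 2 - inner ℝ (diffOn f Ω p v) (diffOn f Ω p w) ^ 2
      = ‖v‖ ^ 2 * ‖w‖ ^ 2 - inner ℝ v w ^ 2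

/-- The part of `Ω` on which `f` can be read in the charts `e` (source) and `e'` (target). -/
def mapDomain (e e' : OpenPartialHomeomorph N Plane) (Ω : Set N) (f : N → N) : Set Plane :=
  chartImage e (Ω ∩ f ⁻¹' e'.source)

/-- The first derivatives `∂_i u` of the coordinate expression `u = e' ∘ f ∘ e⁻¹` of `f`. -/
def mapDeriv (e e' : OpenPartialHomeomorph N Plane) (Ω : Set N) (f : N → N) (i : Fin 2)
    (y : Plane) : Plane :=
  fderivWithin ℝ (e' ∘ f ∘ e.symm) (mapDomain e e' Ω f) y (stdVec i)

/-- The second derivatives `∂_i ∂_j u` of the coordinate expression of `f`. -/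
def mapDeriv₂ (e e' : OpenPartialHomeomorph N Plane) (Ω : Set N) (f : N → N) (i j : Fin 2)
    (y : Plane) : Plane :=
  fderivWithin ℝ (mapDeriv e e' Ω f j) (mapDomain e e' Ω f) y (stdVec i)

/-- The tangent vectors `X_i = (∂_i, ∂_i u)` of the graph of `f`, in the coordinates `(e, e')` of
the product `N × N`. -/
def graphTangent (e e' : OpenPartialHomeomorph N Plane) (Ω : Set N) (f : N → N) (i : Fin 2)
    (y : Plane) : Plane × Plane :=
  (stdVec i, mapDeriv e e' Ω f i y)

/-- The metric `⟨X_i, X_j⟩` induced on the graph of `f` by the product metric of `N × N`. -/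
def graphMetric (e e' : OpenPartialHomeomorph N Plane) (Ω : Set N) (f : N → N) (y : Plane) :
    Matrix (Fin 2) (Fin 2) ℝ :=
  fun i j => metricCoeff e y i j + ∑ a, ∑ b, metricCoeff e' (e' (f (e.symm y))) a b
    * mapDeriv e e' Ω f i y a * mapDeriv e e' Ω f j y b

/-- The covariant derivative `∇_{X_i} X_j` along the graph, with respect to the Levi-Civita
connection of the product metric of `N × N`. -/
def graphCovDeriv (e e' : OpenPartialHomeomorph N Plane) (Ω : Set N) (f : N → N) (i j : Fin 2)
    (y : Plane) : Plane × Plane :=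
  (WithLp.toLp 2 (fun k => christoffel e k i j y),
    mapDeriv₂ e e' Ω f i j y + WithLp.toLp 2 (fun a => ∑ b, ∑ c,
      christoffel e' a b c (e' (f (e.symm y)))
        * mapDeriv e e' Ω f i y b * mapDeriv e e' Ω f j y c))

/-- The graph `{(p, f p) : p ∈ Ω}` is a minimal submanifold of `N × N`: its mean curvature vector,
which is the normal component of `∑ G^ij ∇_{X_i} X_j`, vanishes. In other words, the vector
`∑ G^ij ∇_{X_i} X_j` is tangent to the graph. -/
def IsMinimalGraphOn (Ω : Set N) (f : N → N) : Prop :=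
  ∀ e ∈ atlas Plane N, ∀ e' ∈ atlas Plane N, ∀ y ∈ mapDomain e e' Ω f,
    ∑ i, ∑ j, (graphMetric e e' Ω f y)⁻¹ i j • graphCovDeriv e e' Ω f i j y
      ∈ Submodule.span ℝ (range fun i => graphTangent e e' Ω f i y)

/-- `f` is a minimal Lagrangian diffeomorphism from `Ω` to `Ω'`. -/
structure IsMinimalLagrangianDiffeo (Ω Ω' : Set N) (f : N → N) : Prop where
  diffeo : IsDiffeoOn Ω Ω' f
  areaPreserving : IsAreaPreservingOn Ω f
  orientationPreserving : IsOrientationPreservingOn Ω f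
  minimalGraph : IsMinimalGraphOn Ω f

/-- `det (I + Df_p^* Df_p)`, where the adjoint is taken with respect to the Riemannian metric. -/
def detOnePlusAdjointMul (f : N → N) (Ω : Set N) (p : N) : ℝ :=
  LinearMap.det (LinearMap.id +
    (LinearMap.adjoint (diffOn f Ω p).toLinearMap) ∘ₗ (diffOn f Ω p).toLinearMap)

end Surface

end

noncomputable section

/-! ### Linear functionals on half spaces -/

/-! At each point write `Df = Q S` with `Q` an isometry and `S = [[p, q], [q, r]]` positive
definite. Area preservation gives `det S = 1`, so with `t = tr S` Cayley–Hamilton reads `1 + S² = t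
S`, and `det (1 + Df* Df) = t²`. The theorem is therefore an a priori bound for `t`.

Minimality of the graph forces `Q` to be parallel and `S` to be a Codazzi tensor
(`parallel_of_minimal`). The metric of the graph is `t S`, so the operator `lap`, which contracts
the Hessian with `S⁻¹`, obeys the maximum principle. Put `w = h' ∘ f`, and let `P` be the inner
product of the gradients of `h` and `h'` after identification by `Q`. With `θ` the convexity
constant and `C` a bound for the curvature and for the covariant derivatives of `h` and `h'` up to
order three, all the Laplacians are of order `t`: those of `h` and `w` lie between `θ t` and `4 C t`
(`lap_h`, `lap_w`), that of `P` is at most `20 C² t` (`lap_pairing`), and that of `log t` is at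
least `-C t` (`lap_tr`, `codazzi_gradient_le`).

Suitable combinations of these functions have positive Laplacian and so attain their maximum on the
boundary (`exists_frontier_max`). Applied to `h`, `h - c w` and `w - c h` this shows that on the
boundary `dw = a dh` with `c ≤ a ≤ 1/c`. There `S` maps the transported unit gradient of `h'` to `a`
times the unit gradient of `h`, and `t S = 1 + S²` becomes `t a P = a² + 1` (`boundary_relations`).
A lower bound for `P` on the boundary thus bounds `t` there. It comes from `A h - P`: its maximum is
a boundary minimum of `P`, where the normal derivative has a sign and uniform convexity of `h` gives
`A P ≥ θ` (`pairing_ge`). Finally `log t + K h` carries the boundary bound to the interior.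

A `LocalModel` records these structure equations near one point in an arbitrary chart. Charts and
frames vary with the point, but `h`, `w`, `P` and `t²` are global functions and the constants depend
neither on the chart nor on `f`, so the maximum principle can be run globally. -/

theorem exists_nonneg_smul_of_nonpos_on_halfspace {E : Type*} [AddCommGroup E] [Module ℝ E]
    (ℓ L : E →ₗ[ℝ] ℝ) (hℓ : ℓ ≠ 0) (hL : ∀ v, ℓ v < 0 → L v ≤ 0) :
    ∃ c : ℝ, 0 ≤ c ∧ ∀ v, L v = c * ℓ v := by
  obtain ⟨x, hx⟩ : ∃ x, ℓ x ≠ 0 := by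
    by_contra! hcon
    exact hℓ (LinearMap.ext hcon)
  set v₀ := (-(ℓ x)⁻¹) • x with hv₀
  have hv₀ℓ : ℓ v₀ = -1 := by simp [hv₀, hx]
  -- If `L w ≠ 0` for some `w` in the kernel of `ℓ`, adding a multiple of `w` to `v₀` raises `L` to
  -- `1` while `ℓ` stays equal to `-1`.
  have hker : ∀ w, ℓ w = 0 → L w = 0 := by
    intro w hw
    by_contra hne
    have h := hL (v₀ + ((1 - L v₀) / L w) • w) (by simp [hv₀ℓ, hw])
    simp only [map_add, map_smul, smul_eq_mul, div_mul_cancel₀ _ hne] at h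
    linarith
  refine ⟨-L v₀, by have := hL v₀ (by rw [hv₀ℓ]; norm_num); linarith, fun v => ?_⟩
  have h := hker (v + ℓ v • v₀) (by simp [hv₀ℓ])
  simp only [map_add, map_smul, smul_eq_mul] at h
  linarith

/-! ### Regions of the plane -/

/-- A subset of the plane whose tangent cone at each of its points contains an open half plane of
directions that point into the interior. -/
structure Region where
  /-- The underlying set. -/
  carrier : Set Plane
  exists_halfspace : ∀ y ∈ carrier, ∃ ℓ : Plane →L[ℝ] ℝ, ℓ ≠ 0 ∧
    ∀ v, ℓ v < 0 → ∀ᶠ τ in 𝓝[>] (0 : ℝ), y + τ • v ∈ interior carrier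

namespace Region

variable (s : Region)

/-- The tangent cone contains an open half plane, which spans: any vector becomes an element of it
after subtraction of a multiple of one vector `v₀` in it. -/
theorem uniqueDiffOn : UniqueDiffOn ℝ s.carrier := by
  intro y hy
  obtain ⟨ℓ, hℓ, hs⟩ := s.exists_halfspace y hy
  refine ⟨?_, subset_closure hy⟩
  have hcone : ∀ v, ℓ v < 0 → v ∈ tangentConeAt ℝ s.carrier y := by
    intro v hv
    refine mem_tangentConeAt_of_add_smul_mem (l := 𝓝[>] (0 : ℝ)) (c := id) ?_ ?_
    · exact nhdsGT_le_nhdsNE 0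
    · exact (hs v hv).mono fun τ hτ => interior_subset hτ
  obtain ⟨x, hx⟩ : ∃ x, ℓ x ≠ 0 := by
    by_contra! hcon
    exact hℓ (ContinuousLinearMap.ext hcon)
  obtain ⟨v₀, hv₀⟩ : ∃ v₀, ℓ v₀ < 0 := by
    rcases lt_or_gt_of_ne hx with h | h
    · exact ⟨x, h⟩
    · exact ⟨-x, by simpa using h⟩
  have htop : Submodule.span ℝ (tangentConeAt ℝ s.carrier y) = ⊤ := by
    rw [eq_top_iff]
    intro v _
    by_cases hv : ℓ v < 0
    · exact Submodule.subset_span (hcone v hv)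
    · have h1 : v - ((ℓ v + 1) / ℓ v₀) • v₀ ∈ Submodule.span ℝ (tangentConeAt ℝ s.carrier y) := by
        refine Submodule.subset_span (hcone _ ?_)
        simp [div_mul_cancel₀ _ hv₀.ne]
      have h2 := Submodule.smul_mem _ ((ℓ v + 1) / ℓ v₀) (Submodule.subset_span (hcone v₀ hv₀))
      simpa using Submodule.add_mem _ h1 h2
  rw [htop]
  simp [dense_univ]

/-- Density of the interior is what makes second derivatives symmetric at boundary points too, in
`Sm.pd_comm`. -/
theorem subset_closure_interior : s.carrier ⊆ closure (interior s.carrier) := by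
  intro y hy
  obtain ⟨ℓ, hℓ, hs⟩ := s.exists_halfspace y hy
  obtain ⟨x, hx⟩ : ∃ x, ℓ x ≠ 0 := by
    by_contra! hcon
    exact hℓ (ContinuousLinearMap.ext hcon)
  obtain ⟨v₀, hv₀⟩ : ∃ v₀, ℓ v₀ < 0 := by
    rcases lt_or_gt_of_ne hx with h | h
    · exact ⟨x, h⟩
    · exact ⟨-x, by simpa using h⟩
  refine mem_closure_of_tendsto (b := 𝓝[>] (0 : ℝ)) (f := fun τ : ℝ => y + τ • v₀) ?_ (hs v₀ hv₀)
  have : Filter.Tendsto (fun τ : ℝ => y + τ • v₀) (𝓝 0) (𝓝 (y + (0 : ℝ) • v₀)) :=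
    Continuous.tendsto (by fun_prop) 0
  simp only [zero_smul, add_zero] at this
  exact this.mono_left nhdsWithin_le_nhds

theorem tendsto_add_smul (y v : Plane) :
    Filter.Tendsto (fun τ : ℝ => y + τ • v) (𝓝 0) (𝓝 y) := by
  have : Filter.Tendsto (fun τ : ℝ => y + τ • v) (𝓝 0) (𝓝 (y + (0 : ℝ) • v)) :=
    Continuous.tendsto (by fun_prop) 0
  simpa using this

/-- An open subset of the plane is a region. -/
def ofIsOpen (U : Set Plane) (hU : IsOpen U) : Region where
  carrier := U
  exists_halfspace := by
    intro y hy
    refine ⟨EuclideanSpace.proj 0, ?_, ?_⟩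
    · intro h
      have := DFunLike.congr_fun h (EuclideanSpace.single 0 1)
      simp at this
    · intro v _
      rw [hU.interior_eq]
      exact nhdsWithin_le_nhds ((tendsto_add_smul y v).eventually (hU.mem_nhds hy))

end Region

/-! ### The algebra of smooth functions on a region -/

/-- The extension by zero of a function on a subset of the plane. -/
def extendZero {t : Set Plane} (φ : t → ℝ) (y : Plane) : ℝ :=
  open Classical in if h : y ∈ t then φ ⟨y, h⟩ else 0

theorem extendZero_of_mem {t : Set Plane} (φ : t → ℝ) (y : t) : extendZero φ y = φ y := by
  simp [extendZero]

theorem extendZero_eqOn {t : Set Plane} (u : Plane → ℝ) :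
    EqOn (extendZero fun y : t => u y) u t :=
  fun y hy => extendZero_of_mem (fun y : t => u y) ⟨y, hy⟩

theorem extendZero_eqOn' {t : Set Plane} {φ : t → ℝ} {u : Plane → ℝ} (h : ∀ y : t, φ y = u y) :
    EqOn (extendZero φ) u t :=
  fun y hy => (extendZero_of_mem φ ⟨y, hy⟩).trans (h ⟨y, hy⟩)

/-- The algebra of functions on a region that are smooth up to the boundary. -/
def smoothSubalgebra (s : Region) : Subalgebra ℝ (s.carrier → ℝ) where
  carrier := {φ | ContDiffOn ℝ ∞ (extendZero φ) s.carrier}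
  mul_mem' {φ ψ} hφ hψ := (ContDiffOn.mul hφ hψ).congr <| extendZero_eqOn' fun y => by
    simp [extendZero_of_mem]
  add_mem' {φ ψ} hφ hψ := (ContDiffOn.add hφ hψ).congr <| extendZero_eqOn' fun y => by
    simp [extendZero_of_mem]
  algebraMap_mem' c := (contDiffOn_const (c := c)).congr <| extendZero_eqOn' fun y => by simp

/-- The type of functions on a region that are smooth up to the boundary. -/
def Sm (s : Region) : Type := smoothSubalgebra s

namespace Sm

variable {s : Region}

instance : CommRing (Sm s) := inferInstanceAs (CommRing (smoothSubalgebra s))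

instance : Algebra ℝ (Sm s) := inferInstanceAs (Algebra ℝ (smoothSubalgebra s))

/-- The element of `Sm s` given by a function that is smooth on the region. -/
def ofFun (u : Plane → ℝ) (hu : ContDiffOn ℝ ∞ u s.carrier) : Sm s :=
  ⟨fun y => u y, hu.congr (extendZero_eqOn u)⟩

/-- The extension by zero of an element of `Sm s`. -/
def ext₀ (φ : Sm s) : Plane → ℝ := extendZero φ.1

theorem contDiffOn (φ : Sm s) : ContDiffOn ℝ ∞ φ.ext₀ s.carrier := φ.2

/-- Evaluation at a point. -/
def ev (y : s.carrier) : Sm s →ₐ[ℝ] ℝ :=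
  (Pi.evalAlgHom ℝ (fun _ => ℝ) y).comp (smoothSubalgebra s).val

theorem ext₀_apply (φ : Sm s) (y : s.carrier) : φ.ext₀ y = ev y φ := extendZero_of_mem φ.1 y

@[simp] theorem ev_ofFun (u : Plane → ℝ) (hu) (y : s.carrier) : ev y (ofFun u hu) = u y := rfl

theorem ext_ev {φ ψ : Sm s} (h : ∀ y, ev y φ = ev y ψ) : φ = ψ := Subtype.ext (funext h)

theorem ext₀_eqOn {φ : Sm s} {u : Plane → ℝ} (h : ∀ y : s.carrier, ev y φ = u y) :
    EqOn φ.ext₀ u s.carrier := extendZero_eqOn' h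

theorem differentiableWithinAt (φ : Sm s) (y : s.carrier) :
    DifferentiableWithinAt ℝ φ.ext₀ s.carrier y :=
  φ.contDiffOn.differentiableOn (by simp) y y.2

/-- The partial derivatives on `Sm s`. -/
def pd (k : Fin 2) : Derivation ℝ (Sm s) (Sm s) :=
  Derivation.mk'
    { toFun := fun φ => ofFun (fun y => fderivWithin ℝ φ.ext₀ s.carrier y (stdVec k))
        ((φ.contDiffOn.fderivWithin s.uniqueDiffOn (m := ∞) (by simp)).clm_apply contDiffOn_const)
      map_add' := fun φ ψ => ext_ev fun y => by
        have h : fderivWithin ℝ (φ + ψ).ext₀ s.carrier y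
            = fderivWithin ℝ (φ.ext₀ + ψ.ext₀) s.carrier y :=
          fderivWithin_congr (ext₀_eqOn fun y => by simp [ext₀_apply]) (by simp [ext₀_apply])
        simp [h, fderivWithin_add (s.uniqueDiffOn y y.2) (φ.differentiableWithinAt y)
          (ψ.differentiableWithinAt y)]
      map_smul' := fun c φ => ext_ev fun y => by
        have h : fderivWithin ℝ (c • φ).ext₀ s.carrier y
            = fderivWithin ℝ (c • φ.ext₀) s.carrier y :=
          fderivWithin_congr (ext₀_eqOn fun y => by simp [ext₀_apply]) (by simp [ext₀_apply])
        simp [h, fderivWithin_const_smul (s.uniqueDiffOn y y.2) (φ.differentiableWithinAt y)] }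
    (fun φ ψ => ext_ev fun y => by
        have h : fderivWithin ℝ (φ * ψ).ext₀ s.carrier y
            = fderivWithin ℝ (φ.ext₀ * ψ.ext₀) s.carrier y :=
          fderivWithin_congr (ext₀_eqOn fun y => by simp [ext₀_apply]) (by simp [ext₀_apply])
        simp [h, fderivWithin_mul (s.uniqueDiffOn y y.2) (φ.differentiableWithinAt y)
          (ψ.differentiableWithinAt y), ext₀_apply])

theorem ev_pd (k : Fin 2) (φ : Sm s) (y : s.carrier) :
    ev y (pd k φ) = fderivWithin ℝ φ.ext₀ s.carrier y (stdVec k) := rfl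

theorem ev_pd_of_eqOn {φ : Sm s} {u : Plane → ℝ} (h : ∀ y : s.carrier, ev y φ = u y) (k : Fin 2)
    (y : s.carrier) : ev y (pd k φ) = fderivWithin ℝ u s.carrier y (stdVec k) := by
  rw [ev_pd, fderivWithin_congr (ext₀_eqOn h) (by rw [ext₀_apply, h])]

theorem sum_smul_stdVec (v : Plane) : ∑ k, v k • stdVec k = v := by
  ext j
  fin_cases j <;> simp [stdVec]

theorem fderivWithin_ext₀ (φ : Sm s) (y : s.carrier) (v : Plane) :
    fderivWithin ℝ φ.ext₀ s.carrier y v = ∑ k, v k * ev y (pd k φ) := by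
  conv_lhs => rw [← sum_smul_stdVec v]
  simp [ev_pd]

/-- Partial derivatives commute. -/
theorem pd_comm (k l : Fin 2) (φ : Sm s) : pd k (pd l φ) = pd l (pd k φ) := by
  have key : ∀ (y : s.carrier) (a b : Fin 2), ev y (pd a (pd b φ)) =
      fderivWithin ℝ (fderivWithin ℝ φ.ext₀ s.carrier) s.carrier y (stdVec a) (stdVec b) := by
    intro y a b
    have hd : DifferentiableWithinAt ℝ (fderivWithin ℝ φ.ext₀ s.carrier) s.carrier y :=
      (φ.contDiffOn.fderivWithin s.uniqueDiffOn (m := ∞) (by simp)).differentiableOn (by simp) y y.2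
    rw [ev_pd_of_eqOn (u := fun z => fderivWithin ℝ φ.ext₀ s.carrier z (stdVec b))
      (fun z => ev_pd b φ z), fderivWithin_clm_apply (s.uniqueDiffOn y y.2) hd
      (differentiableWithinAt_const _)]
    simp
  refine ext_ev fun y => ?_
  rw [key, key]
  have hsym : IsSymmSndFDerivWithinAt ℝ φ.ext₀ s.carrier y :=
    (φ.contDiffOn y y.2).isSymmSndFDerivWithinAt (n := ∞)
      (by simpa using WithTop.coe_le_coe.2 (le_top : (2 : ℕ∞) ≤ ⊤))
      s.uniqueDiffOn
      (s.subset_closure_interior y.2) y.2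
  exact hsym _ _

/-! ### Extrema -/

theorem hasFDerivAt_ext₀ (φ : Sm s) (y : s.carrier) (hy : (y : Plane) ∈ interior s.carrier) :
    HasFDerivAt φ.ext₀ (fderivWithin ℝ φ.ext₀ s.carrier y) y :=
  (φ.differentiableWithinAt y).hasFDerivWithinAt.hasFDerivAt (mem_interior_iff_mem_nhds.1 hy)

theorem hasDerivAt_ext₀_line (φ : Sm s) {y v : Plane} {τ : ℝ}
    (hy : y + τ • v ∈ interior s.carrier) :
    HasDerivAt (fun τ : ℝ => φ.ext₀ (y + τ • v)) (∑ k, v k * (pd k φ).ext₀ (y + τ • v)) τ := by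
  have h1 := φ.hasFDerivAt_ext₀ ⟨_, interior_subset hy⟩ hy
  have h2 : HasDerivAt (fun τ : ℝ => y + τ • v) v τ := by
    simpa using ((hasDerivAt_id τ).smul_const v).const_add y
  have h3 := HasFDerivAt.comp_hasDerivAt τ h1 h2
  have h4 := φ.fderivWithin_ext₀ ⟨_, interior_subset hy⟩ v
  simp only [← ext₀_apply] at h4
  rw [h4] at h3
  exact h3

/-- At an interior maximum the first derivatives vanish and the Hessian is non-positive. -/
theorem interior_max (φ : Sm s) (y : s.carrier) (hy : (y : Plane) ∈ interior s.carrier)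
    (hmax : ∀ z, ev z φ ≤ ev y φ) :
    (∀ k, ev y (pd k φ) = 0) ∧
      ∀ v : Fin 2 → ℝ, ∑ k, ∑ l, v k * v l * ev y (pd k (pd l φ)) ≤ 0 := by
  have hs : s.carrier ∈ 𝓝 (y : Plane) := mem_interior_iff_mem_nhds.1 hy
  have hloc : IsLocalMax φ.ext₀ y := by
    filter_upwards [hs] with z hz
    have := hmax ⟨z, hz⟩
    rwa [← ext₀_apply, ← ext₀_apply] at this
  have hzero := hloc.hasFDerivAt_eq_zero (φ.hasFDerivAt_ext₀ y hy)
  have hpd : ∀ k, ev y (pd k φ) = 0 := fun k => by rw [ev_pd, hzero]; simp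
  refine ⟨hpd, fun v => ?_⟩
  set w : Plane := WithLp.toLp 2 v
  have hwv : ∀ k, w k = v k := fun k => rfl
  have hev : ∀ᶠ τ in 𝓝 (0 : ℝ), (y : Plane) + τ • w ∈ interior s.carrier :=
    (Region.tendsto_add_smul y w).eventually (isOpen_interior.mem_nhds hy)
  have hd1 : deriv (fun τ : ℝ => φ.ext₀ (y + τ • w))
      =ᶠ[𝓝 0] fun τ => ∑ k, w k * (pd k φ).ext₀ (y + τ • w) :=
    hev.mono fun τ hτ => (φ.hasDerivAt_ext₀_line hτ).deriv
  have h0 : (y : Plane) + (0 : ℝ) • w ∈ interior s.carrier := by simpa using hy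
  have hd2 : deriv (deriv fun τ : ℝ => φ.ext₀ (y + τ • w)) 0
      = ∑ k, ∑ l, v k * v l * ev y (pd k (pd l φ)) := by
    rw [hd1.deriv_eq]
    have := HasDerivAt.fun_sum (u := Finset.univ) fun l _ =>
      ((pd l φ).hasDerivAt_ext₀_line (v := w) h0).const_mul (w l)
    rw [this.deriv, Finset.sum_comm]
    refine Finset.sum_congr rfl fun l _ => ?_
    rw [Finset.mul_sum]
    refine Finset.sum_congr rfl fun k _ => ?_
    simp only [zero_smul, add_zero, hwv, ext₀_apply]
    ring
  have hd0 : deriv (fun τ : ℝ => φ.ext₀ (y + τ • w)) 0 = 0 := by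
    rw [hd1.self_of_nhds]
    simp [ext₀_apply, hpd]
  rw [← hd2]
  -- A positive second derivative would make `0` a strict-type minimum by the second derivative
  -- test. Being also a local maximum, the function would be locally constant along the line, with
  -- second derivative zero.
  by_contra! hpos
  have hc : ContinuousAt (fun τ : ℝ => φ.ext₀ (y + τ • w)) 0 :=
    (φ.hasDerivAt_ext₀_line h0).continuousAt
  have hmin := isLocalMin_of_deriv_deriv_pos hpos hd0 hc
  have hmax1 : IsLocalMax (fun τ : ℝ => φ.ext₀ (y + τ • w)) 0 := by
    have := (Region.tendsto_add_smul (y : Plane) w).eventually hloc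
    filter_upwards [this] with τ hτ
    simpa using hτ
  have hconst : (fun τ : ℝ => φ.ext₀ (y + τ • w)) =ᶠ[𝓝 0] fun _ => φ.ext₀ y := by
    filter_upwards [hmin, hmax1] with τ h1 h2
    simp only [zero_smul, add_zero] at h1 h2
    exact le_antisymm h2 h1
  have : deriv (deriv fun τ : ℝ => φ.ext₀ (y + τ • w)) 0 = 0 := by
    rw [hconst.deriv.deriv_eq]
    simp
  linarith

/-- If `φ` and `h` attain their maximum over the region at `y` and `dh ≠ 0` there, then `dφ` is a
non-negative multiple of `dh`. -/
theorem boundary_max (φ h : Sm s) (y : s.carrier) (hφ : ∀ z, ev z φ ≤ ev y φ)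
    (hh : ∀ z, ev z h ≤ ev y h) (hne : ∃ k, ev y (pd k h) ≠ 0) :
    ∃ m : ℝ, 0 ≤ m ∧ ∀ k, ev y (pd k φ) = m * ev y (pd k h) := by
  obtain ⟨ℓ, hℓ, hcone⟩ := s.exists_halfspace y y.2
  -- Both differentials are non-positive on the same inward half plane, so both are non-negative
  -- multiples of the same functional `ℓ`.
  have key : ∀ ψ : Sm s, (∀ z, ev z ψ ≤ ev y ψ) → ∃ c : ℝ, 0 ≤ c ∧
      ∀ v, fderivWithin ℝ ψ.ext₀ s.carrier y v = c * ℓ v := by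
    intro ψ hψ
    refine exists_nonneg_smul_of_nonpos_on_halfspace (ℓ : Plane →ₗ[ℝ] ℝ)
      (fderivWithin ℝ ψ.ext₀ s.carrier y : Plane →ₗ[ℝ] ℝ) ?_ ?_
    · intro h0
      exact hℓ (ContinuousLinearMap.ext fun v => DFunLike.congr_fun h0 v)
    · intro v hv
      have hloc : IsLocalMaxOn ψ.ext₀ s.carrier y := by
        refine IsMaxOn.localize fun z hz => ?_
        have := hψ ⟨z, hz⟩
        rwa [← ext₀_apply, ← ext₀_apply] at this
      refine hloc.fderivWithin_nonpos (mem_posTangentConeAt_of_frequently_mem ?_)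
      exact ((hcone v hv).mono fun τ hτ => interior_subset hτ).frequently
  obtain ⟨c, hc, hcφ⟩ := key φ hφ
  obtain ⟨d, hd, hdh⟩ := key h hh
  have hd0 : d ≠ 0 := by
    rintro rfl
    obtain ⟨k, hk⟩ := hne
    exact hk (by rw [ev_pd, hdh]; simp)
  refine ⟨c / d, div_nonneg hc hd, fun k => ?_⟩
  rw [ev_pd, ev_pd, hcφ, hdh]
  field_simp

/-! ### Composition with smooth maps -/

/-- Composition with a smooth map of regions. -/
def pull {s' : Region} (v : Plane → Plane) (hv : ContDiffOn ℝ ∞ v s.carrier)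
    (hm : MapsTo v s.carrier s'.carrier) : Sm s' →ₐ[ℝ] Sm s where
  toFun φ := ofFun (φ.ext₀ ∘ v) (φ.contDiffOn.comp hv hm)
  map_one' := ext_ev fun y => by simp [ext₀_apply _ ⟨v y, hm y.2⟩]
  map_mul' φ ψ := ext_ev fun y => by simp [ext₀_apply _ ⟨v y, hm y.2⟩]
  map_zero' := ext_ev fun y => by simp [ext₀_apply _ ⟨v y, hm y.2⟩]
  map_add' φ ψ := ext_ev fun y => by simp [ext₀_apply _ ⟨v y, hm y.2⟩]
  commutes' c := ext_ev fun y => by simp [ext₀_apply _ ⟨v y, hm y.2⟩]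

theorem ev_pull {s' : Region} (v : Plane → Plane) (hv : ContDiffOn ℝ ∞ v s.carrier)
    (hm : MapsTo v s.carrier s'.carrier) (φ : Sm s') (y : s.carrier) :
    ev y (pull v hv hm φ) = ev ⟨v y, hm y.2⟩ φ := ext₀_apply φ ⟨v y, hm y.2⟩

/-- The components of a smooth map. -/
def component (v : Plane → Plane) (hv : ContDiffOn ℝ ∞ v s.carrier) (c : Fin 2) : Sm s :=
  ofFun (fun y => v y c) ((EuclideanSpace.proj (𝕜 := ℝ) c).contDiff.comp_contDiffOn hv)

theorem ev_pd_component (v : Plane → Plane) (hv : ContDiffOn ℝ ∞ v s.carrier) (k c : Fin 2)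
    (y : s.carrier) :
    ev y (pd k (component v hv c)) = fderivWithin ℝ v s.carrier y (stdVec k) c := by
  have hd : DifferentiableWithinAt ℝ v s.carrier y := hv.differentiableOn (by simp) y y.2
  have h := ((EuclideanSpace.proj (𝕜 := ℝ) c : Plane →L[ℝ] ℝ).hasFDerivAt.comp_hasFDerivWithinAt
    (y : Plane) hd.hasFDerivWithinAt).fderivWithin (s.uniqueDiffOn y y.2)
  rw [ev_pd_of_eqOn (u := fun y => v y c) (fun _ => rfl)]
  exact DFunLike.congr_fun h (stdVec k)

/-- The chain rule. -/
theorem pd_pull {s' : Region} (v : Plane → Plane) (hv : ContDiffOn ℝ ∞ v s.carrier)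
    (hm : MapsTo v s.carrier s'.carrier) (φ : Sm s') (k : Fin 2) :
    pd k (pull v hv hm φ) = ∑ c, pd k (component v hv c) * pull v hv hm (pd c φ) := by
  refine ext_ev fun y => ?_
  have hd : DifferentiableWithinAt ℝ v s.carrier y := hv.differentiableOn (by simp) y y.2
  rw [ev_pd_of_eqOn (u := φ.ext₀ ∘ v) (fun _ => rfl),
    fderivWithin_comp (y : Plane) (φ.differentiableWithinAt ⟨v y, hm y.2⟩) hd hm
      (s.uniqueDiffOn y y.2)]
  have := φ.fderivWithin_ext₀ ⟨v y, hm y.2⟩ (fderivWithin ℝ v s.carrier y (stdVec k))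
  simp only [ContinuousLinearMap.comp_apply, map_sum, map_mul, ev_pull, ev_pd_component]
  exact this

/-- Post-composition of an element with a function that is smooth on an open set of values. -/
def compFun (F : ℝ → ℝ) (U : Set ℝ) (hF : ContDiffOn ℝ ∞ F U) (φ : Sm s)
    (hφ : ∀ y, ev y φ ∈ U) : Sm s :=
  ofFun (F ∘ φ.ext₀) (hF.comp φ.contDiffOn fun y hy => by
    rw [ext₀_apply φ ⟨y, hy⟩]; exact hφ _)

theorem ev_compFun (F : ℝ → ℝ) (U : Set ℝ) (hF : ContDiffOn ℝ ∞ F U) (φ : Sm s)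
    (hφ : ∀ y, ev y φ ∈ U) (y : s.carrier) : ev y (compFun F U hF φ hφ) = F (ev y φ) := by
  rw [← ext₀_apply φ]; rfl

end Sm

/-! ### Frames along a map -/

section FrameAlgebra

variable {A : Type*} [CommRing A]

/-- The coefficients `(X₁, -X₀)` of `X` evaluated on the rotated frame `(E₁, -E₀)`. -/
def rot (X : Fin 2 → A) : Fin 2 → A := ![X 1, -X 0]

@[simp] theorem rot_zero (X : Fin 2 → A) : rot X 0 = X 1 := rfl

@[simp] theorem rot_one (X : Fin 2 → A) : rot X 1 = -X 0 := rfl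

/-- A bilinear form with coefficients `g`, evaluated on two vectors. -/
def bil (g : Fin 2 → Fin 2 → A) (X Y : Fin 2 → A) : A := ∑ i, ∑ j, g i j * X i * Y j

/-- Orthonormality of a frame. -/
def IsOrthonormalFrame (g : Fin 2 → Fin 2 → A) (F : Fin 2 → Fin 2 → A) : Prop :=
  ∀ a b, bil g (F a) (F b) = if a = b then 1 else 0

variable {g : Fin 2 → Fin 2 → A} {F : Fin 2 → Fin 2 → A}

theorem bil_comm (hg : ∀ i j, g i j = g j i) (X Y : Fin 2 → A) : bil g X Y = bil g Y X := by
  simp only [bil, Fin.sum_univ_two, hg 1 0]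
  ring

/-- The expansion of a vector in an orthonormal frame. -/
theorem IsOrthonormalFrame.expand (hF : IsOrthonormalFrame g F) (X : Fin 2 → A) (k : Fin 2) :
    X k = ∑ a, bil g (F a) X * F a k := by
  have h1 : (Matrix.of F * Matrix.of g) * (Matrix.of F).transpose = 1 := by
    ext a b
    rw [Matrix.one_apply, ← hF a b]
    simp only [Matrix.mul_apply, Matrix.of_apply, Matrix.transpose_apply, bil, Fin.sum_univ_two]
    ring
  -- For square matrices a one-sided inverse is two-sided, so orthonormality of the frame turns into
  -- completeness.
  have h2 := mul_eq_one_comm.1 h1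
  have h3 : ∀ i, ∑ a, F a k * ∑ j, F a j * g j i = if k = i then 1 else 0 := by
    intro i
    have := congrFun (congrFun h2 k) i
    simpa [Matrix.mul_apply, Matrix.one_apply] using this
  have h30 := h3 0
  have h31 := h3 1
  simp only [Fin.sum_univ_two] at h30 h31
  simp only [bil, Fin.sum_univ_two]
  fin_cases k
  · simp only [Fin.zero_eta, Fin.isValue, if_true, zero_ne_one, if_false] at *
    linear_combination (-X 0) * h30 - X 1 * h31
  · simp only [Fin.mk_one, Fin.isValue, if_true, one_ne_zero, if_false] at *
    linear_combination (-X 0) * h30 - X 1 * h31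

/-- Pairing the relation with each frame vector isolates a coefficient. This reads vector equations
componentwise over a mere commutative ring. -/
theorem IsOrthonormalFrame.coeff_eq_zero (hF : IsOrthonormalFrame g F) {x y : A}
    (h : ∀ k, x * F 0 k + y * F 1 k = 0) : x = 0 ∧ y = 0 := by
  have h00 := hF 0 0
  have h01 := hF 0 1
  have h10 := hF 1 0
  have h11 := hF 1 1
  simp only [bil, Fin.sum_univ_two, if_true, Fin.isValue, zero_ne_one, one_ne_zero, if_false]
    at h00 h01 h10 h11
  have k0 := h 0
  have k1 := h 1
  constructor
  · linear_combination (F 0 0 * g 0 0 + F 0 1 * g 1 0) * k0 + (F 0 0 * g 0 1 + F 0 1 * g 1 1) * k1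
      - x * h00 - y * h01
  · linear_combination (F 1 0 * g 0 0 + F 1 1 * g 1 0) * k0 + (F 1 0 * g 0 1 + F 1 1 * g 1 1) * k1
      - x * h10 - y * h11

variable [Algebra ℝ A]

/-- The covariant derivative of a vector field `X` along a map, where `U` is the velocity of the
map in the direction of the derivation `D`. -/
def covDeriv (Γ : Fin 2 → Fin 2 → Fin 2 → A) (D : Derivation ℝ A A) (U X : Fin 2 → A) : Fin 2 → A :=
  fun k => D (X k) + ∑ i, ∑ j, Γ k i j * U i * X j

/-- Compatibility of the connection `Γ` with the metric `g` in the direction of `D`. -/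
def IsCompatible (g : Fin 2 → Fin 2 → A) (Γ : Fin 2 → Fin 2 → Fin 2 → A) (D : Derivation ℝ A A)
    (U : Fin 2 → A) : Prop :=
  ∀ i j, D (g i j) = ∑ c, U c * ∑ l, (g i l * Γ l c j + g j l * Γ l c i)

variable {Γ : Fin 2 → Fin 2 → Fin 2 → A} {D : Derivation ℝ A A} {U : Fin 2 → A}

theorem IsCompatible.deriv_bil (h : IsCompatible g Γ D U) (hg : ∀ i j, g i j = g j i)
    (X Y : Fin 2 → A) :
    D (bil g X Y) = bil g (covDeriv Γ D U X) Y + bil g X (covDeriv Γ D U Y) := by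
  have h00 := h 0 0
  have h01 := h 0 1
  have h11 := h 1 1
  simp only [Fin.sum_univ_two, hg 1 0] at h00 h01 h11
  simp only [bil, covDeriv, Fin.sum_univ_two, hg 1 0, map_add, Derivation.leibniz, smul_eq_mul,
    h00, h01, h11]
  ring

/-- The covariant derivative of an orthonormal frame is an infinitesimal rotation. -/
theorem IsOrthonormalFrame.covDeriv_eq (hF : IsOrthonormalFrame g F) (h : IsCompatible g Γ D U)
    (hg : ∀ i j, g i j = g j i) :
    (∀ k, covDeriv Γ D U (F 0) k = bil g (F 1) (covDeriv Γ D U (F 0)) * F 1 k) ∧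
      ∀ k, covDeriv Γ D U (F 1) k = -bil g (F 1) (covDeriv Γ D U (F 0)) * F 0 k := by
  -- Constant length gives only twice the diagonal coefficient equal to zero; `2` is invertible
  -- because `A` is a real algebra.
  have h2 : IsUnit (2 : A) := by
    have := (isUnit_iff_ne_zero.2 (two_ne_zero (α := ℝ))).map (algebraMap ℝ A)
    rwa [map_ofNat] at this
  have e : ∀ a b, bil g (covDeriv Γ D U (F a)) (F b) + bil g (F a) (covDeriv Γ D U (F b)) = 0 := by
    intro a b
    rw [← h.deriv_bil hg, hF a b]
    split_ifs <;> simp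
  have d : ∀ a, bil g (F a) (covDeriv Γ D U (F a)) = 0 := by
    intro a
    have := e a a
    rw [bil_comm hg, ← two_mul] at this
    exact h2.mul_right_eq_zero.1 this
  have e10 := e 0 1
  rw [bil_comm hg] at e10
  constructor
  · intro k
    rw [hF.expand (covDeriv Γ D U (F 0)) k, Fin.sum_univ_two, d 0]
    ring
  · intro k
    rw [hF.expand (covDeriv Γ D U (F 1)) k, Fin.sum_univ_two, d 1]
    linear_combination F 0 k * e10

/-- The derivative of `dφ(X)`, where `d` and `H` are the differential and the Hessian of `φ`. -/
theorem deriv_pairing {d : Fin 2 → A} {H : Fin 2 → Fin 2 → A}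
    (hd : ∀ k, D (d k) = ∑ c, U c * (H c k + ∑ m, Γ m c k * d m)) (X : Fin 2 → A) :
    D (∑ k, d k * X k) = bil H U X + ∑ k, d k * covDeriv Γ D U X k := by
  simp only [bil, covDeriv, Fin.sum_univ_two, map_add, Derivation.leibniz, smul_eq_mul, hd]
  ring

/-- A trilinear form with coefficients `T`, evaluated on three vectors. -/
def tril (T : Fin 2 → Fin 2 → Fin 2 → A) (X Y Z : Fin 2 → A) : A :=
  ∑ c, ∑ i, ∑ j, T c i j * X c * Y i * Z j

/-- The derivative of `H(X, Y)`, where `T` is the covariant derivative of the tensor `H`. -/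
theorem deriv_tensor {H : Fin 2 → Fin 2 → A} {T : Fin 2 → Fin 2 → Fin 2 → A}
    (hH : ∀ i j, D (H i j) = ∑ c, U c * (T c i j + ∑ m, (Γ m c i * H m j + Γ m c j * H i m)))
    (X Y : Fin 2 → A) :
    D (bil H X Y) = tril T U X Y + bil H (covDeriv Γ D U X) Y + bil H X (covDeriv Γ D U Y) := by
  simp only [bil, tril, covDeriv, Fin.sum_univ_two, map_add, Derivation.leibniz, smul_eq_mul, hH]
  ring

/-! ### The polar decomposition of a minimal area preserving map -/

/-- For a minimal area preserving map, the isometric part of the polar decomposition is parallel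
and the symmetric part is a Codazzi tensor. -/
theorem parallel_of_minimal {D : Fin 2 → Derivation ℝ A A} {V : Fin 2 → Fin 2 → A}
    {α β : Fin 2 → A} {p q r : A} (hF : IsOrthonormalFrame g F) (hdet : p * r - q * q = 1)
    (ht : IsUnit (p + r))
    (hβ0 : ∀ i k, covDeriv Γ (D i) (V i) (F 0) k = β i * F 1 k)
    (hβ1 : ∀ i k, covDeriv Γ (D i) (V i) (F 1) k = -β i * F 0 k)
    (hV0 : ∀ k, V 0 k = p * F 0 k + q * F 1 k) (hV1 : ∀ k, V 1 k = q * F 0 k + r * F 1 k)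
    (hsymm : ∀ k, covDeriv Γ (D 0) (V 0) (V 1) k - covDeriv Γ (D 1) (V 1) (V 0) k
      = -α 0 * V 0 k - α 1 * V 1 k)
    (hmin : ∀ k, r * (covDeriv Γ (D 0) (V 0) (V 0) k - α 0 * V 1 k)
      - q * (covDeriv Γ (D 0) (V 0) (V 1) k + α 0 * V 0 k)
      - q * (covDeriv Γ (D 1) (V 1) (V 0) k - α 1 * V 1 k)
      + p * (covDeriv Γ (D 1) (V 1) (V 1) k + α 1 * V 0 k) = 0) :
    β 0 = α 0 ∧ β 1 = α 1 ∧
      D 0 q - α 0 * r + α 0 * p = D 1 p - 2 * α 1 * q ∧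
      D 0 r + 2 * α 0 * q = D 1 q - α 1 * r + α 1 * p := by
  -- Covariant differentiation in the frame `F`: the components are differentiated, and the frame
  -- turns at rate `β`.
  have cV : ∀ (i : Fin 2) (x y : A) (Z : Fin 2 → A), (∀ k, Z k = x * F 0 k + y * F 1 k) →
      ∀ k, covDeriv Γ (D i) (V i) Z k
        = (D i x - β i * y) * F 0 k + (D i y + β i * x) * F 1 k := by
    intro i x y Z hZ k
    have e0 := hβ0 i k
    have e1 := hβ1 i k
    simp only [covDeriv, Fin.sum_univ_two] at e0 e1
    simp only [covDeriv, Fin.sum_univ_two, hZ, map_add, Derivation.leibniz, smul_eq_mul]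
    linear_combination x * e0 + y * e1
  -- The symmetry of the second derivatives of the map gives the Codazzi equations up to terms in `β
  -- - α`.
  have s := hF.coeff_eq_zero
    (x := D 0 q - β 0 * r - (D 1 p - β 1 * q) + α 0 * p + α 1 * q)
    (y := D 0 r + β 0 * q - (D 1 q + β 1 * p) + α 0 * q + α 1 * r) (by
      intro k
      have := hsymm k
      rw [cV 0 q r _ hV1, cV 1 p q _ hV0, hV0, hV1] at this
      linear_combination this)
  -- The components of the minimal surface equation.
  have m := hF.coeff_eq_zero
    (x := r * (D 0 p - β 0 * q - α 0 * q) - q * (D 0 q - β 0 * r + α 0 * p)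
      - q * (D 1 p - β 1 * q - α 1 * q) + p * (D 1 q - β 1 * r + α 1 * p))
    (y := r * (D 0 q + β 0 * p - α 0 * r) - q * (D 0 r + β 0 * q + α 0 * q)
      - q * (D 1 q + β 1 * p - α 1 * r) + p * (D 1 r + β 1 * q + α 1 * q)) (by
      intro k
      have := hmin k
      rw [cV 0 q r _ hV1, cV 1 p q _ hV0, cV 0 p q _ hV0, cV 1 q r _ hV1, hV0, hV1] at this
      linear_combination this)
  obtain ⟨s0, s1⟩ := s
  obtain ⟨m0, m1⟩ := m
  have dd : ∀ i, p * D i r + r * D i p - 2 * q * D i q = 0 := by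
    intro i
    have := congrArg (D i) hdet
    simp only [map_sub, Derivation.leibniz, smul_eq_mul, Derivation.map_one_eq_zero] at this
    linear_combination this
  -- The symmetry equations and the derivative of `det S = 1` eliminate every derivative of `S` from
  -- the minimal surface equation. What remains is a linear system for `β - α`, whose matrix has
  -- determinant `1` once the unit `p + r` is cancelled.
  have u0 : (p + r) * (q * (β 0 - α 0) - p * (β 1 - α 1)) = 0 := by
    linear_combination m0 - dd 0 - q * s0 + p * s1
  have u1 : (p + r) * (r * (β 0 - α 0) - q * (β 1 - α 1)) = 0 := by
    linear_combination m1 - dd 1 - r * s0 + q * s1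
  rw [ht.mul_right_eq_zero] at u0 u1
  have b0 : β 0 = α 0 := by
    linear_combination p * u1 - q * u0 - (β 0 - α 0) * hdet
  have b1 : β 1 = α 1 := by
    linear_combination q * u1 - r * u0 - (β 1 - α 1) * hdet
  refine ⟨b0, b1, ?_, ?_⟩
  · linear_combination s0 + r * b0 - q * b1
  · linear_combination s1 - q * b0 + p * b1

end FrameAlgebra

/-! ### The structure equations of a minimal Lagrangian map -/

/-- The structure equations of a minimal Lagrangian map in an orthonormal frame, together with the
functions `h` and `w` and their covariant derivatives. The matrix `[[p, q], [q, r]]` is the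
symmetric part of the differential of the map and `α` the connection form of the frame. -/
structure MinimalModel (A : Type*) [CommRing A] [Algebra ℝ A] where
  /-- The derivatives along the frame. -/
  D : Fin 2 → Derivation ℝ A A
  /-- The connection form. -/
  α : Fin 2 → A
  /-- An entry of the symmetric part of the differential. -/
  p : A
  /-- An entry of the symmetric part of the differential. -/
  q : A
  /-- An entry of the symmetric part of the differential. -/
  r : A
  /-- A function on the source. -/
  h : A
  /-- The pull-back of a function on the target. -/
  w : A
  /-- The differential of `h`. -/
  dh : Fin 2 → A
  /-- The differential of the function on the target, in the transported frame. -/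
  dk : Fin 2 → A
  /-- The Hessian of `h`. -/
  Hh : Fin 2 → Fin 2 → A
  /-- The Hessian of the function on the target, in the transported frame. -/
  Hk : Fin 2 → Fin 2 → A
  /-- The third covariant derivative of `h`. -/
  Th : Fin 2 → Fin 2 → Fin 2 → A
  /-- The third covariant derivative of the function on the target. -/
  Tk : Fin 2 → Fin 2 → Fin 2 → A
  comm : ∀ x, D 0 (D 1 x) - D 1 (D 0 x) = -α 0 * D 0 x - α 1 * D 1 x
  det_eq : p * r - q * q = 1
  codazzi₀ : D 0 q - α 0 * r + α 0 * p = D 1 p - 2 * α 1 * q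
  codazzi₁ : D 0 r + 2 * α 0 * q = D 1 q - α 1 * r + α 1 * p
  deriv_h : ∀ i, D i h = dh i
  deriv_dh : ∀ i a, D i (dh a) = Hh i a + α i * rot dh a
  deriv_Hh : ∀ i a b, D i (Hh a b) = Th i a b + α i * (rot (fun c => Hh c b) a + rot (Hh a) b)
  deriv_w : D 0 w = p * dk 0 + q * dk 1 ∧ D 1 w = q * dk 0 + r * dk 1
  deriv_dk₀ : ∀ a, D 0 (dk a) = p * Hk 0 a + q * Hk 1 a + α 0 * rot dk a
  deriv_dk₁ : ∀ a, D 1 (dk a) = q * Hk 0 a + r * Hk 1 a + α 1 * rot dk a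
  deriv_Hk₀ : ∀ a b, D 0 (Hk a b) = p * Tk 0 a b + q * Tk 1 a b
    + α 0 * (rot (fun c => Hk c b) a + rot (Hk a) b)
  deriv_Hk₁ : ∀ a b, D 1 (Hk a b) = q * Tk 0 a b + r * Tk 1 a b
    + α 1 * (rot (fun c => Hk c b) a + rot (Hk a) b)

namespace MinimalModel

variable {A : Type*} [CommRing A] [Algebra ℝ A] (M : MinimalModel A)

/-- The Laplace operator of the graph, up to a positive factor. -/
def lap (x : A) : A :=
  M.r * (M.D 0 (M.D 0 x) - M.α 0 * M.D 1 x) - M.q * (M.D 0 (M.D 1 x) + M.α 0 * M.D 0 x)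
    - M.q * (M.D 1 (M.D 0 x) - M.α 1 * M.D 1 x) + M.p * (M.D 1 (M.D 1 x) + M.α 1 * M.D 0 x)

/-- The trace of the symmetric part of the differential. -/
def tr : A := M.p + M.r

/-- The inner product of the gradients of the two functions, identified by the isometric part of
the differential. -/
def pairing : A := M.dh 0 * M.dk 0 + M.dh 1 * M.dk 1

/-- The curvature of the connection form. -/
def curv : A := M.D 0 (M.α 1) - M.D 1 (M.α 0) + M.α 0 * M.α 0 + M.α 1 * M.α 1

theorem lap_add (x y : A) : M.lap (x + y) = M.lap x + M.lap y := by
  simp only [lap, map_add]; ring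

theorem lap_smul (c : ℝ) (x : A) : M.lap (c • x) = c • M.lap x := by
  simp only [lap, Derivation.map_smul]
  simp only [Algebra.smul_def]
  ring

/-- The covariant derivative `S₀₀;₀` of the symmetric part of the differential. -/
def S000 : A := M.D 0 M.p - 2 * M.α 0 * M.q

/-- The covariant derivative `S₀₀;₁` of the symmetric part of the differential. -/
def S001 : A := M.D 1 M.p - 2 * M.α 1 * M.q

/-- The covariant derivative `S₀₁;₁` of the symmetric part of the differential. -/
def S011 : A := M.D 1 M.q - M.α 1 * M.r + M.α 1 * M.p

/-- The covariant derivative `S₁₁;₁` of the symmetric part of the differential. -/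
def S111 : A := M.D 1 M.r + 2 * M.α 1 * M.q

theorem D0p : M.D 0 M.p = M.S000 + 2 * M.α 0 * M.q := by rw [S000]; ring

theorem D1p : M.D 1 M.p = M.S001 + 2 * M.α 1 * M.q := by rw [S001]; ring

theorem D0q : M.D 0 M.q = M.S001 + M.α 0 * M.r - M.α 0 * M.p := by
  rw [S001]; linear_combination M.codazzi₀

theorem D1q : M.D 1 M.q = M.S011 + M.α 1 * M.r - M.α 1 * M.p := by rw [S011]; ring

theorem D0r : M.D 0 M.r = M.S011 - 2 * M.α 0 * M.q := by
  rw [S011]; linear_combination M.codazzi₁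

theorem D1r : M.D 1 M.r = M.S111 - 2 * M.α 1 * M.q := by rw [S111]; ring

/-- Differentiating `det S = 1` shows that the covariant derivative of `S` is trace-free against
`S⁻¹`. With the Codazzi symmetry this says that `S` is divergence-free for `S⁻¹`, which removes the
first-order terms from the Laplacians below. -/
theorem det_deriv₀ : M.r * M.S000 - 2 * M.q * M.S001 + M.p * M.S011 = 0 := by
  have := congrArg (M.D 0) M.det_eq
  simp only [map_sub, Derivation.leibniz, smul_eq_mul, Derivation.map_one_eq_zero, D0p, D0q,
    D0r] at this
  linear_combination this

theorem det_deriv₁ : M.r * M.S001 - 2 * M.q * M.S011 + M.p * M.S111 = 0 := by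
  have := congrArg (M.D 1) M.det_eq
  simp only [map_sub, Derivation.leibniz, smul_eq_mul, Derivation.map_one_eq_zero, D1p, D1q,
    D1r] at this
  linear_combination this

theorem lap_h : M.lap M.h
    = M.r * M.Hh 0 0 - M.q * M.Hh 0 1 - M.q * M.Hh 1 0 + M.p * M.Hh 1 1 := by
  simp only [lap, M.deriv_h, M.deriv_dh, rot_zero, rot_one]
  ring

/-- The Hessian of `w` is `S Hk S` plus derivatives of `S` applied to `dk`. The contraction with
`S⁻¹` turns the first into the trace of `S Hk`, and the rest vanishes by `det_deriv₀` and
`det_deriv₁`. -/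
theorem lap_w : M.lap M.w
    = M.p * M.Hk 0 0 + M.q * M.Hk 0 1 + M.q * M.Hk 1 0 + M.r * M.Hk 1 1 := by
  simp only [lap, M.deriv_w.1, M.deriv_w.2, map_add, Derivation.leibniz, smul_eq_mul, M.deriv_dk₀,
    M.deriv_dk₁, rot_zero, rot_one, D0p, D1p, D0q, D1q, D0r, D1r]
  linear_combination M.dk 0 * M.det_deriv₀ + M.dk 1 * M.det_deriv₁ + (M.p * M.Hk 0 0
    + M.q * M.Hk 0 1 + M.q * M.Hk 1 0 + M.r * M.Hk 1 1) * M.det_eq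

theorem deriv_pairing₀ : M.D 0 M.pairing
    = M.Hh 0 0 * M.dk 0 + M.Hh 0 1 * M.dk 1
      + M.dh 0 * (M.p * M.Hk 0 0 + M.q * M.Hk 1 0)
      + M.dh 1 * (M.p * M.Hk 0 1 + M.q * M.Hk 1 1) := by
  simp only [pairing, map_add, Derivation.leibniz, smul_eq_mul, M.deriv_dh, M.deriv_dk₀, rot_zero,
    rot_one]
  ring

theorem deriv_pairing₁ : M.D 1 M.pairing
    = M.Hh 1 0 * M.dk 0 + M.Hh 1 1 * M.dk 1
      + M.dh 0 * (M.q * M.Hk 0 0 + M.r * M.Hk 1 0)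
      + M.dh 1 * (M.q * M.Hk 0 1 + M.r * M.Hk 1 1) := by
  simp only [pairing, map_add, Derivation.leibniz, smul_eq_mul, M.deriv_dh, M.deriv_dk₁, rot_zero,
    rot_one]
  ring

/-- Since `Q` is parallel, `P` differentiates like an inner product of two gradients in one frame.
Each derivative of `dk` brings a factor `S`, which meets the contracting `S⁻¹`; every term is thus
at most linear in the entries of `S`. -/
theorem lap_pairing : M.lap M.pairing
    = ∑ a, (M.r * M.Th 0 0 a - M.q * M.Th 0 1 a - M.q * M.Th 1 0 a + M.p * M.Th 1 1 a) * M.dk a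
      + 2 * (∑ i, ∑ a, M.Hh i a * M.Hk i a)
      + ∑ a, M.dh a
        * (M.p * M.Tk 0 0 a + M.q * M.Tk 0 1 a + M.q * M.Tk 1 0 a + M.r * M.Tk 1 1 a) := by
  simp only [lap, deriv_pairing₀, deriv_pairing₁, map_add, Derivation.leibniz, smul_eq_mul,
    M.deriv_dk₀, M.deriv_dk₁, M.deriv_dh, M.deriv_Hh, M.deriv_Hk₀, M.deriv_Hk₁, rot_zero, rot_one,
    D0p, D1p, D0q, D1q, D0r, D1r, Fin.sum_univ_two]
  linear_combination (M.dh 0 * M.Hk 0 0 + M.dh 1 * M.Hk 0 1) * M.det_deriv₀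
    + (M.dh 0 * M.Hk 1 0 + M.dh 1 * M.Hk 1 1) * M.det_deriv₁
    + (2 * (M.Hh 0 0 * M.Hk 0 0 + M.Hh 0 1 * M.Hk 0 1 + M.Hh 1 0 * M.Hk 1 0 + M.Hh 1 1 * M.Hk 1 1)
      + M.dh 0 * (M.p * M.Tk 0 0 0 + M.q * M.Tk 0 1 0 + M.q * M.Tk 1 0 0 + M.r * M.Tk 1 1 0)
      + M.dh 1 * (M.p * M.Tk 0 0 1 + M.q * M.Tk 0 1 1 + M.q * M.Tk 1 0 1 + M.r * M.Tk 1 1 1))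
      * M.det_eq

theorem deriv_tr₀ : M.D 0 M.tr = M.S000 + M.S011 := by
  rw [tr, map_add, D0p, D0r]; ring

theorem deriv_tr₁ : M.D 1 M.tr = M.S001 + M.S111 := by
  rw [tr, map_add, D1p, D1r]; ring

/-- The Bochner formula for the trace of the symmetric part of the differential. -/
theorem lap_tr : M.lap M.tr
    = 2 * (M.S001 * M.S001 - M.S000 * M.S011 + M.S011 * M.S011 - M.S001 * M.S111)
      - M.curv * (M.tr * M.tr - 4) := by
  have h2 : ∀ i, M.D i 2 = 0 := fun i => by rw [← one_add_one_eq_two]; simp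
  -- Commuting two derivatives of the entries of `S` produces the curvature; the differentiated
  -- relations `e0` and `e1` then remove the remaining second derivatives.
  have cp := M.comm M.p
  have cq := M.comm M.q
  have cr := M.comm M.r
  have e0 := congrArg (M.D 0) M.det_deriv₀
  have e1 := congrArg (M.D 1) M.det_deriv₁
  simp only [map_add, map_sub, Derivation.leibniz, smul_eq_mul, D0p, D1p, D0q, D1q, D0r, D1r,
    map_zero, h2] at cp cq cr e0 e1
  simp only [lap, deriv_tr₀, deriv_tr₁, map_add]
  simp only [curv, tr]
  linear_combination e0 + e1 + (M.r - M.p) * cq + M.q * cp - M.q * cr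
    - M.α 0 * M.det_deriv₁ + M.α 1 * M.det_deriv₀ + 4 * (M.D 0 (M.α 1) - M.D 1 (M.α 0)
      + M.α 0 * M.α 0 + M.α 1 * M.α 1) * M.det_eq

end MinimalModel

/-! ### Inequalities for symmetric matrices of determinant one -/

/-- The value of the quadratic form with coefficients `H` on `(x, y)`. -/
def quad (H : Fin 2 → Fin 2 → ℝ) (x y : ℝ) : ℝ :=
  H 0 0 * x * x + H 0 1 * x * y + H 1 0 * y * x + H 1 1 * y * y

/-- Because `p r = 1 + q²`, `p` times the contraction with `S⁻¹` is the sum of the values of the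
form at `(1, 0)` and `(q, -p)`. The same identity for the Euclidean form yields the trace, which
`S⁻¹` shares with `S`. -/
theorem trace_inv_mul_ge {p q r θ : ℝ} {H : Fin 2 → Fin 2 → ℝ} (hp : 0 < p)
    (hdet : p * r - q * q = 1) (hH : ∀ x y, θ * (x * x + y * y) ≤ quad H x y) :
    θ * (p + r) ≤ r * H 0 0 - q * H 0 1 - q * H 1 0 + p * H 1 1 := by
  have h1 := hH 1 0
  have h2 := hH q (-p)
  unfold quad at h1 h2
  have : p * (θ * (p + r)) ≤ p * (r * H 0 0 - q * H 0 1 - q * H 1 0 + p * H 1 1) := by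
    have e1 : p * (θ * (p + r)) = θ * (1 + q * q + p * p) := by
      linear_combination θ * hdet
    have e2 : p * (r * H 0 0 - q * H 0 1 - q * H 1 0 + p * H 1 1)
        = H 0 0 + (q * q * H 0 0 - p * q * H 0 1 - p * q * H 1 0 + p * p * H 1 1) := by
      linear_combination H 0 0 * hdet
    rw [e1, e2]
    linarith
  exact le_of_mul_le_mul_left this hp

theorem trace_mul_ge {p q r θ : ℝ} {H : Fin 2 → Fin 2 → ℝ} (hr : 0 < r)
    (hdet : p * r - q * q = 1) (hH : ∀ x y, θ * (x * x + y * y) ≤ quad H x y) :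
    θ * (p + r) ≤ p * H 0 0 + q * H 0 1 + q * H 1 0 + r * H 1 1 := by
  -- Exchanging the diagonal entries and negating `q` interchanges `S` and `S⁻¹`.
  have := trace_inv_mul_ge (q := -q) (r := p) hr (by linarith) hH
  linarith

theorem abs_offdiag_le {p q r : ℝ} (hp : 0 < p) (hr : 0 < r) (hdet : p * r - q * q = 1) :
    |q| ≤ p + r :=
  abs_le_of_sq_le_sq (by nlinarith) (by linarith)

theorem two_le_trace {p q r : ℝ} (hp : 0 < p) (hr : 0 < r) (hdet : p * r - q * q = 1) :
    2 ≤ p + r := by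
  nlinarith [sq_nonneg (p - r), sq_nonneg q]

theorem abs_combination_le {p q r C a b c d : ℝ} (hp : 0 < p) (hr : 0 < r)
    (hdet : p * r - q * q = 1) (ha : |a| ≤ C) (hb : |b| ≤ C) (hc : |c| ≤ C) (hd : |d| ≤ C) :
    |p * a + q * b + q * c + r * d| ≤ 4 * C * (p + r) := by
  have hq := abs_offdiag_le hp hr hdet
  have hC : 0 ≤ C := (abs_nonneg a).trans ha
  have key : ∀ x y : ℝ, |x| ≤ p + r → |y| ≤ C → |x * y| ≤ (p + r) * C := by
    intro x y hx hy
    rw [abs_mul]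
    exact mul_le_mul hx hy (abs_nonneg y) (by linarith)
  have h1 := key p a (by rw [abs_of_pos hp]; linarith) ha
  have h2 := key q b hq hb
  have h3 := key q c hq hc
  have h4 := key r d (by rw [abs_of_pos hr]; linarith) hd
  have e1 := abs_add_le (p * a + q * b + q * c) (r * d)
  have e2 := abs_add_le (p * a + q * b) (q * c)
  have e3 := abs_add_le (p * a) (q * b)
  linarith

theorem abs_combination_inv_le {p q r C a b c d : ℝ} (hp : 0 < p) (hr : 0 < r)
    (hdet : p * r - q * q = 1) (ha : |a| ≤ C) (hb : |b| ≤ C) (hc : |c| ≤ C) (hd : |d| ≤ C) :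
    |r * a - q * b - q * c + p * d| ≤ 4 * C * (p + r) := by
  have := abs_combination_le (q := -q) hr hp (by linarith) ha hb hc hd
  rw [add_comm r p] at this
  convert this using 2
  ring

/-- The gradient term in the formula for the Laplacian of `log (p + r)` is dominated by the square
of the second fundamental form. -/
theorem codazzi_gradient_le {p q r x y z v : ℝ} (hp : 0 < p) (hr : 0 < r)
    (hdet : p * r - q * q = 1) (h0 : r * x - 2 * q * y + p * z = 0)
    (h1 : r * y - 2 * q * z + p * v = 0) :
    r * ((x + z) * (x + z)) - 2 * q * ((x + z) * (y + v)) + p * ((y + v) * (y + v))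
      ≤ (p + r) * (2 * (y * y - x * z + z * z - y * v)) := by
  -- The two trace relations express `x` and `v` by `y` and `z`. After multiplication by `p r` the
  -- left side becomes `(t² - 4) W` and the right side `2 t² W` with `t = p + r`, so only `W ≥ 0` is
  -- needed.
  set W := r * y * y - 2 * q * y * z + p * z * z with hW
  have hW0 : 0 ≤ W := by
    have : 0 ≤ r * W := by
      have : r * W = (r * y - q * z) ^ 2 + z ^ 2 := by
        rw [hW]; linear_combination z ^ 2 * hdet
      rw [this]; positivity
    exact nonneg_of_mul_nonneg_right this hr
  have hx : x = (2 * q * y - p * z) / r := by field_simp; linarith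
  have hv : v = (2 * q * z - r * y) / p := by field_simp; linarith
  have e1 : p * r * (2 * (y * y - x * z + z * z - y * v)) = 2 * (p + r) * W := by
    rw [hx, hv, hW]; field_simp; ring
  have e2 : p * r * (r * ((x + z) * (x + z)) - 2 * q * ((x + z) * (y + v))
      + p * ((y + v) * (y + v))) = ((p + r) ^ 2 - 4) * W := by
    have h4 : (p + r) ^ 2 - 4 = (p - r) ^ 2 + 4 * q ^ 2 := by linear_combination 4 * hdet
    rw [h4, hx, hv, hW]
    field_simp
    ring
  have hpr : 0 < p * r := mul_pos hp hr
  refine le_of_mul_le_mul_left ?_ hpr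
  have : p * r * ((p + r) * (2 * (y * y - x * z + z * z - y * v))) = 2 * (p + r) ^ 2 * W := by
    linear_combination (p + r) * e1
  rw [this, e2]
  nlinarith [mul_nonneg (sq_nonneg (p + r)) hW0]


/-! ### The maximum principle -/

namespace MinimalModel

variable {s : Region} (M : MinimalModel (Sm s))

theorem ev_det (y : s.carrier) :
    Sm.ev y M.p * Sm.ev y M.r - Sm.ev y M.q * Sm.ev y M.q = 1 := by
  simpa using congrArg (Sm.ev y) M.det_eq

/-- At an interior maximum the Laplacian is non-positive. -/
theorem lap_nonpos {E : Fin 2 → Fin 2 → Sm s} (hE : ∀ i x, M.D i x = ∑ k, E i k * Sm.pd k x)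
    {y : s.carrier} (hp : 0 < Sm.ev y M.p) (hy : (y : Plane) ∈ interior s.carrier) {φ : Sm s}
    (hmax : ∀ z, Sm.ev z φ ≤ Sm.ev y φ) : Sm.ev y (M.lap φ) ≤ 0 := by
  obtain ⟨h1, h2⟩ := φ.interior_max y hy hmax
  have d1 : ∀ i, Sm.ev y (M.D i φ) = 0 := by
    intro i
    rw [hE]
    simp [h1]
  have d2 : ∀ j i, Sm.ev y (M.D j (M.D i φ))
      = ∑ k, ∑ l, Sm.ev y (E j k) * Sm.ev y (E i l) * Sm.ev y (Sm.pd k (Sm.pd l φ)) := by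
    intro j i
    rw [hE j, hE i]
    simp only [Fin.sum_univ_two, map_add, Derivation.leibniz, smul_eq_mul, map_mul, h1]
    ring
  set e : Fin 2 → Fin 2 → ℝ := fun i k => Sm.ev y (E i k)
  have q1 := h2 (e 0)
  -- Completing the square with `p r - q² = 1`: `p` times the Laplacian is the sum of the Hessian
  -- along `E 0` and along `q E 0 - p E 1`.
  have q2 := h2 fun k => Sm.ev y M.q * e 0 k - Sm.ev y M.p * e 1 k
  have hdet := M.ev_det y
  rw [lap]
  simp only [map_add, map_sub, map_mul, d1, d2]
  refine nonpos_of_mul_nonpos_right ?_ hp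
  simp only [Fin.sum_univ_two] at q1 q2 ⊢
  refine le_trans (le_of_eq ?_) (add_nonpos q1 q2)
  change Sm.ev y M.p * (Sm.ev y M.r * ((e 0 0 * e 0 0 * _ + _) + _ - _) - _ - _ + _) = _
  linear_combination (e 0 0 * e 0 0 * Sm.ev y (Sm.pd 0 (Sm.pd 0 φ))
    + e 0 0 * e 0 1 * Sm.ev y (Sm.pd 0 (Sm.pd 1 φ))
    + (e 0 1 * e 0 0 * Sm.ev y (Sm.pd 1 (Sm.pd 0 φ))
    + e 0 1 * e 0 1 * Sm.ev y (Sm.pd 1 (Sm.pd 1 φ)))) * hdet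

/-- If `φ` and `h` attain their maximum at `y` and `dh ≠ 0` there, then `dφ` is a non-negative
multiple of `dh`. -/
theorem exists_deriv_eq {E : Fin 2 → Fin 2 → Sm s}
    (hE : ∀ i x, M.D i x = ∑ k, E i k * Sm.pd k x) {y : s.carrier} {φ : Sm s}
    (hφ : ∀ z, Sm.ev z φ ≤ Sm.ev y φ) (hh : ∀ z, Sm.ev z M.h ≤ Sm.ev y M.h)
    (hne : Sm.ev y (M.dh 0) ^ 2 + Sm.ev y (M.dh 1) ^ 2 = 1) :
    ∃ m : ℝ, 0 ≤ m ∧ ∀ i, Sm.ev y (M.D i φ) = m * Sm.ev y (M.dh i) := by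
  obtain ⟨m, hm, hd⟩ := φ.boundary_max M.h y hφ hh (by
    by_contra! hcon
    have : ∀ i, Sm.ev y (M.dh i) = 0 := fun i => by
      rw [← M.deriv_h, hE]
      simp [hcon]
    simp [this] at hne)
  refine ⟨m, hm, fun i => ?_⟩
  rw [← M.deriv_h, hE, hE]
  simp only [map_sum, map_mul, hd, Finset.mul_sum]
  exact Finset.sum_congr rfl fun k _ => by ring

/-- A lower bound for the Laplacian of the logarithm of the trace. -/
theorem lap_log_ge {y : s.carrier} (hp : 0 < Sm.ev y M.p) (hr : 0 < Sm.ev y M.r) {C : ℝ}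
    (hC : |Sm.ev y M.curv| ≤ C) {l : Sm s} (hl : ∀ i, M.tr * M.D i l = M.D i M.tr) :
    -(C * Sm.ev y M.tr) ≤ Sm.ev y (M.lap l) := by
  have hl2 : ∀ j i, M.D j M.tr * M.D i l + M.tr * M.D j (M.D i l) = M.D j (M.D i M.tr) := by
    intro j i
    have := congrArg (M.D j) (hl i)
    simp only [Derivation.leibniz, smul_eq_mul] at this
    linear_combination this
  -- The formula `t² Δ(log t) = t Δt - |∇t|²`, stated without division; the Bochner formula and
  -- `codazzi_gradient_le` then control the right side.
  have key : M.tr * (M.tr * M.lap l) = M.tr * M.lap M.tr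
      - (M.r * (M.D 0 M.tr * M.D 0 M.tr) - 2 * M.q * (M.D 0 M.tr * M.D 1 M.tr)
        + M.p * (M.D 1 M.tr * M.D 1 M.tr)) := by
    simp only [lap]
    linear_combination M.tr * (M.r * hl2 0 0 - M.q * hl2 0 1 - M.q * hl2 1 0 + M.p * hl2 1 1)
      + (-M.r * M.D 0 M.tr + M.q * M.D 1 M.tr + M.tr * (M.p * M.α 1 - M.q * M.α 0)) * hl 0
      + (M.q * M.D 0 M.tr - M.p * M.D 1 M.tr + M.tr * (M.q * M.α 1 - M.r * M.α 0)) * hl 1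
  rw [lap_tr, deriv_tr₀, deriv_tr₁] at key
  have kev := congrArg (Sm.ev y) key
  have h0 := congrArg (Sm.ev y) M.det_deriv₀
  have h1 := congrArg (Sm.ev y) M.det_deriv₁
  simp only [map_add, map_sub, map_mul, map_ofNat, map_zero] at kev h0 h1
  have hdet := M.ev_det y
  have hg := codazzi_gradient_le hp hr hdet h0 h1
  have ht : Sm.ev y M.tr = Sm.ev y M.p + Sm.ev y M.r := by simp [tr]
  have ht2 : 2 ≤ Sm.ev y M.tr := ht ▸ two_le_trace hp hr hdet
  rw [← ht] at hg
  set t := Sm.ev y M.tr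
  have hK := abs_le.1 hC
  have hC0 : 0 ≤ C := (abs_nonneg _).trans hC
  have hk : Sm.ev y M.curv * (t * t - 4) ≤ C * (t * t) := by
    have : Sm.ev y M.curv * (t * t - 4) ≤ C * (t * t - 4) :=
      mul_le_mul_of_nonneg_right hK.2 (by nlinarith)
    linarith
  have htt : t * (t * -(C * t)) ≤ t * (t * Sm.ev y (M.lap l)) := by
    rw [kev]
    have := mul_le_mul_of_nonneg_left hk (show 0 ≤ t by linarith)
    linarith
  have htpos : 0 < t := by linarith
  exact le_of_mul_le_mul_left (le_of_mul_le_mul_left htt htpos) htpos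

end MinimalModel

/-! ### The a priori estimate from local models -/

/-- A local description, near the point `x` of `Ω`, of the functions `h`, `w`, `P` and `T` in terms
of the structure equations of a minimal Lagrangian map, with the bounds `θ` and `C` at `x`. -/
structure LocalModel {N : Type*} [TopologicalSpace N] (Ω : Set N) (h w P T : N → ℝ) (θ C : ℝ)
    (x : N) where
  /-- The coordinate domain. -/
  s : Region
  /-- The structure equations. -/
  M : MinimalModel (Sm s)
  /-- The components of the frame. -/
  E : Fin 2 → Fin 2 → Sm s
  /-- The coordinate parametrization. -/
  c : Plane → N
  /-- The coordinates of `x`. -/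
  y : s.carrier
  deriv_eq : ∀ i φ, M.D i φ = ∑ k, E i k * Sm.pd k φ
  c_y : c y = x
  c_mem : ∀ z : s.carrier, c z ∈ Ω
  ev_h : ∀ z : s.carrier, Sm.ev z M.h = h (c z)
  ev_w : ∀ z : s.carrier, Sm.ev z M.w = w (c z)
  ev_pairing : ∀ z : s.carrier, Sm.ev z M.pairing = P (c z)
  ev_tr : ∀ z : s.carrier, Sm.ev z M.tr = √(T (c z))
  p_pos : ∀ z : s.carrier, 0 < Sm.ev z M.p
  r_pos : ∀ z : s.carrier, 0 < Sm.ev z M.r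
  continuousWithinAt : ∀ (φ : Sm s) (Φ : N → ℝ), (∀ z : s.carrier, Sm.ev z φ = Φ (c z)) →
    ContinuousWithinAt Φ Ω x
  mem_interior : x ∈ interior Ω → (y : Plane) ∈ interior s.carrier
  bound_dh : ∀ a, |Sm.ev y (M.dh a)| ≤ C
  bound_dk : ∀ a, |Sm.ev y (M.dk a)| ≤ C
  bound_Hh : ∀ a b, |Sm.ev y (M.Hh a b)| ≤ C
  bound_Hk : ∀ a b, |Sm.ev y (M.Hk a b)| ≤ C
  bound_Th : ∀ i a b, |Sm.ev y (M.Th i a b)| ≤ C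
  bound_Tk : ∀ i a b, |Sm.ev y (M.Tk i a b)| ≤ C
  bound_curv : |Sm.ev y M.curv| ≤ C
  convex_h : ∀ a b : ℝ, θ * (a * a + b * b) ≤ quad (fun i j => Sm.ev y (M.Hh i j)) a b
  convex_k : ∀ a b : ℝ, θ * (a * a + b * b) ≤ quad (fun i j => Sm.ev y (M.Hk i j)) a b
  boundary_h : x ∈ frontier Ω → h x = 0
  boundary_w : x ∈ frontier Ω → w x = 0
  boundary_dh : x ∈ frontier Ω → Sm.ev y (M.dh 0) ^ 2 + Sm.ev y (M.dh 1) ^ 2 = 1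
  boundary_dk : x ∈ frontier Ω → Sm.ev y (M.dk 0) ^ 2 + Sm.ev y (M.dk 1) ^ 2 = 1

namespace LocalModel

variable {N : Type*} [TopologicalSpace N] {Ω : Set N} {h w P T : N → ℝ} {θ C : ℝ} {x : N}

section Pointwise

variable (m : LocalModel Ω h w P T θ C x)

/-- The trace of the symmetric part of the differential at `x`. -/
def t : ℝ := Sm.ev m.y m.M.tr

theorem t_eq : m.t = Sm.ev m.y m.M.p + Sm.ev m.y m.M.r := by simp [t, MinimalModel.tr]

theorem two_le_t : 2 ≤ m.t :=
  m.t_eq ▸ two_le_trace (m.p_pos _) (m.r_pos _) (m.M.ev_det _)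

theorem lap_h_ge : θ * m.t ≤ Sm.ev m.y (m.M.lap m.M.h) := by
  rw [m.t_eq, m.M.lap_h]
  simpa using trace_inv_mul_ge (m.p_pos _) (m.M.ev_det _) m.convex_h

theorem lap_w_ge : θ * m.t ≤ Sm.ev m.y (m.M.lap m.M.w) := by
  rw [m.t_eq, m.M.lap_w]
  simpa using trace_mul_ge (m.r_pos _) (m.M.ev_det _) m.convex_k

theorem lap_h_le : Sm.ev m.y (m.M.lap m.M.h) ≤ 4 * C * m.t := by
  rw [m.t_eq, m.M.lap_h]
  simpa using le_of_abs_le (abs_combination_inv_le (m.p_pos _) (m.r_pos _) (m.M.ev_det _)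
    (m.bound_Hh 0 0) (m.bound_Hh 0 1) (m.bound_Hh 1 0) (m.bound_Hh 1 1))

theorem lap_w_le : Sm.ev m.y (m.M.lap m.M.w) ≤ 4 * C * m.t := by
  rw [m.t_eq, m.M.lap_w]
  simpa using le_of_abs_le (abs_combination_le (m.p_pos _) (m.r_pos _) (m.M.ev_det _)
    (m.bound_Hk 0 0) (m.bound_Hk 0 1) (m.bound_Hk 1 0) (m.bound_Hk 1 1))

theorem lap_pairing_le : Sm.ev m.y (m.M.lap m.M.pairing) ≤ 20 * C ^ 2 * m.t := by
  have hC : 0 ≤ C := (abs_nonneg _).trans (m.bound_dh 0)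
  have ht := m.two_le_t
  have hmul : ∀ {a b A B : ℝ}, |a| ≤ A → |b| ≤ B → a * b ≤ A * B := by
    intro a b A B ha hb
    refine (le_abs_self _).trans ?_
    rw [abs_mul]
    exact mul_le_mul ha hb (abs_nonneg b) ((abs_nonneg a).trans ha)
  have h1 := fun a => hmul (abs_combination_inv_le (m.p_pos m.y) (m.r_pos m.y) (m.M.ev_det m.y)
    (m.bound_Th 0 0 a) (m.bound_Th 0 1 a) (m.bound_Th 1 0 a) (m.bound_Th 1 1 a)) (m.bound_dk a)
  have h2 := fun a => hmul (m.bound_dh a) (abs_combination_le (m.p_pos m.y) (m.r_pos m.y)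
    (m.M.ev_det m.y) (m.bound_Tk 0 0 a) (m.bound_Tk 0 1 a) (m.bound_Tk 1 0 a) (m.bound_Tk 1 1 a))
  have h3 := fun i a => hmul (m.bound_Hh i a) (m.bound_Hk i a)
  rw [← m.t_eq] at h1 h2
  rw [m.M.lap_pairing]
  simp only [Fin.sum_univ_two, map_add, map_sub, map_mul, map_ofNat]
  have h10 := h1 0
  have h11 := h1 1
  have h20 := h2 0
  have h21 := h2 1
  -- Each of the two sums with third derivatives is at most `8 C² t`, and the cross term is at most
  -- `8 C² ≤ 4 C² t` because `t ≥ 2`. This gives the constant `20`.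
  have hCt : C * C * 2 ≤ C * C * m.t := mul_le_mul_of_nonneg_left ht (mul_nonneg hC hC)
  nlinarith [h3 0 0, h3 0 1, h3 1 0, h3 1 1]

theorem ev_tr_pos (z : m.s.carrier) : 0 < Sm.ev z m.M.tr := by
  have := two_le_trace (m.p_pos z) (m.r_pos z) (m.M.ev_det z)
  have e : Sm.ev z m.M.tr = Sm.ev z m.M.p + Sm.ev z m.M.r := by simp [MinimalModel.tr]
  linarith

/-- The logarithm of the trace. -/
def logTr : Sm m.s :=
  Sm.compFun Real.log {0}ᶜ Real.contDiffOn_log m.M.tr fun z =>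
    mem_compl_singleton_iff.2 (m.ev_tr_pos z).ne'

theorem ev_logTr (z : m.s.carrier) : Sm.ev z m.logTr = Real.log (T (m.c z)) / 2 := by
  rw [logTr, Sm.ev_compFun, m.ev_tr, Real.log_sqrt]
  have h1 := m.ev_tr_pos z
  rw [m.ev_tr] at h1
  exact (Real.sqrt_pos.1 h1).le

theorem tr_mul_deriv_logTr (i : Fin 2) : m.M.tr * m.M.D i m.logTr = m.M.D i m.M.tr := by
  have key : ∀ k, m.M.tr * Sm.pd k m.logTr = Sm.pd k m.M.tr := by
    intro k
    refine Sm.ext_ev fun z => ?_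
    have h0 : m.M.tr.ext₀ z ≠ 0 := by rw [Sm.ext₀_apply]; exact (m.ev_tr_pos z).ne'
    have := ((m.M.tr.differentiableWithinAt z).hasFDerivWithinAt.log h0).fderivWithin
      (m.s.uniqueDiffOn z z.2)
    -- The chain rule for the logarithm, in the form `t ∂ₖ (log t) = ∂ₖ t`.
    rw [map_mul, Sm.ev_pd_of_eqOn (u := fun z => Real.log (m.M.tr.ext₀ z)) (fun _ => rfl), this,
      Sm.ev_pd]
    simp only [smul_apply, smul_eq_mul, Sm.ext₀_apply]
    rw [← mul_assoc, mul_inv_cancel₀ (m.ev_tr_pos z).ne', one_mul]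
  rw [m.deriv_eq, m.deriv_eq, Finset.mul_sum]
  refine Finset.sum_congr rfl fun k _ => ?_
  rw [← key k]
  ring

theorem lap_logTr_ge : -(C * m.t) ≤ Sm.ev m.y (m.M.lap m.logTr) :=
  m.M.lap_log_ge (m.p_pos _) (m.r_pos _) m.bound_curv m.tr_mul_deriv_logTr

end Pointwise

/-- A function with positive Laplacian attains its maximum on the boundary. -/
theorem exists_frontier_max (hΩ : IsCompact Ω) (hne : Ω.Nonempty)
    (m : ∀ x ∈ Ω, LocalModel Ω h w P T θ C x) (Φ : N → ℝ)
    (φ : ∀ x (hx : x ∈ Ω), Sm (m x hx).s)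
    (hφ : ∀ x hx (z : (m x hx).s.carrier), Sm.ev z (φ x hx) = Φ ((m x hx).c z))
    (hlap : ∀ x hx, 0 < Sm.ev (m x hx).y ((m x hx).M.lap (φ x hx))) :
    ∃ x₀ ∈ Ω, x₀ ∈ frontier Ω ∧ ∀ x ∈ Ω, Φ x ≤ Φ x₀ := by
  have hcont : ContinuousOn Φ Ω := fun x hx => (m x hx).continuousWithinAt (φ x hx) Φ (hφ x hx)
  obtain ⟨x₀, hx₀, hmax⟩ := hΩ.exists_isMaxOn hne hcont
  refine ⟨x₀, hx₀, ⟨subset_closure hx₀, fun hint => ?_⟩, hmax⟩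
  refine (hlap x₀ hx₀).not_ge ((m x₀ hx₀).M.lap_nonpos (m x₀ hx₀).deriv_eq
    ((m x₀ hx₀).p_pos _) ((m x₀ hx₀).mem_interior hint) fun z => ?_)
  rw [hφ, hφ, (m x₀ hx₀).c_y]
  exact hmax ((m x₀ hx₀).c_mem z)

/-- The derivative at a boundary maximum. -/
theorem exists_deriv_eq (m : LocalModel Ω h w P T θ C x) (hx : x ∈ frontier Ω)
    (hh : ∀ z ∈ Ω, h z ≤ 0) {Φ : N → ℝ} {φ : Sm m.s} (hφ : ∀ z, Sm.ev z φ = Φ (m.c z))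
    (hmax : ∀ z ∈ Ω, Φ z ≤ Φ x) :
    ∃ μ : ℝ, 0 ≤ μ ∧ ∀ i, Sm.ev m.y (m.M.D i φ) = μ * Sm.ev m.y (m.M.dh i) := by
  refine m.M.exists_deriv_eq m.deriv_eq (fun z => ?_) (fun z => ?_) (m.boundary_dh hx)
  · rw [hφ, hφ, m.c_y]
    exact hmax _ (m.c_mem z)
  · rw [m.ev_h, m.ev_h, m.c_y, m.boundary_h hx]
    exact hh _ (m.c_mem z)

/-- On the boundary the differential of `w` is a multiple of the differential of `h`, with a factor
that is bounded from above and from below. -/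
theorem exists_deriv_w_eq (m : LocalModel Ω h w P T θ C x) (hx : x ∈ frontier Ω)
    (hh : ∀ z ∈ Ω, h z ≤ 0) {c : ℝ} (h1 : ∀ z ∈ Ω, h z ≤ c * w z)
    (h2 : ∀ z ∈ Ω, w z ≤ c * h z) :
    ∃ a : ℝ, c ≤ a ∧ c * a ≤ 1 ∧ ∀ i, Sm.ev m.y (m.M.D i m.M.w) = a * Sm.ev m.y (m.M.dh i) := by
  -- The functions `h - c w` and `w - c h` are non-positive and vanish at `x`, so their
  -- differentials are `μ₁ dh` and `μ₂ dh`. Hence `a = c + μ₂` and `c a = 1 - μ₁`.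
  obtain ⟨μ₁, hμ₁, e1⟩ := m.exists_deriv_eq hx hh (Φ := fun z => h z - c * w z)
    (φ := m.M.h + (-c) • m.M.w) (fun z => by simp [m.ev_h, m.ev_w]; ring)
    (fun z hz => by simp only [m.boundary_h hx, m.boundary_w hx]; linarith [h1 z hz])
  obtain ⟨μ₂, hμ₂, e2⟩ := m.exists_deriv_eq hx hh (Φ := fun z => w z - c * h z)
    (φ := m.M.w + (-c) • m.M.h) (fun z => by simp [m.ev_h, m.ev_w]; ring)
    (fun z hz => by simp only [m.boundary_h hx, m.boundary_w hx]; linarith [h2 z hz])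
  simp only [map_add, Derivation.map_smul, map_smul, m.M.deriv_h, smul_eq_mul] at e1 e2
  refine ⟨c + μ₂, by linarith, ?_, fun i => by linarith [e2 i]⟩
  have hd := m.boundary_dh hx
  have key : ∀ i, (1 - μ₁ - c * (c + μ₂)) * Sm.ev m.y (m.M.dh i) = 0 := fun i => by
    linear_combination e1 i + c * e2 i
  have h0 := key 0
  have h1 := key 1
  have : 1 - μ₁ - c * (c + μ₂) = 0 := by
    linear_combination Sm.ev m.y (m.M.dh 0) * h0 + Sm.ev m.y (m.M.dh 1) * h1
      - (1 - μ₁ - c * (c + μ₂)) * hd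
  linarith

/-- Relations between the trace and the pairing at boundary points. -/
theorem boundary_relations (m : LocalModel Ω h w P T θ C x) (hx : x ∈ frontier Ω) {a : ℝ}
    (ha : 0 < a) (hw : ∀ i, Sm.ev m.y (m.M.D i m.M.w) = a * Sm.ev m.y (m.M.dh i)) :
    0 < P x ∧ m.t * (a * P x) = a ^ 2 + 1 := by
  have e0 := hw 0
  have e1 := hw 1
  rw [m.M.deriv_w.1] at e0
  rw [m.M.deriv_w.2] at e1
  have hP := m.ev_pairing m.y
  rw [m.c_y, MinimalModel.pairing] at hP
  simp only [map_add, map_mul] at e0 e1 hP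
  have hdet := m.M.ev_det m.y
  have hk := m.boundary_dk hx
  have hh := m.boundary_dh hx
  have hp := m.p_pos m.y
  rw [m.t_eq]
  set p := Sm.ev m.y m.M.p
  set q := Sm.ev m.y m.M.q
  set r := Sm.ev m.y m.M.r
  set k₀ := Sm.ev m.y (m.M.dk 0)
  set k₁ := Sm.ev m.y (m.M.dk 1)
  set h₀ := Sm.ev m.y (m.M.dh 0)
  set h₁ := Sm.ev m.y (m.M.dh 1)
  -- On the boundary `S dk = a dh` with `dk` and `dh` of length one. So `a P = ⟨S dk, dk⟩`, which is
  -- positive, and `a² = |S dk|²`; the identity `t S = 1 + S²` evaluated on `dk` is the second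
  -- claim.
  have haP : a * P x = k₀ * (p * k₀ + q * k₁) + k₁ * (q * k₀ + r * k₁) := by
    rw [← hP, e0, e1]; ring
  have e2 : a ^ 2 = (p * k₀ + q * k₁) ^ 2 + (q * k₀ + r * k₁) ^ 2 := by
    rw [e0, e1]; linear_combination (-a ^ 2) * hh
  constructor
  · have h3 : 0 < p * (a * P x) := by
      have : p * (a * P x) = (p * k₀ + q * k₁) ^ 2 + k₁ ^ 2 := by
        rw [haP]; linear_combination k₁ ^ 2 * hdet
      rw [this]
      by_contra! hcon
      have hk1 : k₁ = 0 := by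
        have : k₁ ^ 2 ≤ 0 := by linarith [sq_nonneg (p * k₀ + q * k₁)]
        exact pow_eq_zero_iff two_ne_zero |>.1 (le_antisymm this (sq_nonneg _))
      have hk0 : p * k₀ = 0 := by
        rw [hk1] at hcon
        have : (p * k₀) ^ 2 ≤ 0 := by linarith
        exact pow_eq_zero_iff two_ne_zero |>.1 (le_antisymm this (sq_nonneg _))
      have : k₀ = 0 := by simpa [hp.ne'] using hk0
      rw [hk1, this] at hk
      norm_num at hk
    exact pos_of_mul_pos_right (pos_of_mul_pos_right h3 hp.le) ha.le
  · rw [haP, e2]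
    linear_combination hk + (k₀ ^ 2 + k₁ ^ 2) * hdet

set_option maxHeartbeats 400000 in
/-- A lower bound for the pairing at a boundary minimum of `P - A h`. -/
theorem pairing_ge (m : LocalModel Ω h w P T θ C x) (hx : x ∈ frontier Ω) (hθ : 0 < θ)
    (hh : ∀ z ∈ Ω, h z ≤ 0) {c A : ℝ} (hc : 0 < c) (h1 : ∀ z ∈ Ω, h z ≤ c * w z)
    (h2 : ∀ z ∈ Ω, w z ≤ c * h z) (hA : 0 < A)
    (hmax : ∀ z ∈ Ω, A * h z - P z ≤ A * h x - P x) : θ / A ≤ P x := by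
  obtain ⟨a, hca, hac, hw⟩ := m.exists_deriv_w_eq hx hh h1 h2
  have ha : 0 < a := hc.trans_le hca
  obtain ⟨hPpos, -⟩ := m.boundary_relations hx ha hw
  obtain ⟨μ, hμ, hd⟩ := m.exists_deriv_eq hx hh (Φ := fun z => A * h z - P z)
    (φ := A • m.M.h + (-1 : ℝ) • m.M.pairing)
    (fun z => by simp [m.ev_h, m.ev_pairing]; ring) hmax
  have hd0 := hd 0
  have hd1 := hd 1
  have hw0 := hw 0
  have hw1 := hw 1
  have hPe := m.ev_pairing m.y
  rw [m.c_y, MinimalModel.pairing] at hPe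
  rw [m.M.deriv_w.1] at hw0
  rw [m.M.deriv_w.2] at hw1
  simp only [map_add, Derivation.map_smul, map_smul, m.M.deriv_h, m.M.deriv_pairing₀,
    m.M.deriv_pairing₁, smul_eq_mul, map_mul] at hd0 hd1 hw0 hw1 hPe
  have c1 := m.convex_h (Sm.ev m.y (m.M.dk 0)) (Sm.ev m.y (m.M.dk 1))
  have c2 := m.convex_k (Sm.ev m.y (m.M.dh 0)) (Sm.ev m.y (m.M.dh 1))
  have b1 := m.boundary_dk hx
  have b2 := m.boundary_dh hx
  have c1' : θ ≤ quad (fun i j => Sm.ev m.y (m.M.Hh i j)) (Sm.ev m.y (m.M.dk 0))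
      (Sm.ev m.y (m.M.dk 1)) := by
    refine le_trans (le_of_eq ?_) c1
    linear_combination (-θ) * b1
  have c2' : 0 ≤ a * quad (fun i j => Sm.ev m.y (m.M.Hk i j)) (Sm.ev m.y (m.M.dh 0))
      (Sm.ev m.y (m.M.dh 1)) := by
    refine mul_nonneg ha.le (le_trans ?_ c2)
    exact mul_nonneg hθ.le (add_nonneg (mul_self_nonneg _) (mul_self_nonneg _))
  -- Contract `d(A h - P) = μ dh` with `dk`. The relation `S dk = a dh` turns the Hessian of the
  -- target function into the quadratic form at `dh`, so both terms on the right have a sign.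
  have key : (A - μ) * P x = quad (fun i j => Sm.ev m.y (m.M.Hh i j)) (Sm.ev m.y (m.M.dk 0))
      (Sm.ev m.y (m.M.dk 1)) + a * quad (fun i j => Sm.ev m.y (m.M.Hk i j))
      (Sm.ev m.y (m.M.dh 0)) (Sm.ev m.y (m.M.dh 1)) := by
    rw [← hPe]
    simp only [quad]
    linear_combination Sm.ev m.y (m.M.dk 0) * hd0 + Sm.ev m.y (m.M.dk 1) * hd1
      + (Sm.ev m.y (m.M.dh 0) * Sm.ev m.y (m.M.Hk 0 0)
        + Sm.ev m.y (m.M.dh 1) * Sm.ev m.y (m.M.Hk 0 1)) * hw0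
      + (Sm.ev m.y (m.M.dh 0) * Sm.ev m.y (m.M.Hk 1 0)
        + Sm.ev m.y (m.M.dh 1) * Sm.ev m.y (m.M.Hk 1 1)) * hw1
  rw [div_le_iff₀ hA]
  have e : (A - μ) * P x = P x * A - μ * P x := by ring
  linarith [mul_nonneg hμ hPpos.le]

/-- A bound for the trace at boundary points. -/
theorem t_le_of_pairing_ge (m : LocalModel Ω h w P T θ C x) (hx : x ∈ frontier Ω)
    (hh : ∀ z ∈ Ω, h z ≤ 0) {c δ : ℝ} (hc : 0 < c) (h1 : ∀ z ∈ Ω, h z ≤ c * w z)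
    (h2 : ∀ z ∈ Ω, w z ≤ c * h z) (hδ : 0 < δ) (hP : δ ≤ P x) : m.t ≤ (c⁻¹ + c⁻¹) / δ := by
  obtain ⟨a, hca, hac, hw⟩ := m.exists_deriv_w_eq hx hh h1 h2
  have ha : 0 < a := hc.trans_le hca
  obtain ⟨hPpos, htP⟩ := m.boundary_relations hx ha hw
  -- Both summands are at most `c⁻¹` because `c ≤ a ≤ c⁻¹`.
  have e1 : m.t * P x = a + a⁻¹ := by
    field_simp
    linarith
  have e2 : a ≤ c⁻¹ := by
    rw [← one_div, le_div_iff₀ hc]; linarith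
  have e3 : a⁻¹ ≤ c⁻¹ := inv_anti₀ hc hca
  rw [le_div_iff₀ hδ]
  have e4 := mul_le_mul_of_nonneg_left hP (show 0 ≤ m.t by linarith [m.two_le_t])
  linarith

/-- The a priori estimate. -/
theorem exists_bound (hΩ : IsCompact Ω) (hθ : 0 < θ) (hC : 1 ≤ C) {B : ℝ}
    (hB : ∀ x ∈ Ω, -B ≤ h x) :
    ∃ C₄ : ℝ, ∀ w P T : N → ℝ, (∀ x ∈ Ω, Nonempty (LocalModel Ω h w P T θ C x)) →
      ∀ x ∈ Ω, T x ≤ C₄ := by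
  -- The constants make Laplacians positive: `c` leaves `θ t / 2` for `h - c w` and `w - c h`, `A`
  -- leaves `t` for `A h - P`, and `K` leaves `t` for `log t + K h`.
  set c := θ / (8 * C) with hc
  have hc0 : 0 < c := by positivity
  set A := (20 * C ^ 2 + 1) / θ with hA
  have hA0 : 0 < A := by positivity
  set K := (C + 1) / θ with hK
  have hK0 : 0 < K := by positivity
  -- The boundary bound for `t`, with `θ / A` the lower bound for `P`.
  set τ := (c⁻¹ + c⁻¹) / (θ / A) with hτ
  have hτ0 : 0 < τ := by positivity
  -- The factor `2` appears because `T = t²`, and `K B` because `-h ≤ B` at interior points while `h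
  -- = 0` on the boundary.
  refine ⟨Real.exp (2 * (Real.log τ + K * B)), fun w P T hm x hx => ?_⟩
  have hne : Ω.Nonempty := ⟨x, hx⟩
  let m : ∀ x ∈ Ω, LocalModel Ω h w P T θ C x := fun x hx => (hm x hx).some
  -- the functions `h` and `w` are non-positive and comparable
  have hh : ∀ z ∈ Ω, h z ≤ 0 := by
    obtain ⟨x₀, hx₀, hf, hmax⟩ := exists_frontier_max hΩ hne m h (fun x hx => (m x hx).M.h)
      (fun x hx z => (m x hx).ev_h z) (fun x hx => lt_of_lt_of_le
        (mul_pos hθ (by linarith [(m x hx).two_le_t])) (m x hx).lap_h_ge)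
    intro z hz
    rw [← (m x₀ hx₀).boundary_h hf]
    exact hmax z hz
  have h4 : ∀ t : ℝ, 2 ≤ t → 0 < θ * t - c * (4 * C * t) := by
    intro t ht
    have : θ * t - c * (4 * C * t) = θ * t / 2 := by
      rw [hc]; field_simp; ring
    rw [this]
    have : 0 < θ * t := mul_pos hθ (by linarith)
    linarith
  have h1 : ∀ z ∈ Ω, h z ≤ c * w z := by
    obtain ⟨x₀, hx₀, hf, hmax⟩ := exists_frontier_max hΩ hne m (fun z => h z - c * w z)
      (fun x hx => (m x hx).M.h + (-c) • (m x hx).M.w)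
      (fun x hx z => by simp [(m x hx).ev_h, (m x hx).ev_w]; ring) (fun x hx => by
        rw [MinimalModel.lap_add, MinimalModel.lap_smul, map_add, map_smul, smul_eq_mul]
        have e1 := (m x hx).lap_h_ge
        have e2 := mul_le_mul_of_nonneg_left (m x hx).lap_w_le hc0.le
        linarith [h4 _ (m x hx).two_le_t])
    intro z hz
    have := hmax z hz
    simp only [(m x₀ hx₀).boundary_h hf, (m x₀ hx₀).boundary_w hf] at this
    linarith
  have h2 : ∀ z ∈ Ω, w z ≤ c * h z := by
    obtain ⟨x₀, hx₀, hf, hmax⟩ := exists_frontier_max hΩ hne m (fun z => w z - c * h z)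
      (fun x hx => (m x hx).M.w + (-c) • (m x hx).M.h)
      (fun x hx z => by simp [(m x hx).ev_h, (m x hx).ev_w]; ring) (fun x hx => by
        rw [MinimalModel.lap_add, MinimalModel.lap_smul, map_add, map_smul, smul_eq_mul]
        have e1 := (m x hx).lap_w_ge
        have e2 := mul_le_mul_of_nonneg_left (m x hx).lap_h_le hc0.le
        linarith [h4 _ (m x hx).two_le_t])
    intro z hz
    have := hmax z hz
    simp only [(m x₀ hx₀).boundary_h hf, (m x₀ hx₀).boundary_w hf] at this
    linarith
  -- the lower bound for the pairing on the boundary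
  have hP : ∀ z ∈ Ω, z ∈ frontier Ω → θ / A ≤ P z := by
    have hAθ : A * θ = 20 * C ^ 2 + 1 := by rw [hA]; field_simp
    obtain ⟨x₀, hx₀, hf, hmax⟩ := exists_frontier_max hΩ hne m (fun z => A * h z - P z)
      (fun x hx => A • (m x hx).M.h + (-1 : ℝ) • (m x hx).M.pairing)
      (fun x hx z => by simp [(m x hx).ev_h, (m x hx).ev_pairing]; ring) (fun x hx => by
        rw [MinimalModel.lap_add, MinimalModel.lap_smul, MinimalModel.lap_smul, map_add, map_smul,
          map_smul, smul_eq_mul, smul_eq_mul]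
        have e1 := mul_le_mul_of_nonneg_left (m x hx).lap_h_ge hA0.le
        have e2 := (m x hx).lap_pairing_le
        have e3 : A * (θ * (m x hx).t) = 20 * C ^ 2 * (m x hx).t + (m x hx).t := by
          rw [← mul_assoc, hAθ]; ring
        linarith [(m x hx).two_le_t])
    have hx₀P := (m x₀ hx₀).pairing_ge hf hθ hh hc0 h1 h2 hA0 hmax
    intro z hz hzf
    have := hmax z hz
    simp only [(m x₀ hx₀).boundary_h hf, (m z hz).boundary_h hzf] at this
    linarith
  -- the bound for the trace on the boundary
  have ht : ∀ z (hz : z ∈ Ω), z ∈ frontier Ω → (m z hz).t ≤ τ := fun z hz hzf =>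
    (m z hz).t_le_of_pairing_ge hzf hh hc0 h1 h2 (by positivity) (hP z hz hzf)
  -- the interior bound
  have hKθ : K * θ = C + 1 := by rw [hK]; field_simp
  obtain ⟨x₀, hx₀, hf, hmax⟩ := exists_frontier_max hΩ hne m
    (fun z => Real.log (T z) / 2 + K * h z)
    (fun x hx => (m x hx).logTr + K • (m x hx).M.h)
    (fun x hx z => by simp [(m x hx).ev_h, (m x hx).ev_logTr]) (fun x hx => by
      rw [MinimalModel.lap_add, MinimalModel.lap_smul, map_add, map_smul, smul_eq_mul]
      have e1 := mul_le_mul_of_nonneg_left (m x hx).lap_h_ge hK0.le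
      have e2 := (m x hx).lap_logTr_ge
      have e3 : K * (θ * (m x hx).t) = C * (m x hx).t + (m x hx).t := by
        rw [← mul_assoc, hKθ]; ring
      linarith [(m x hx).two_le_t])
  have hlog : Real.log (T x₀) / 2 ≤ Real.log τ := by
    have e1 := (m x₀ hx₀).ev_logTr (m x₀ hx₀).y
    rw [(m x₀ hx₀).c_y, logTr, Sm.ev_compFun] at e1
    rw [← e1]
    exact Real.log_le_log ((m x₀ hx₀).ev_tr_pos _) (ht x₀ hx₀ hf)
  have hTpos : 0 < T x := by
    have := (m x hx).ev_tr_pos (m x hx).y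
    rw [(m x hx).ev_tr, (m x hx).c_y] at this
    exact Real.sqrt_pos.1 this
  have e1 := hmax x hx
  simp only [(m x₀ hx₀).boundary_h hf] at e1
  have e2 := mul_le_mul_of_nonneg_left (hB x hx) hK0.le
  rw [← Real.log_le_iff_le_exp hTpos]
  linarith

end LocalModel

/-! ### The metric in a chart -/

section Metric

variable {N : Type*} [MetricSpace N] [ChartedSpace Plane N] [IsManifold 𝓘(ℝ, Plane) ∞ N]

theorem contMDiffOn_symm_atlas {e : OpenPartialHomeomorph N Plane} (he : e ∈ atlas Plane N) :
    ContMDiffOn 𝓘(ℝ, Plane) 𝓘(ℝ, Plane) ∞ e.symm e.target :=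
  contMDiffOn_symm_of_mem_maximalAtlas (StructureGroupoid.subset_maximalAtlas _ he)

theorem contMDiffOn_atlas {e : OpenPartialHomeomorph N Plane} (he : e ∈ atlas Plane N) :
    ContMDiffOn 𝓘(ℝ, Plane) 𝓘(ℝ, Plane) ∞ e e.source :=
  contMDiffOn_of_mem_maximalAtlas (StructureGroupoid.subset_maximalAtlas _ he)

theorem mdifferentiableAt_symm {e : OpenPartialHomeomorph N Plane} (he : e ∈ atlas Plane N)
    {y : Plane} (hy : y ∈ e.target) : MDifferentiableAt 𝓘(ℝ, Plane) 𝓘(ℝ, Plane) e.symm y :=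
  ((contMDiffOn_symm_atlas he).contMDiffAt (e.open_target.mem_nhds hy)).mdifferentiableAt (by simp)

theorem contMDiffOn_coordVec {e : OpenPartialHomeomorph N Plane} (he : e ∈ atlas Plane N)
    (i : Fin 2) :
    ContMDiffOn 𝓘(ℝ, Plane) 𝓘(ℝ, Plane).tangent ∞
      (fun y => (⟨e.symm y, coordVec e y i⟩ : TangentBundle 𝓘(ℝ, Plane) N)) e.target := by
  have : IsManifold 𝓘(ℝ, Plane) 1 N := IsManifold.of_le (n := ∞) (by simp)
  have h1 := (contMDiffOn_symm_atlas he).contMDiffOn_tangentMapWithin (m := ∞) (by simp)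
    e.open_target.uniqueMDiffOn
  have h2 : ContMDiffOn 𝓘(ℝ, Plane) 𝓘(ℝ, Plane).tangent ∞
      (fun y => (⟨y, stdVec i⟩ : TangentBundle 𝓘(ℝ, Plane) Plane)) e.target :=
    contMDiffOn_vectorSpace_iff_contDiffOn.2 contDiffOn_const
  refine (h1.comp h2 fun y hy => hy).congr fun y hy => ?_
  simp only [Function.comp_apply, tangentMapWithin, coordVec]
  rw [mfderivWithin_of_isOpen e.open_target hy]

/-- The differential of the inverse of a chart, as a linear map of the plane. -/
def symmDeriv (e : OpenPartialHomeomorph N Plane) (y : Plane) : Plane →L[ℝ] Plane :=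
  mfderiv 𝓘(ℝ, Plane) 𝓘(ℝ, Plane) e.symm y

theorem injective_symmDeriv {e : OpenPartialHomeomorph N Plane} (he : e ∈ atlas Plane N)
    {y : Plane} (hy : y ∈ e.target) : Function.Injective (symmDeriv e y) := by
  have : IsManifold 𝓘(ℝ, Plane) 1 N := IsManifold.of_le (n := ∞) (by simp)
  exact (mdifferentiable_of_mem_atlas he).symm.mfderiv_injective hy

end Metric

/-! ### Domains with smooth boundary as regions of the plane -/

section Regions

variable {N : Type*} [MetricSpace N]

theorem mem_interior_chartImage {e : OpenPartialHomeomorph N Plane} {Ω : Set N} {y : Plane}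
    (hy : y ∈ e.target) (h : e.symm y ∈ interior Ω) : y ∈ interior (chartImage e Ω) := by
  refine mem_interior.2 ⟨e.target ∩ e.symm ⁻¹' interior Ω, ?_, ?_, hy, h⟩
  · exact fun z hz => ⟨hz.1, interior_subset (s := Ω) hz.2⟩
  · exact e.isOpen_inter_preimage_symm isOpen_interior

theorem mapDomain_subset {e e' : OpenPartialHomeomorph N Plane} {Ω : Set N} {f : N → N} :
    mapDomain e e' Ω f ⊆ chartImage e Ω := fun _ hy => ⟨hy.1, hy.2.1⟩

/-- Continuity of `f` makes its domain in charts relatively open in the image of `Ω`, so the inward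
half planes are inherited. -/
theorem exists_isOpen_inter_subset_mapDomain {e e' : OpenPartialHomeomorph N Plane} {Ω : Set N}
    {f : N → N} (hf : ContinuousOn f Ω) :
    ∃ V : Set Plane, IsOpen V ∧ mapDomain e e' Ω f = chartImage e Ω ∩ V := by
  obtain ⟨W, hW, hWeq⟩ := continuousOn_iff'.1 hf e'.source e'.open_source
  refine ⟨e.target ∩ e.symm ⁻¹' W, e.isOpen_inter_preimage_symm hW, ?_⟩
  ext y
  have := Set.ext_iff.1 hWeq (e.symm y)
  simp only [mem_inter_iff, mem_preimage] at this
  simp only [mapDomain, chartImage, mem_inter_iff, mem_preimage]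
  tauto

theorem eventually_neg_of_fderiv_neg {r : Plane → ℝ} {y v : Plane} {ℓ : Plane →L[ℝ] ℝ}
    (hr : HasFDerivAt r ℓ y) (h0 : r y = 0) (hv : ℓ v < 0) :
    ∀ᶠ τ in 𝓝[>] (0 : ℝ), r (y + τ • v) < 0 := by
  have h2 : HasDerivAt (fun τ : ℝ => y + τ • v) v 0 := by
    simpa using ((hasDerivAt_id (0 : ℝ)).smul_const v).const_add y
  have h3 : HasDerivAt (fun τ : ℝ => r (y + τ • v)) (ℓ v) 0 :=
    HasFDerivAt.comp_hasDerivAt (0 : ℝ) (by simpa using hr) h2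
  have h4 := (hasDerivAt_iff_tendsto_slope.1 h3).eventually_lt_const hv
  have h5 : ∀ᶠ τ in 𝓝[>] (0 : ℝ), slope (fun τ : ℝ => r (y + τ • v)) 0 τ < 0 :=
    nhdsGT_le_nhdsNE 0 h4
  filter_upwards [h5, self_mem_nhdsWithin] with τ hτ hpos
  simp only [slope_def_field, zero_smul, add_zero, h0, sub_zero] at hτ
  exact (div_neg_iff.1 hτ).resolve_left (fun h => lt_asymm h.2 hpos) |>.1

variable [ChartedSpace Plane N] [IsManifold 𝓘(ℝ, Plane) ∞ N]

theorem exists_halfspace_chartImage {e : OpenPartialHomeomorph N Plane} (he : e ∈ atlas Plane N)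
    {Ω : Set N} (hΩ : HasSmoothBoundary Ω) {y : Plane} (hy : y ∈ chartImage e Ω) :
    ∃ ℓ : Plane →L[ℝ] ℝ, ℓ ≠ 0 ∧
      ∀ v, ℓ v < 0 → ∀ᶠ τ in 𝓝[>] (0 : ℝ), y + τ • v ∈ interior (chartImage e Ω) := by
  by_cases hint : e.symm y ∈ interior Ω
  · obtain ⟨ℓ, hℓ, h⟩ := (Region.ofIsOpen
      (interior (chartImage e Ω)) isOpen_interior).exists_halfspace
      y (mem_interior_chartImage hy.1 hint)
    refine ⟨ℓ, hℓ, fun v hv => (h v hv).mono fun τ hτ => ?_⟩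
    simpa [Region.ofIsOpen] using hτ
  · obtain ⟨U, ρ, hU, hyU, hρ, hdρ, hΩU⟩ := hΩ.2 (e.symm y) ⟨subset_closure hy.2, hint⟩
    have hsub : ∀ q ∈ U, ρ q ≤ 0 → q ∈ Ω := fun q hq h =>
      (hΩU.symm.subset ⟨h, hq⟩ : q ∈ Ω ∩ U).1
    have hρc : ContinuousOn ρ U := hρ.continuousOn
    have hopen : IsOpen (U ∩ ρ ⁻¹' Iio 0) := hρc.isOpen_inter_preimage hU isOpen_Iio
    have hneg : ∀ q ∈ U, ρ q < 0 → q ∈ interior Ω := fun q hq h =>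
      mem_interior.2 ⟨_, fun q' hq' => hsub q' hq'.1 (le_of_lt hq'.2), hopen, hq, h⟩
    -- A point of `Ω` with `ρ < 0` would be interior.
    have h0 : ρ (e.symm y) = 0 := by
      refine le_antisymm (hΩU.subset ⟨hy.2, hyU⟩ : e.symm y ∈ {q | ρ q ≤ 0} ∩ U).1 ?_
      by_contra! hlt
      exact hint (hneg _ hyU hlt)
    have hρd : MDifferentiableAt 𝓘(ℝ, Plane) 𝓘(ℝ, ℝ) ρ (e.symm y) :=
      (hρ.contMDiffAt (hU.mem_nhds hyU)).mdifferentiableAt (by simp)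
    have hd := hρd.hasMFDerivAt.comp y (mdifferentiableAt_symm he hy.1).hasMFDerivAt
    have hd' := hasMFDerivAt_iff_hasFDerivAt.1 hd
    -- The functional is the differential of the defining function read in the chart. Directions
    -- along which it decreases enter `ρ < 0`.
    refine ⟨(mfderiv 𝓘(ℝ, Plane) 𝓘(ℝ, ℝ) ρ (e.symm y)).comp
        (mfderiv 𝓘(ℝ, Plane) 𝓘(ℝ, Plane) e.symm y), ?_, fun v hv => ?_⟩
    · intro hzero
      refine hdρ (ContinuousLinearMap.ext fun x => ?_)
      have : IsManifold 𝓘(ℝ, Plane) 1 N := IsManifold.of_le (n := ∞) (by simp)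
      obtain ⟨v, rfl⟩ :=
        (mdifferentiable_of_mem_atlas (I := 𝓘(ℝ, Plane)) he).symm.mfderiv_surjective
        (x := y) hy.1 x
      exact DFunLike.congr_fun hzero v
    · have hV : IsOpen (e.target ∩ e.symm ⁻¹' U) := e.isOpen_inter_preimage_symm hU
      have h1 := eventually_neg_of_fderiv_neg hd' h0 hv
      have h2 : ∀ᶠ τ in 𝓝[>] (0 : ℝ), y + τ • v ∈ e.target ∩ e.symm ⁻¹' U :=
        nhdsWithin_le_nhds ((Region.tendsto_add_smul y v).eventually (hV.mem_nhds ⟨hy.1, hyU⟩))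
      filter_upwards [h1, h2] with τ hτ1 hτ2
      exact mem_interior_chartImage hτ2.1 (hneg _ hτ2.2 hτ1)

/-- The region of the plane that corresponds to `Ω` in a chart. -/
def chartRegion (e : OpenPartialHomeomorph N Plane) (he : e ∈ atlas Plane N) (Ω : Set N)
    (hΩ : HasSmoothBoundary Ω) : Region where
  carrier := chartImage e Ω
  exists_halfspace _ hy := exists_halfspace_chartImage he hΩ hy

/-- The region of the plane on which a map can be read in charts. -/
def mapRegion (e e' : OpenPartialHomeomorph N Plane) (he : e ∈ atlas Plane N) (Ω : Set N)
    (hΩ : HasSmoothBoundary Ω) (f : N → N) (hf : ContinuousOn f Ω) : Region where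
  carrier := mapDomain e e' Ω f
  exists_halfspace y hy := by
    obtain ⟨V, hV, hVeq⟩ := exists_isOpen_inter_subset_mapDomain (e := e) (e' := e') hf
    obtain ⟨ℓ, hℓ, h⟩ := exists_halfspace_chartImage he hΩ (mapDomain_subset hy)
    refine ⟨ℓ, hℓ, fun v hv => ?_⟩
    rw [hVeq, interior_inter, hV.interior_eq]
    rw [hVeq] at hy
    filter_upwards [h v hv, nhdsWithin_le_nhds
      ((Region.tendsto_add_smul y v).eventually (hV.mem_nhds hy.2))] with τ h1 h2
    exact ⟨h1, h2⟩

end Regions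

/-! ### The Gram matrix of the coordinate vector fields -/

section Metric

variable {N : Type*} [MetricSpace N] [ChartedSpace Plane N]
  [Bundle.RiemannianBundle (fun p : N => TangentSpace 𝓘(ℝ, Plane) p)]

/-- The Riemannian inner product at `p`, on the model space. -/
def innerAt (p : N) : Plane →ₗ[ℝ] Plane →ₗ[ℝ] ℝ := innerₗ (Tan p)

theorem innerAt_self_pos (p : N) {v : Plane} (hv : v ≠ 0) : 0 < innerAt p v v :=
  (real_inner_self_pos (F := Tan p)).2 hv

theorem metricCoeff_eq (e : OpenPartialHomeomorph N Plane) (y : Plane) (i j : Fin 2) :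
    metricCoeff e y i j
      = innerAt (e.symm y) (symmDeriv e y (stdVec i)) (symmDeriv e y (stdVec j)) := rfl

theorem innerAt_symmDeriv (e : OpenPartialHomeomorph N Plane) (y v w : Plane) :
    innerAt (e.symm y) (symmDeriv e y v) (symmDeriv e y w) = bil (metricCoeff e y) v w := by
  conv_lhs => rw [← Sm.sum_smul_stdVec v, ← Sm.sum_smul_stdVec w]
  simp only [bil, Fin.sum_univ_two, metricCoeff_eq, map_add, map_smul, LinearMap.add_apply,
    LinearMap.smul_apply, smul_eq_mul]
  ring

theorem metricCoeff_symm (e : OpenPartialHomeomorph N Plane) (y : Plane) (i j : Fin 2) :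
    metricCoeff e y i j = metricCoeff e y j i := real_inner_comm _ _

variable [IsManifold 𝓘(ℝ, Plane) ∞ N]

theorem bil_metricCoeff_pos {e : OpenPartialHomeomorph N Plane} (he : e ∈ atlas Plane N)
    {y : Plane} (hy : y ∈ e.target) {v : Plane} (hv : v ≠ 0) : 0 < bil (metricCoeff e y) v v := by
  rw [← innerAt_symmDeriv]
  refine innerAt_self_pos _ fun h => hv (injective_symmDeriv he hy ?_)
  rw [h, map_zero]

theorem metricCoeff_zero_zero_pos {e : OpenPartialHomeomorph N Plane} (he : e ∈ atlas Plane N)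
    {y : Plane} (hy : y ∈ e.target) : 0 < metricCoeff e y 0 0 := by
  have := bil_metricCoeff_pos he hy (v := !₂[1, 0]) (fun h => by simpa using congrArg (· 0) h)
  simpa [bil] using this

theorem metricCoeff_det_pos {e : OpenPartialHomeomorph N Plane} (he : e ∈ atlas Plane N)
    {y : Plane} (hy : y ∈ e.target) :
    0 < metricCoeff e y 0 0 * metricCoeff e y 1 1 - metricCoeff e y 0 1 * metricCoeff e y 0 1 := by
  have h0 := metricCoeff_zero_zero_pos he hy
  have := bil_metricCoeff_pos he hy (v := !₂[-metricCoeff e y 0 1, metricCoeff e y 0 0])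
    (fun h => h0.ne' (by simpa using congrArg (· 1) h))
  simp only [bil, Fin.sum_univ_two, metricCoeff_symm e y 1 0] at this
  simp at this
  nlinarith

variable
  [IsContMDiffRiemannianBundle 𝓘(ℝ, Plane) ∞ Plane (fun p : N => TangentSpace 𝓘(ℝ, Plane) p)]

theorem contDiffOn_metricCoeff {e : OpenPartialHomeomorph N Plane} (he : e ∈ atlas Plane N)
    (i j : Fin 2) : ContDiffOn ℝ ∞ (fun y => metricCoeff e y i j) e.target := by
  rw [← contMDiffOn_iff_contDiffOn]
  exact (contMDiffOn_coordVec he i).inner_bundle (contMDiffOn_coordVec he j)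

end Metric

/-! ### Differentials in charts -/

section ChainRule

variable {N : Type*} [MetricSpace N] [ChartedSpace Plane N]

/-- The differential of a map at a point of `Ω`, as a linear map of the model space. -/
def diffAt (f : N → N) (Ω : Set N) (p : N) : Plane →L[ℝ] Plane := diffOn f Ω p

/-- The differential of a function at a point of `Ω`, as a functional on the model space. -/
def funDiffAt (φ : N → ℝ) (Ω : Set N) (p : N) : Plane →L[ℝ] ℝ :=
  mfderivWithin 𝓘(ℝ, Plane) 𝓘(ℝ, ℝ) φ Ω p

variable [IsManifold 𝓘(ℝ, Plane) ∞ N]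

theorem contDiffOn_comp_symm {e : OpenPartialHomeomorph N Plane} (he : e ∈ atlas Plane N)
    {Ω : Set N} {φ : N → ℝ} (hφ : ContMDiffOn 𝓘(ℝ, Plane) 𝓘(ℝ, ℝ) ∞ φ Ω) :
    ContDiffOn ℝ ∞ (φ ∘ e.symm) (chartImage e Ω) := by
  rw [← contMDiffOn_iff_contDiffOn]
  exact hφ.comp ((contMDiffOn_symm_atlas he).mono inter_subset_left) fun y hy => hy.2

theorem contDiffOn_mapDomain {e e' : OpenPartialHomeomorph N Plane} (he : e ∈ atlas Plane N)
    (he' : e' ∈ atlas Plane N) {Ω : Set N} {f : N → N}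
    (hf : ContMDiffOn 𝓘(ℝ, Plane) 𝓘(ℝ, Plane) ∞ f Ω) :
    ContDiffOn ℝ ∞ (e' ∘ f ∘ e.symm) (mapDomain e e' Ω f) := by
  rw [← contMDiffOn_iff_contDiffOn]
  refine (contMDiffOn_atlas he').comp (t := e'.source) ?_ fun y hy => hy.2.2
  exact hf.comp ((contMDiffOn_symm_atlas he).mono inter_subset_left) fun y hy => hy.2.1

theorem hasMFDerivWithinAt_symm {e : OpenPartialHomeomorph N Plane} (he : e ∈ atlas Plane N)
    {y : Plane} (hy : y ∈ e.target) (t : Set Plane) :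
    HasMFDerivWithinAt 𝓘(ℝ, Plane) 𝓘(ℝ, Plane) e.symm t y (symmDeriv e y) :=
  (mdifferentiableAt_symm he hy).hasMFDerivAt.hasMFDerivWithinAt

theorem funDiffAt_symmDeriv {e : OpenPartialHomeomorph N Plane} (he : e ∈ atlas Plane N)
    {Ω : Set N} {φ : N → ℝ} (hφ : ContMDiffOn 𝓘(ℝ, Plane) 𝓘(ℝ, ℝ) ∞ φ Ω) {t : Set Plane}
    (ht : t ⊆ chartImage e Ω) {y : Plane} (hy : y ∈ t) (hu : UniqueDiffWithinAt ℝ t y)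
    (v : Plane) :
    funDiffAt φ Ω (e.symm y) (symmDeriv e y v) = fderivWithin ℝ (φ ∘ e.symm) t y v := by
  have h1 := ((hφ _ (ht hy).2).mdifferentiableWithinAt (by simp)).hasMFDerivWithinAt
  have h2 := h1.comp y (hasMFDerivWithinAt_symm he (ht hy).1 t) (fun z hz => (ht hz).2)
  have h3 : HasFDerivWithinAt (φ ∘ e.symm)
      ((funDiffAt φ Ω (e.symm y)).comp (symmDeriv e y)) t y :=
    hasMFDerivWithinAt_iff_hasFDerivWithinAt.1 h2
  rw [h3.fderivWithin hu]
  rfl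

theorem diffAt_symmDeriv {e e' : OpenPartialHomeomorph N Plane} (he : e ∈ atlas Plane N)
    (he' : e' ∈ atlas Plane N) {Ω : Set N} {f : N → N}
    (hf : ContMDiffOn 𝓘(ℝ, Plane) 𝓘(ℝ, Plane) ∞ f Ω) {y : Plane}
    (hy : y ∈ mapDomain e e' Ω f) (hu : UniqueDiffWithinAt ℝ (mapDomain e e' Ω f) y) (v : Plane) :
    diffAt f Ω (e.symm y) (symmDeriv e y v)
      = symmDeriv e' ((e' ∘ f ∘ e.symm) y)
        (fderivWithin ℝ (e' ∘ f ∘ e.symm) (mapDomain e e' Ω f) y v) := by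
  set t := mapDomain e e' Ω f
  have h1 := ((hf _ hy.2.1).mdifferentiableWithinAt (by simp)).hasMFDerivWithinAt
  have h2 := h1.comp y (hasMFDerivWithinAt_symm he hy.1 t) (fun z hz => hz.2.1)
  have h3 := ((contDiffOn_mapDomain he he' hf).differentiableOn (by simp) y
    hy).hasFDerivWithinAt.hasMFDerivWithinAt
  have h4 := (hasMFDerivWithinAt_symm he' (e'.map_source hy.2.2) univ).comp y h3
    (fun z _ => mem_univ _)
  -- Both factorizations of the same map are differentiated; unique differentiability of the domain
  -- makes the two results agree, at boundary points too.
  have hEq : ∀ z ∈ t, (f ∘ e.symm) z = (e'.symm ∘ (e' ∘ f ∘ e.symm)) z := fun z hz =>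
    (e'.left_inv hz.2.2).symm
  have h5 := h4.congr_of_eventuallyEq (f₁ := f ∘ e.symm)
    (Filter.eventually_of_mem self_mem_nhdsWithin hEq) (hEq y hy)
  have h6 := UniqueMDiffWithinAt.eq hu.uniqueMDiffWithinAt h2 h5
  exact DFunLike.congr_fun h6 v

end ChainRule

/-! ### The Levi-Civita connection in a chart -/

namespace Sm

variable {s : Region}

/-- The Hessian of `φ` with respect to the connection `Γ`. -/
def hess (Γ : Fin 2 → Fin 2 → Fin 2 → Sm s) (φ : Sm s) (i j : Fin 2) : Sm s :=
  pd i (pd j φ) - ∑ k, Γ k i j * pd k φ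

/-- The covariant derivative of the Hessian of `φ`. -/
def covHess (Γ : Fin 2 → Fin 2 → Fin 2 → Sm s) (φ : Sm s) (c i j : Fin 2) : Sm s :=
  pd c (hess Γ φ i j) - ∑ m, (Γ m c i * hess Γ φ m j + Γ m c j * hess Γ φ i m)

/-- The inverse square root of a positive element. -/
def invSqrt (φ : Sm s) (hφ : ∀ y, 0 < ev y φ) : Sm s :=
  compFun (fun x => (√x)⁻¹) (Ioi 0)
    (ContDiffOn.inv (fun _ hx => (Real.contDiffAt_sqrt (ne_of_gt hx)).contDiffWithinAt)
      fun _ hx => (Real.sqrt_pos.2 hx).ne') φ hφ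

theorem ev_invSqrt (φ : Sm s) (hφ : ∀ y, 0 < ev y φ) (y : s.carrier) :
    ev y (invSqrt φ hφ) = (√(ev y φ))⁻¹ := ev_compFun ..

theorem invSqrt_mul_invSqrt_mul (φ : Sm s) (hφ : ∀ y, 0 < ev y φ) :
    invSqrt φ hφ * invSqrt φ hφ * φ = 1 := by
  refine ext_ev fun y => ?_
  have h := Real.mul_self_sqrt (hφ y).le
  have h0 := (Real.sqrt_pos.2 (hφ y)).ne'
  simp only [map_mul, ev_invSqrt, map_one]
  field_simp
  rw [sq, h]

variable {s₀ : Region} {v : Plane → Plane} {hv : ContDiffOn ℝ ∞ v s.carrier}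
  {hm : MapsTo v s.carrier s₀.carrier} {D : Derivation ℝ (Sm s) (Sm s)} {E : Fin 2 → Sm s}

/-- The chain rule for a derivation. -/
theorem deriv_pull (hD : ∀ x, D x = ∑ k, E k * pd k x) (φ : Sm s₀) :
    D (pull v hv hm φ) = ∑ c, D (component v hv c) * pull v hv hm (pd c φ) := by
  simp only [hD, pd_pull, Fin.sum_univ_two]
  ring

theorem deriv_pull_pd (hD : ∀ x, D x = ∑ k, E k * pd k x)
    (Γ : Fin 2 → Fin 2 → Fin 2 → Sm s₀) (φ : Sm s₀) (k : Fin 2) :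
    D (pull v hv hm (pd k φ)) = ∑ c, D (component v hv c) * (pull v hv hm (hess Γ φ c k)
      + ∑ m, pull v hv hm (Γ m c k) * pull v hv hm (pd m φ)) := by
  rw [deriv_pull hD]
  simp [hess]

theorem deriv_pull_hess (hD : ∀ x, D x = ∑ k, E k * pd k x)
    (Γ : Fin 2 → Fin 2 → Fin 2 → Sm s₀) (φ : Sm s₀) (i j : Fin 2) :
    D (pull v hv hm (hess Γ φ i j)) = ∑ c, D (component v hv c) * (pull v hv hm (covHess Γ φ c i j)
      + ∑ m, (pull v hv hm (Γ m c i) * pull v hv hm (hess Γ φ m j)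
        + pull v hv hm (Γ m c j) * pull v hv hm (hess Γ φ i m))) := by
  rw [deriv_pull hD]
  simp [covHess]

theorem isCompatible_pull (hD : ∀ x, D x = ∑ k, E k * pd k x)
    {g : Fin 2 → Fin 2 → Sm s₀} {Γ : Fin 2 → Fin 2 → Fin 2 → Sm s₀}
    (h : ∀ c i j, pd c (g i j) = ∑ l, (g i l * Γ l c j + g j l * Γ l c i)) :
    IsCompatible (fun i j => pull v hv hm (g i j)) (fun k i j => pull v hv hm (Γ k i j)) D
      (fun c => D (component v hv c)) := by
  intro i j
  simp only [deriv_pull hD, h, map_sum, map_add, map_mul]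

/-- The commutator of the derivatives along an orthonormal frame. -/
theorem comm_of_frame {D : Fin 2 → Derivation ℝ (Sm s) (Sm s)} {E : Fin 2 → Fin 2 → Sm s}
    (hD : ∀ i x, D i x = ∑ k, E i k * pd k x) {Γ : Fin 2 → Fin 2 → Fin 2 → Sm s}
    (hΓ : ∀ k i j, Γ k i j = Γ k j i) {α : Fin 2 → Sm s}
    (h0 : ∀ i k, covDeriv Γ (D i) (E i) (E 0) k = α i * E 1 k)
    (h1 : ∀ i k, covDeriv Γ (D i) (E i) (E 1) k = -α i * E 0 k) (x : Sm s) :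
    D 0 (D 1 x) - D 1 (D 0 x) = -α 0 * D 0 x - α 1 * D 1 x := by
  -- Vanishing torsion: the bracket of the frame fields is the difference of their covariant
  -- derivatives, and the Christoffel terms cancel by symmetry.
  have key : ∀ k, D 0 (E 1 k) - D 1 (E 0 k) = -α 0 * E 0 k - α 1 * E 1 k := by
    intro k
    have e0 := h1 0 k
    have e1 := h0 1 k
    simp only [covDeriv, Fin.sum_univ_two, hΓ k 1 0] at e0 e1
    linear_combination e0 - e1
  have hc := pd_comm 0 1 x
  have hx : ∀ i j, D i (D j x)
      = ∑ l, (D i (E j l) * pd l x + E j l * ∑ k, E i k * pd k (pd l x)) := by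
    intro i j
    rw [hD j x]
    simp only [Fin.sum_univ_two, map_add, Derivation.leibniz, smul_eq_mul]
    rw [hD i (pd 0 x), hD i (pd 1 x)]
    simp only [Fin.sum_univ_two]
    ring
  rw [hx, hx, hD 0 x, hD 1 x]
  have k0 := key 0
  have k1 := key 1
  simp only [Fin.sum_univ_two]
  linear_combination pd 0 x * k0 + pd 1 x * k1 + (E 0 0 * E 1 1 - E 0 1 * E 1 0) * hc

end Sm

/-! ### The geometry of a domain in a chart -/

/-- A domain with smooth boundary together with a chart. -/
structure ChartedDomain (N : Type*) [MetricSpace N] [ChartedSpace Plane N] where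
  /-- The chart. -/
  e : OpenPartialHomeomorph N Plane
  mem_atlas : e ∈ atlas Plane N
  /-- The domain. -/
  Ω : Set N
  smoothBoundary : HasSmoothBoundary Ω

namespace ChartedDomain

variable {N : Type*} [MetricSpace N] [ChartedSpace Plane N] [IsManifold 𝓘(ℝ, Plane) ∞ N]

/-- The domain in the chart. -/
def region (X : ChartedDomain N) : Region := chartRegion X.e X.mem_atlas X.Ω X.smoothBoundary

theorem mem_target (X : ChartedDomain N) (y : X.region.carrier) : (y : Plane) ∈ X.e.target := y.2.1

/-- A smooth function in the chart. -/
def fn (X : ChartedDomain N) (φ : N → ℝ) (hφ : ContMDiffOn 𝓘(ℝ, Plane) 𝓘(ℝ, ℝ) ∞ φ X.Ω) :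
    Sm X.region :=
  Sm.ofFun (φ ∘ X.e.symm) (contDiffOn_comp_symm X.mem_atlas hφ)

theorem ev_pd_fn (X : ChartedDomain N) (φ : N → ℝ)
    (hφ : ContMDiffOn 𝓘(ℝ, Plane) 𝓘(ℝ, ℝ) ∞ φ X.Ω) (k : Fin 2)
    (y : X.region.carrier) :
    Sm.ev y (Sm.pd k (X.fn φ hφ))
      = fderivWithin ℝ (φ ∘ X.e.symm) (chartImage X.e X.Ω) y (stdVec k) :=
  Sm.ev_pd_of_eqOn (fun _ => rfl) k y

variable [Bundle.RiemannianBundle (fun p : N => TangentSpace 𝓘(ℝ, Plane) p)]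
  [IsContMDiffRiemannianBundle 𝓘(ℝ, Plane) ∞ Plane (fun p : N => TangentSpace 𝓘(ℝ, Plane) p)]
  (X : ChartedDomain N)

/-- The metric coefficients. -/
def g (i j : Fin 2) : Sm X.region :=
  Sm.ofFun (fun y => metricCoeff X.e y i j)
    ((contDiffOn_metricCoeff X.mem_atlas i j).mono inter_subset_left)

theorem ev_g (y : X.region.carrier) (i j : Fin 2) : Sm.ev y (X.g i j) = metricCoeff X.e y i j := rfl

theorem g_symm (i j : Fin 2) : X.g i j = X.g j i :=
  Sm.ext_ev fun y => metricCoeff_symm X.e y i j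

theorem ev_pd_g (y : X.region.carrier) (c i j : Fin 2) :
    Sm.ev y (Sm.pd c (X.g i j)) = fderiv ℝ (fun z => metricCoeff X.e z i j) y (stdVec c) := by
  have hd : DifferentiableAt ℝ (fun z => metricCoeff X.e z i j) y :=
    ((contDiffOn_metricCoeff X.mem_atlas i j).differentiableOn (by simp)).differentiableAt
      (X.e.open_target.mem_nhds (X.mem_target y))
  rw [Sm.ev_pd_of_eqOn (u := fun z => metricCoeff X.e z i j) (fun _ => rfl),
    hd.fderivWithin (X.region.uniqueDiffOn y y.2)]

/-- The determinant of the metric. -/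
def det : Sm X.region := X.g 0 0 * X.g 1 1 - X.g 0 1 * X.g 0 1

theorem ev_g_zero_zero_pos (y : X.region.carrier) : 0 < Sm.ev y (X.g 0 0) :=
  metricCoeff_zero_zero_pos X.mem_atlas (X.mem_target y)

theorem ev_det_pos (y : X.region.carrier) : 0 < Sm.ev y X.det := by
  have := metricCoeff_det_pos X.mem_atlas (X.mem_target y)
  simpa [det, ev_g] using this

/-- The inverse of the square root of `g₀₀`. -/
def a : Sm X.region := Sm.invSqrt (X.g 0 0) X.ev_g_zero_zero_pos

/-- The inverse of the square root of the determinant of the metric. -/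
def b : Sm X.region := Sm.invSqrt X.det X.ev_det_pos

theorem a_mul : X.a * X.a * X.g 0 0 = 1 := Sm.invSqrt_mul_invSqrt_mul _ _

theorem b_mul : X.b * X.b * (X.g 0 0 * X.g 1 1 - X.g 0 1 * X.g 0 1) = 1 :=
  Sm.invSqrt_mul_invSqrt_mul _ _

/-- The inverse of the metric. -/
def gInv : Matrix (Fin 2) (Fin 2) (Sm X.region) :=
  !![X.b * X.b * X.g 1 1, -(X.b * X.b * X.g 0 1); -(X.b * X.b * X.g 0 1), X.b * X.b * X.g 0 0]

theorem g_mul_gInv (i m : Fin 2) : ∑ l, X.g i l * X.gInv l m = if i = m then 1 else 0 := by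
  have h := X.b_mul
  have h10 := X.g_symm 1 0
  fin_cases i <;> fin_cases m <;> simp [gInv, Fin.sum_univ_two, h10] <;>
    first | ring1 | linear_combination h

/-- The Christoffel symbols. -/
def Γ (k i j : Fin 2) : Sm X.region :=
  (1 / 2 : ℝ) • ∑ l, X.gInv k l *
    (Sm.pd i (X.g j l) + Sm.pd j (X.g i l) - Sm.pd l (X.g i j))

theorem Γ_symm (k i j : Fin 2) : X.Γ k i j = X.Γ k j i := by
  simp only [Γ, X.g_symm i j]
  congr 1
  exact Finset.sum_congr rfl fun l _ => by ring

theorem inv_metricCoeff (y : X.region.carrier) (k l : Fin 2) :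
    (metricCoeff X.e y)⁻¹ k l = Sm.ev y (X.gInv k l) := by
  have h : metricCoeff X.e y * (Matrix.of fun k l => Sm.ev y (X.gInv k l)) = 1 := by
    ext i m
    have := congrArg (Sm.ev y) (X.g_mul_gInv i m)
    rw [Matrix.mul_apply, Matrix.one_apply]
    rw [map_sum] at this
    simp only [map_mul, ev_g] at this
    simp only [Matrix.of_apply, this]
    split_ifs <;> simp
  rw [Matrix.inv_eq_right_inv h]
  rfl

theorem ev_Γ (y : X.region.carrier) (k i j : Fin 2) :
    Sm.ev y (X.Γ k i j) = christoffel X.e k i j y := by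
  simp only [Γ, christoffel, map_smul, smul_eq_mul, map_sum, map_mul, map_add, map_sub, ev_pd_g,
    inv_metricCoeff]

/-- Lowering the index cancels the inverse metric. In the sum of two permuted copies all but one
derivative of the metric drop out, which is compatibility. -/
theorem g_mul_Γ (i c j : Fin 2) : ∑ l, X.g i l * X.Γ l c j
    = (1 / 2 : ℝ) • (Sm.pd c (X.g j i) + Sm.pd j (X.g c i) - Sm.pd i (X.g c j)) := by
  have h0 := X.g_mul_gInv i 0
  have h1 := X.g_mul_gInv i 1
  simp only [Γ, Fin.sum_univ_two, Algebra.smul_def] at h0 h1 ⊢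
  fin_cases i <;> simp only [Fin.zero_eta, Fin.mk_one, Fin.isValue, if_true, zero_ne_one,
    one_ne_zero, if_false] at h0 h1 ⊢
  all_goals linear_combination (algebraMap ℝ (Sm X.region) (1 / 2))
    * (Sm.pd c (X.g j 0) + Sm.pd j (X.g c 0) - Sm.pd 0 (X.g c j)) * h0
    + (algebraMap ℝ (Sm X.region) (1 / 2))
    * (Sm.pd c (X.g j 1) + Sm.pd j (X.g c 1) - Sm.pd 1 (X.g c j)) * h1

/-- The Levi-Civita connection is compatible with the metric. -/
theorem pd_g (c i j : Fin 2) :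
    Sm.pd c (X.g i j) = ∑ l, (X.g i l * X.Γ l c j + X.g j l * X.Γ l c i) := by
  rw [Finset.sum_add_distrib, g_mul_Γ, g_mul_Γ, X.g_symm j i, X.g_symm c i, X.g_symm c j,
    ← smul_add]
  have : Sm.pd c (X.g i j) + Sm.pd j (X.g i c) - Sm.pd i (X.g j c)
      + (Sm.pd c (X.g i j) + Sm.pd i (X.g j c) - Sm.pd j (X.g i c))
      = (2 : ℝ) • Sm.pd c (X.g i j) := by
    rw [two_smul]; ring
  rw [this, smul_smul]
  norm_num

/-- An orthonormal frame. -/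
def E : Fin 2 → Fin 2 → Sm X.region :=
  ![![X.a, 0], ![-(X.g 0 1 * X.a * X.b), X.g 0 0 * X.a * X.b]]

/-- The frame is the Gram–Schmidt process applied to the coordinate fields, with the normalizing
factors `g₀₀^(-1/2)` and `(det g)^(-1/2)`. -/
theorem isOrthonormalFrame : IsOrthonormalFrame X.g X.E := by
  intro i j
  have ha := X.a_mul
  have hb := X.b_mul
  have h10 := X.g_symm 1 0
  fin_cases i <;> fin_cases j <;> simp [bil, E, Fin.sum_univ_two, h10]
  · linear_combination ha
  · ring
  · ring
  · linear_combination ha + X.a * X.a * X.g 0 0 * hb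

/-- The derivatives along the frame. -/
def D (i : Fin 2) : Derivation ℝ (Sm X.region) (Sm X.region) := ∑ k, X.E i k • Sm.pd k

theorem D_apply (i : Fin 2) (x : Sm X.region) : X.D i x = ∑ k, X.E i k * Sm.pd k x := by
  simp [D, Fin.sum_univ_two]

/-- The connection form of the frame. -/
def α (i : Fin 2) : Sm X.region := bil X.g (X.E 1) (covDeriv X.Γ (X.D i) (X.E i) (X.E 0))

/-- The curvature. -/
def curv : Sm X.region := X.D 0 (X.α 1) - X.D 1 (X.α 0) + X.α 0 * X.α 0 + X.α 1 * X.α 1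

theorem isCompatible (i : Fin 2) : IsCompatible X.g X.Γ (X.D i) (X.E i) := by
  intro j k
  simp only [D_apply, pd_g]

theorem covDeriv_E (i : Fin 2) :
    (∀ k, covDeriv X.Γ (X.D i) (X.E i) (X.E 0) k = X.α i * X.E 1 k) ∧
      ∀ k, covDeriv X.Γ (X.D i) (X.E i) (X.E 1) k = -X.α i * X.E 0 k :=
  X.isOrthonormalFrame.covDeriv_eq (X.isCompatible i) X.g_symm

theorem ev_hess (φ : N → ℝ) (hφ : ContMDiffOn 𝓘(ℝ, Plane) 𝓘(ℝ, ℝ) ∞ φ X.Ω) (i j : Fin 2)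
    (y : X.region.carrier) :
    Sm.ev y (Sm.hess X.Γ (X.fn φ hφ) i j) = hessCoeff X.e X.Ω φ i j y := by
  simp only [Sm.hess, hessCoeff, map_sub, map_sum, map_mul, ev_Γ, ev_pd_fn]
  rw [Sm.ev_pd_of_eqOn (u := fun z => fderivWithin ℝ (φ ∘ X.e.symm) (chartImage X.e X.Ω) z
    (stdVec j)) (fun z => X.ev_pd_fn φ hφ j z)]
  rfl

end ChartedDomain

/-! ### A minimal Lagrangian map in charts -/

/-- A minimal Lagrangian map between two domains with charts. -/
structure MapChart (N : Type*) [MetricSpace N] [ChartedSpace Plane N]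
    [Bundle.RiemannianBundle (fun p : N => TangentSpace 𝓘(ℝ, Plane) p)] where
  /-- The source. -/
  X : ChartedDomain N
  /-- The target. -/
  Y : ChartedDomain N
  /-- The map. -/
  f : N → N
  minimal : IsMinimalLagrangianDiffeo X.Ω Y.Ω f

section AreaPreserving

variable {N : Type*} [MetricSpace N] [ChartedSpace Plane N]
  [Bundle.RiemannianBundle (fun p : N => TangentSpace 𝓘(ℝ, Plane) p)]

theorem innerAt_areaPreserving {Ω Ω' : Set N} {f : N → N} (hf : IsMinimalLagrangianDiffeo Ω Ω' f)
    {p : N} (hp : p ∈ Ω) (v w : Plane) :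
    innerAt (f p) (diffAt f Ω p v) (diffAt f Ω p v) * innerAt (f p) (diffAt f Ω p w)
      (diffAt f Ω p w) - innerAt (f p) (diffAt f Ω p v) (diffAt f Ω p w) ^ 2
      = innerAt p v v * innerAt p w w - innerAt p v w ^ 2 := by
  have h := hf.areaPreserving p hp v w
  rw [← real_inner_self_eq_norm_sq (F := Tan (f p)) (diffOn f Ω p v),
    ← real_inner_self_eq_norm_sq (F := Tan (f p)) (diffOn f Ω p w),
    ← real_inner_self_eq_norm_sq (F := Tan p) v, ← real_inner_self_eq_norm_sq (F := Tan p) w] at h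
  exact h

end AreaPreserving

namespace MapChart

variable {N : Type*} [MetricSpace N] [ChartedSpace Plane N] [IsManifold 𝓘(ℝ, Plane) ∞ N]
  [Bundle.RiemannianBundle (fun p : N => TangentSpace 𝓘(ℝ, Plane) p)]
  (Z : MapChart N)

/-- The region on which the map can be read in the charts. -/
def region : Region :=
  mapRegion Z.X.e Z.Y.e Z.X.mem_atlas Z.X.Ω Z.X.smoothBoundary Z.f
    Z.minimal.diffeo.2.1.continuousOn

/-- The map in the charts. -/
def u : Plane → Plane := Z.Y.e ∘ Z.f ∘ Z.X.e.symm

theorem contDiffOn_u : ContDiffOn ℝ ∞ Z.u Z.region.carrier :=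
  contDiffOn_mapDomain Z.X.mem_atlas Z.Y.mem_atlas Z.minimal.diffeo.2.1

theorem symm_u (z : Z.region.carrier) : Z.Y.e.symm (Z.u z) = Z.f (Z.X.e.symm z) :=
  Z.Y.e.left_inv z.2.2.2

theorem mapsTo_u : MapsTo Z.u Z.region.carrier Z.Y.region.carrier := fun z hz =>
  ⟨Z.Y.e.map_source hz.2.2, by
    change Z.Y.e.symm (Z.u z) ∈ Z.Y.Ω
    rw [Z.symm_u ⟨z, hz⟩]
    exact Z.minimal.diffeo.1.mapsTo hz.2.1⟩

theorem mapsTo_id : MapsTo id Z.region.carrier Z.X.region.carrier := fun _ hz => ⟨hz.1, hz.2.1⟩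

/-- Restriction of functions on the source. -/
def src : Sm Z.X.region →ₐ[ℝ] Sm Z.region := Sm.pull id contDiffOn_id Z.mapsTo_id

/-- Pull-back of functions on the target. -/
def tgt : Sm Z.Y.region →ₐ[ℝ] Sm Z.region := Sm.pull Z.u Z.contDiffOn_u Z.mapsTo_u

/-- The point of the source chart. -/
def srcPt (z : Z.region.carrier) : Z.X.region.carrier := ⟨z, Z.mapsTo_id z.2⟩

/-- The point of the target chart. -/
def tgtPt (z : Z.region.carrier) : Z.Y.region.carrier := ⟨Z.u z, Z.mapsTo_u z.2⟩

theorem ev_src (z : Z.region.carrier) (φ : Sm Z.X.region) :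
    Sm.ev z (Z.src φ) = Sm.ev (Z.srcPt z) φ := Sm.ev_pull ..

theorem ev_tgt (z : Z.region.carrier) (φ : Sm Z.Y.region) :
    Sm.ev z (Z.tgt φ) = Sm.ev (Z.tgtPt z) φ := Sm.ev_pull ..

/-- The components of the map. -/
def comp (c : Fin 2) : Sm Z.region := Sm.component Z.u Z.contDiffOn_u c

variable [IsContMDiffRiemannianBundle 𝓘(ℝ, Plane) ∞ Plane
  (fun p : N => TangentSpace 𝓘(ℝ, Plane) p)]

/-- The orthonormal frame. -/
def E (i k : Fin 2) : Sm Z.region := Z.src (Z.X.E i k)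

/-- The derivatives along the frame. -/
def D (i : Fin 2) : Derivation ℝ (Sm Z.region) (Sm Z.region) := ∑ k, Z.E i k • Sm.pd k

theorem D_apply (i : Fin 2) (x : Sm Z.region) : Z.D i x = ∑ k, Z.E i k * Sm.pd k x := by
  simp [D, Fin.sum_univ_two]

theorem D_component_id (i c : Fin 2) :
    Z.D i (Sm.component id contDiffOn_id c) = Z.E i c := by
  have : ∀ k, Sm.pd k (Sm.component id contDiffOn_id c : Sm Z.region) = if k = c then 1 else 0 := by
    intro k
    refine Sm.ext_ev fun z => ?_
    rw [Sm.ev_pd_component, fderivWithin_id (Z.region.uniqueDiffOn z z.2)]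
    fin_cases k <;> fin_cases c <;> simp [stdVec]
  simp [D_apply, this]

theorem D_src (i : Fin 2) (φ : Sm Z.X.region) : Z.D i (Z.src φ) = Z.src (Z.X.D i φ) := by
  rw [src, Sm.deriv_pull (Z.D_apply i), Z.X.D_apply]
  simp only [D_component_id, map_sum, map_mul]
  rfl

/-- The connection form. -/
def α (i : Fin 2) : Sm Z.region := Z.src (Z.X.α i)

/-- The Christoffel symbols of the source. -/
def Γ (k i j : Fin 2) : Sm Z.region := Z.src (Z.X.Γ k i j)

theorem src_covDeriv (i a k : Fin 2) : covDeriv Z.Γ (Z.D i) (Z.E i) (Z.E a) k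
    = Z.src (covDeriv Z.X.Γ (Z.X.D i) (Z.X.E i) (Z.X.E a) k) := by
  simp only [covDeriv, Γ, E, D_src, map_add, map_sum, map_mul]

theorem covDeriv_E_zero (i k : Fin 2) :
    covDeriv Z.Γ (Z.D i) (Z.E i) (Z.E 0) k = Z.α i * Z.E 1 k := by
  rw [src_covDeriv, (Z.X.covDeriv_E i).1, map_mul]
  rfl

theorem covDeriv_E_one (i k : Fin 2) :
    covDeriv Z.Γ (Z.D i) (Z.E i) (Z.E 1) k = -Z.α i * Z.E 0 k := by
  rw [src_covDeriv, (Z.X.covDeriv_E i).2, map_mul, map_neg]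
  rfl

theorem comm (x : Sm Z.region) :
    Z.D 0 (Z.D 1 x) - Z.D 1 (Z.D 0 x) = -Z.α 0 * Z.D 0 x - Z.α 1 * Z.D 1 x :=
  Sm.comm_of_frame Z.D_apply (Γ := Z.Γ) (fun k i j => congrArg Z.src (Z.X.Γ_symm k i j))
    Z.covDeriv_E_zero Z.covDeriv_E_one x

/-- The metric of the target along the map. -/
def g' (i j : Fin 2) : Sm Z.region := Z.tgt (Z.Y.g i j)

theorem g'_symm (i j : Fin 2) : Z.g' i j = Z.g' j i := congrArg Z.tgt (Z.Y.g_symm i j)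

/-- The Christoffel symbols of the target along the map. -/
def Γ' (k i j : Fin 2) : Sm Z.region := Z.tgt (Z.Y.Γ k i j)

/-- The derivatives of the map along the frame. -/
def V (i c : Fin 2) : Sm Z.region := Z.D i (Z.comp c)

theorem isCompatible (i : Fin 2) : IsCompatible Z.g' Z.Γ' (Z.D i) (Z.V i) :=
  Sm.isCompatible_pull (Z.D_apply i) Z.Y.pd_g

/-- The pull-back of the metric of the target, in the frame. -/
def pb (i j : Fin 2) : Sm Z.region := bil Z.g' (Z.V i) (Z.V j)

/-- The frame at a point, as a vector of the plane. -/
def Evec (z : Z.region.carrier) (i : Fin 2) : Plane := WithLp.toLp 2 fun k => Sm.ev z (Z.E i k)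

/-- The derivatives of the map at a point, as vectors of the plane. -/
def Vvec (z : Z.region.carrier) (i : Fin 2) : Plane := WithLp.toLp 2 fun k => Sm.ev z (Z.V i k)

theorem fderivWithin_u (z : Z.region.carrier) (i : Fin 2) :
    fderivWithin ℝ Z.u Z.region.carrier z (Z.Evec z i) = Z.Vvec z i := by
  ext c
  conv_lhs => rw [← Sm.sum_smul_stdVec (Z.Evec z i)]
  simp only [map_sum, map_smul, Vvec, V, D_apply, map_mul, comp, Sm.ev_pd_component, Evec]
  simp [Fin.sum_univ_two]

theorem diffAt_Evec (z : Z.region.carrier) (i : Fin 2) :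
    diffAt Z.f Z.X.Ω (Z.X.e.symm z) (symmDeriv Z.X.e z (Z.Evec z i))
      = symmDeriv Z.Y.e (Z.u z) (Z.Vvec z i) := by
  rw [← fderivWithin_u]
  exact diffAt_symmDeriv Z.X.mem_atlas Z.Y.mem_atlas Z.minimal.diffeo.2.1 z.2
    (Z.region.uniqueDiffOn z z.2) _

theorem ev_bil {s : Region} (z : s.carrier) (G : Fin 2 → Fin 2 → Sm s) (v w : Fin 2 → Sm s) :
    Sm.ev z (bil G v w)
      = bil (fun i j => Sm.ev z (G i j)) (fun i => Sm.ev z (v i)) (fun i => Sm.ev z (w i)) := by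
  simp [bil]

theorem innerAt_Evec (z : Z.region.carrier) (i j : Fin 2) :
    innerAt (Z.X.e.symm z) (symmDeriv Z.X.e z (Z.Evec z i)) (symmDeriv Z.X.e z (Z.Evec z j))
      = if i = j then 1 else 0 := by
  rw [innerAt_symmDeriv]
  have := congrArg (Sm.ev (Z.srcPt z)) (Z.X.isOrthonormalFrame i j)
  rw [ev_bil] at this
  have h2 : Sm.ev (Z.srcPt z) (if i = j then (1 : Sm Z.X.region) else 0)
      = if i = j then (1 : ℝ) else 0 := by split_ifs <;> simp
  rw [h2] at this
  rw [← this]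
  simp only [bil, Evec, E, ev_src]
  rfl

theorem innerAt_symmDeriv_tgt (z : Z.region.carrier) (v w : Fin 2 → Sm Z.region) :
    innerAt (Z.f (Z.X.e.symm z)) (symmDeriv Z.Y.e (Z.u z) (WithLp.toLp 2 fun k => Sm.ev z (v k)))
      (symmDeriv Z.Y.e (Z.u z) (WithLp.toLp 2 fun k => Sm.ev z (w k)))
      = Sm.ev z (bil Z.g' v w) := by
  rw [← Z.symm_u, innerAt_symmDeriv, ev_bil]
  simp only [bil, g', ev_tgt]
  rfl

theorem ev_pb (z : Z.region.carrier) (i j : Fin 2) :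
    Sm.ev z (Z.pb i j) = innerAt (Z.f (Z.X.e.symm z))
      (diffAt Z.f Z.X.Ω (Z.X.e.symm z) (symmDeriv Z.X.e z (Z.Evec z i)))
      (diffAt Z.f Z.X.Ω (Z.X.e.symm z) (symmDeriv Z.X.e z (Z.Evec z j))) := by
  rw [diffAt_Evec, diffAt_Evec]
  exact (Z.innerAt_symmDeriv_tgt z _ _).symm

theorem pb_symm (i j : Fin 2) : Z.pb i j = Z.pb j i := bil_comm Z.g'_symm _ _

theorem ev_pb_nonneg (z : Z.region.carrier) (i : Fin 2) : 0 ≤ Sm.ev z (Z.pb i i) := by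
  rw [ev_pb]
  exact real_inner_self_nonneg (F := Tan (Z.f (Z.X.e.symm z)))

/-- Area preservation, applied to the unit square spanned by the orthonormal frame. -/
theorem det_pb : Z.pb 0 0 * Z.pb 1 1 - Z.pb 0 1 * Z.pb 0 1 = 1 := by
  refine Sm.ext_ev fun z => ?_
  have h := innerAt_areaPreserving Z.minimal z.2.2.1 (symmDeriv Z.X.e z (Z.Evec z 0))
    (symmDeriv Z.X.e z (Z.Evec z 1))
  simp only [innerAt_Evec, ← ev_pb] at h
  simp only [map_sub, map_mul, map_one]
  simp at h
  linarith

/-- The sum of the squares of the singular values, plus two. -/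
def trSq : Sm Z.region := Z.pb 0 0 + Z.pb 1 1 + 2

theorem ev_trSq_pos (z : Z.region.carrier) : 0 < Sm.ev z Z.trSq := by
  have h0 := Z.ev_pb_nonneg z 0
  have h1 := Z.ev_pb_nonneg z 1
  simp only [trSq, map_add, map_ofNat]
  linarith

/-- The inverse of the trace of the symmetric part of the differential. -/
def ti : Sm Z.region := Sm.invSqrt Z.trSq Z.ev_trSq_pos

theorem ti_mul : Z.ti * Z.ti * (Z.pb 0 0 + Z.pb 1 1 + 2) = 1 := Sm.invSqrt_mul_invSqrt_mul _ _

/-- An entry of the symmetric part of the differential. -/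
def p : Sm Z.region := (Z.pb 0 0 + 1) * Z.ti

/-- An entry of the symmetric part of the differential. -/
def q : Sm Z.region := Z.pb 0 1 * Z.ti

/-- An entry of the symmetric part of the differential. -/
def r : Sm Z.region := (Z.pb 1 1 + 1) * Z.ti

theorem ev_ti_pos (z : Z.region.carrier) : 0 < Sm.ev z Z.ti := by
  rw [ti, Sm.ev_invSqrt]
  exact inv_pos.2 (Real.sqrt_pos.2 (Z.ev_trSq_pos z))

theorem ev_p_pos (z : Z.region.carrier) : 0 < Sm.ev z Z.p := by
  have h0 := Z.ev_pb_nonneg z 0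
  simp only [p, map_mul, map_add, map_one]
  exact mul_pos (by linarith) (Z.ev_ti_pos z)

theorem ev_r_pos (z : Z.region.carrier) : 0 < Sm.ev z Z.r := by
  have h0 := Z.ev_pb_nonneg z 1
  simp only [r, map_mul, map_add, map_one]
  exact mul_pos (by linarith) (Z.ev_ti_pos z)

/-- A positive square root `S` of the matrix `pb`, of determinant one, satisfies `t S = 1 + pb` with
`t² = tr pb + 2`; this explains `p`, `q`, `r` and `ti = 1 / t`. The determinant of `1 + pb` is `t²`.
-/
theorem det_eq : Z.p * Z.r - Z.q * Z.q = 1 := by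
  have h1 := Z.ti_mul
  have h2 := Z.det_pb
  simp only [p, q, r]
  linear_combination h1 + Z.ti * Z.ti * h2

theorem p_add_r_mul_ti : (Z.p + Z.r) * Z.ti = 1 := by
  simp only [p, r]
  linear_combination Z.ti_mul

theorem p_add_r : Z.p + Z.r = Z.ti * Z.trSq := by
  simp only [p, r, trSq]
  ring

/-- The orthonormal frame of the target along the map that corresponds to the frame of the source
under the isometric part of the differential. -/
def F : Fin 2 → Fin 2 → Sm Z.region :=
  ![fun c => Z.r * Z.V 0 c - Z.q * Z.V 1 c, fun c => -Z.q * Z.V 0 c + Z.p * Z.V 1 c]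

theorem F_zero (c : Fin 2) : Z.F 0 c = Z.r * Z.V 0 c - Z.q * Z.V 1 c := rfl

theorem F_one (c : Fin 2) : Z.F 1 c = -Z.q * Z.V 0 c + Z.p * Z.V 1 c := rfl

theorem V_zero (c : Fin 2) : Z.V 0 c = Z.p * Z.F 0 c + Z.q * Z.F 1 c := by
  rw [F_zero, F_one]
  linear_combination (-Z.V 0 c) * Z.det_eq

theorem V_one (c : Fin 2) : Z.V 1 c = Z.q * Z.F 0 c + Z.r * Z.F 1 c := by
  rw [F_zero, F_one]
  linear_combination (-Z.V 1 c) * Z.det_eq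

theorem bil_combination {A : Type*} [CommRing A] (G : Fin 2 → Fin 2 → A) (x y x' y' : A)
    (v w v' w' : Fin 2 → A) :
    bil G (fun k => x * v k + y * w k) (fun k => x' * v' k + y' * w' k)
      = x * x' * bil G v v' + x * y' * bil G v w' + y * x' * bil G w v' + y * y' * bil G w w' := by
  simp only [bil, Fin.sum_univ_two]
  ring

/-- The frame `F` is `S⁻¹` applied to the vectors `V`, whose Gram matrix is `pb = S²`. -/
theorem isOrthonormalFrame : IsOrthonormalFrame Z.g' Z.F := by
  have h1 := Z.ti_mul
  have h2 := Z.det_pb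
  have e0 : Z.F 0 = fun k => Z.r * Z.V 0 k + -Z.q * Z.V 1 k := by
    funext k; rw [F_zero]; ring
  have e1 : Z.F 1 = fun k => -Z.q * Z.V 0 k + Z.p * Z.V 1 k := rfl
  have hb : ∀ i j, bil Z.g' (Z.V i) (Z.V j) = Z.pb i j := fun _ _ => rfl
  have h10 := Z.pb_symm 1 0
  intro a b
  fin_cases a <;> fin_cases b <;>
    simp only [Fin.zero_eta, Fin.mk_one, Fin.isValue, if_true, zero_ne_one, one_ne_zero, if_false,
      e0, e1, bil_combination, hb, h10, p, q, r]
  · linear_combination h1 + Z.ti * Z.ti * (Z.pb 1 1 + 2) * h2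
  · linear_combination (-Z.ti * Z.ti * Z.pb 0 1) * h2
  · linear_combination (-Z.ti * Z.ti * Z.pb 0 1) * h2
  · linear_combination h1 + Z.ti * Z.ti * (Z.pb 0 0 + 2) * h2

/-- The connection along the map is torsion-free, so the difference is the image of the bracket of
the frame fields. -/
theorem covDeriv_V_symm (k : Fin 2) :
    covDeriv Z.Γ' (Z.D 0) (Z.V 0) (Z.V 1) k - covDeriv Z.Γ' (Z.D 1) (Z.V 1) (Z.V 0) k
      = -Z.α 0 * Z.V 0 k - Z.α 1 * Z.V 1 k := by
  have h := Z.comm (Z.comp k)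
  have hΓ : Z.Γ' k 1 0 = Z.Γ' k 0 1 := congrArg Z.tgt (Z.Y.Γ_symm k 1 0)
  simp only [covDeriv, Fin.sum_univ_two, hΓ]
  simp only [V] at h ⊢
  linear_combination h

end MapChart

namespace MapChart

variable {N : Type*} [MetricSpace N] [ChartedSpace Plane N] [IsManifold 𝓘(ℝ, Plane) ∞ N]
  [Bundle.RiemannianBundle (fun p : N => TangentSpace 𝓘(ℝ, Plane) p)]
  (Z : MapChart N)

theorem ev_pd_comp (z : Z.region.carrier) (k a : Fin 2) :
    Sm.ev z (Sm.pd k (Z.comp a)) = mapDeriv Z.X.e Z.Y.e Z.X.Ω Z.f k z a :=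
  Sm.ev_pd_component ..

theorem contDiffOn_mapDeriv (k : Fin 2) :
    ContDiffOn ℝ ∞ (mapDeriv Z.X.e Z.Y.e Z.X.Ω Z.f k) Z.region.carrier :=
  (Z.contDiffOn_u.fderivWithin Z.region.uniqueDiffOn (m := ∞) (by simp)).clm_apply contDiffOn_const

theorem ev_pd_pd_comp (z : Z.region.carrier) (k l a : Fin 2) :
    Sm.ev z (Sm.pd k (Sm.pd l (Z.comp a))) = mapDeriv₂ Z.X.e Z.Y.e Z.X.Ω Z.f k l z a := by
  have : Sm.pd l (Z.comp a) = Sm.component _ (Z.contDiffOn_mapDeriv l) a :=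
    Sm.ext_ev fun y => Z.ev_pd_comp y l a
  rw [this]
  exact Sm.ev_pd_component ..

variable [IsContMDiffRiemannianBundle 𝓘(ℝ, Plane) ∞ Plane
  (fun p : N => TangentSpace 𝓘(ℝ, Plane) p)]

/-! ### The minimal surface equation in the frame -/

/-- The second fundamental form of the map, in coordinates. -/
def sff (k l a : Fin 2) : Sm Z.region :=
  Sm.pd k (Sm.pd l (Z.comp a)) + ∑ b, ∑ c, Z.Γ' a b c * Sm.pd k (Z.comp b) * Sm.pd l (Z.comp c)
    - ∑ m, Z.Γ m k l * Sm.pd m (Z.comp a)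

/-- The derivatives of the frame coefficients cancel in the difference, which is therefore
tensorial. This transfers the minimal surface equation from coordinates to the frame. -/
theorem covDeriv_V_sub (i j a : Fin 2) :
    covDeriv Z.Γ' (Z.D i) (Z.V i) (Z.V j) a
      - ∑ l, covDeriv Z.Γ (Z.D i) (Z.E i) (Z.E j) l * Sm.pd l (Z.comp a)
      = ∑ k, ∑ l, Z.E i k * Z.E j l * Z.sff k l a := by
  have hx : Z.D i (Z.V j a) = ∑ l, (Z.D i (Z.E j l) * Sm.pd l (Z.comp a)
      + Z.E j l * ∑ k, Z.E i k * Sm.pd k (Sm.pd l (Z.comp a))) := by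
    rw [V, Z.D_apply j]
    simp only [Fin.sum_univ_two, map_add, Derivation.leibniz, smul_eq_mul]
    rw [Z.D_apply i (Sm.pd 0 (Z.comp a)), Z.D_apply i (Sm.pd 1 (Z.comp a))]
    simp only [Fin.sum_univ_two]
    ring
  simp only [covDeriv]
  rw [hx]
  simp only [V, D_apply, sff, Fin.sum_univ_two]
  ring

/-- The inverse of the metric of the graph, in coordinates. -/
theorem inv_graphMetric (z : Z.region.carrier) (k l : Fin 2) :
    (graphMetric Z.X.e Z.Y.e Z.X.Ω Z.f z)⁻¹ k l = Sm.ev z (Z.ti * (Z.r * Z.E 0 k * Z.E 0 l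
      - Z.q * Z.E 0 k * Z.E 1 l - Z.q * Z.E 1 k * Z.E 0 l + Z.p * Z.E 1 k * Z.E 1 l)) := by
  set Em : Matrix (Fin 2) (Fin 2) (Sm Z.region) := Matrix.of Z.E with hEm
  set G : Matrix (Fin 2) (Fin 2) (Sm Z.region) := Matrix.of fun i j =>
    Z.src (Z.X.g i j) + ∑ a, ∑ b, Z.g' a b * Sm.pd i (Z.comp a) * Sm.pd j (Z.comp b) with hG
  -- In the frame the metric of the graph is `1 + pb`, that is, `p + r` times the matrix `[[p, q],
  -- [q, r]]`. The matrix set here is the inverse of that product.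
  set S : Matrix (Fin 2) (Fin 2) (Sm Z.region) :=
    !![Z.ti * Z.r, -(Z.ti * Z.q); -(Z.ti * Z.q), Z.ti * Z.p] with hS
  have hEG : Em * G * Em.transpose = !![1 + Z.pb 0 0, Z.pb 0 1; Z.pb 0 1, 1 + Z.pb 1 1] := by
    have key : ∀ i j, (Em * G * Em.transpose) i j = (if i = j then 1 else 0) + Z.pb i j := by
      intro i j
      have h1 : (if i = j then (1 : Sm Z.region) else 0)
          = bil (fun k l => Z.src (Z.X.g k l)) (Z.E i) (Z.E j) := by
        have := congrArg Z.src (Z.X.isOrthonormalFrame i j)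
        simp only [bil, map_sum, map_mul] at this
        simp only [bil, E, this]
        split_ifs <;> simp
      rw [h1, pb]
      simp only [Matrix.mul_apply, Matrix.transpose_apply, hEm, hG, Matrix.of_apply, bil, V,
        D_apply, Fin.sum_univ_two]
      ring
    ext i j
    rw [key]
    have h10 := Z.pb_symm 1 0
    fin_cases i <;> fin_cases j <;> simp [h10]
  have hMS : Em * (G * Em.transpose * S) = 1 := by
    rw [← mul_assoc, ← mul_assoc, hEG, hS]
    have h1 := Z.ti_mul
    have h2 := Z.det_pb
    ext i j
    fin_cases i <;> fin_cases j <;>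
      simp [Matrix.mul_apply, Fin.sum_univ_two, p, q, r]
    · linear_combination h1 + Z.ti * Z.ti * h2
    · ring
    · ring
    · linear_combination h1 + Z.ti * Z.ti * h2
  have hinv : G * (Em.transpose * S * Em) = 1 := by
    rw [← mul_assoc, ← mul_assoc]
    exact mul_eq_one_comm.1 hMS
  have hGz : (Sm.ev z).toRingHom.mapMatrix G = graphMetric Z.X.e Z.Y.e Z.X.Ω Z.f z := by
    ext i j
    simp only [hG, RingHom.mapMatrix_apply, Matrix.map_apply, Matrix.of_apply, graphMetric]
    change Sm.ev z _ = _
    simp only [map_add, map_sum, map_mul, ev_src, g', ev_tgt, ev_pd_comp]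
    rfl
  have hz := congrArg (Sm.ev z).toRingHom.mapMatrix hinv
  rw [map_mul, map_one, hGz] at hz
  rw [Matrix.inv_eq_right_inv hz]
  change Sm.ev z ((Em.transpose * S * Em) k l) = _
  congr 1
  simp only [Matrix.mul_apply, Matrix.transpose_apply, hEm, hS, Matrix.of_apply, Fin.sum_univ_two]
  simp
  ring

/-- The minimal surface equation in coordinates. -/
theorem sum_inv_graphMetric_mul_sff (z : Z.region.carrier) (a : Fin 2) :
    ∑ i, ∑ j, (graphMetric Z.X.e Z.Y.e Z.X.Ω Z.f z)⁻¹ i j * Sm.ev z (Z.sff i j a) = 0 := by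
  obtain ⟨c, hc⟩ := (Submodule.mem_span_range_iff_exists_fun ℝ).1
    (Z.minimal.minimalGraph Z.X.e Z.X.mem_atlas Z.Y.e Z.Y.mem_atlas z z.2)
  set G := (graphMetric Z.X.e Z.Y.e Z.X.Ω Z.f z)⁻¹
  -- The source component of the tangency condition determines the coefficients `c`. Substituting
  -- them in the target component leaves the contracted second fundamental form.
  have h1 : ∀ k, c k = ∑ i, ∑ j, G i j * christoffel Z.X.e k i j z := by
    intro k
    have := congrArg (fun v : Plane × Plane => v.1 k) hc
    simp only [Fin.sum_univ_two, graphTangent, graphCovDeriv] at this ⊢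
    fin_cases k <;> simpa [stdVec] using this
  have h2 := congrArg (fun v : Plane × Plane => v.2 a) hc
  have hΓ : ∀ k i j, Sm.ev z (Z.Γ k i j) = christoffel Z.X.e k i j z := fun k i j => by
    rw [Γ, ev_src, ChartedDomain.ev_Γ]; rfl
  have hΓ' : ∀ k i j, Sm.ev z (Z.Γ' k i j) = christoffel Z.Y.e k i j (Z.Y.e (Z.f (Z.X.e.symm z))) :=
    fun k i j => by rw [Γ', ev_tgt, ChartedDomain.ev_Γ]; rfl
  simp only [sff, map_add, map_sub, map_sum, map_mul, ev_pd_pd_comp, ev_pd_comp, hΓ, hΓ']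
  simp only [Fin.sum_univ_two, graphTangent, graphCovDeriv, h1] at h2 ⊢
  simp at h2
  linear_combination -h2

/-- The minimal surface equation in the frame. -/
theorem minimal_frame (a : Fin 2) :
    Z.r * (covDeriv Z.Γ' (Z.D 0) (Z.V 0) (Z.V 0) a - Z.α 0 * Z.V 1 a)
      - Z.q * (covDeriv Z.Γ' (Z.D 0) (Z.V 0) (Z.V 1) a + Z.α 0 * Z.V 0 a)
      - Z.q * (covDeriv Z.Γ' (Z.D 1) (Z.V 1) (Z.V 0) a - Z.α 1 * Z.V 1 a)
      + Z.p * (covDeriv Z.Γ' (Z.D 1) (Z.V 1) (Z.V 1) a + Z.α 1 * Z.V 0 a) = 0 := by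
  have h0 : ∀ i, covDeriv Z.Γ' (Z.D i) (Z.V i) (Z.V 0) a - Z.α i * Z.V 1 a
      = ∑ k, ∑ l, Z.E i k * Z.E 0 l * Z.sff k l a := by
    intro i
    rw [← covDeriv_V_sub, show Z.V 1 a = _ from Z.D_apply 1 (Z.comp a)]
    simp only [covDeriv_E_zero, Fin.sum_univ_two]
    ring
  have h1 : ∀ i, covDeriv Z.Γ' (Z.D i) (Z.V i) (Z.V 1) a + Z.α i * Z.V 0 a
      = ∑ k, ∑ l, Z.E i k * Z.E 1 l * Z.sff k l a := by
    intro i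
    rw [← covDeriv_V_sub, show Z.V 0 a = _ from Z.D_apply 0 (Z.comp a)]
    simp only [covDeriv_E_one, Fin.sum_univ_two]
    ring
  rw [h0, h0, h1, h1]
  have h : ∑ k, ∑ l, Z.ti * (Z.r * Z.E 0 k * Z.E 0 l - Z.q * Z.E 0 k * Z.E 1 l
      - Z.q * Z.E 1 k * Z.E 0 l + Z.p * Z.E 1 k * Z.E 1 l) * Z.sff k l a = 0 := by
    refine Sm.ext_ev fun z => ?_
    have := Z.sum_inv_graphMetric_mul_sff z a
    simp only [inv_graphMetric, ← map_mul, ← map_sum] at this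
    rw [this, map_zero]
  have ht := Z.p_add_r_mul_ti
  -- The inverse metric of the graph carries the factor `ti`, which multiplication by `p + r`
  -- removes.
  have := congrArg (fun x => (Z.p + Z.r) * x) h
  simp only [mul_zero] at this
  rw [← this]
  simp only [Fin.sum_univ_two]
  linear_combination (-(Z.r * (Z.E 0 0 * Z.E 0 0 * Z.sff 0 0 a + Z.E 0 0 * Z.E 0 1 * Z.sff 0 1 a
    + Z.E 0 1 * Z.E 0 0 * Z.sff 1 0 a + Z.E 0 1 * Z.E 0 1 * Z.sff 1 1 a)
    - Z.q * (Z.E 0 0 * Z.E 1 0 * Z.sff 0 0 a + Z.E 0 0 * Z.E 1 1 * Z.sff 0 1 a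
    + Z.E 0 1 * Z.E 1 0 * Z.sff 1 0 a + Z.E 0 1 * Z.E 1 1 * Z.sff 1 1 a)
    - Z.q * (Z.E 1 0 * Z.E 0 0 * Z.sff 0 0 a + Z.E 1 0 * Z.E 0 1 * Z.sff 0 1 a
    + Z.E 1 1 * Z.E 0 0 * Z.sff 1 0 a + Z.E 1 1 * Z.E 0 1 * Z.sff 1 1 a)
    + Z.p * (Z.E 1 0 * Z.E 1 0 * Z.sff 0 0 a + Z.E 1 0 * Z.E 1 1 * Z.sff 0 1 a
    + Z.E 1 1 * Z.E 1 0 * Z.sff 1 0 a + Z.E 1 1 * Z.E 1 1 * Z.sff 1 1 a))) * ht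

/-- The connection form of the transported frame. -/
def β (i : Fin 2) : Sm Z.region := bil Z.g' (Z.F 1) (covDeriv Z.Γ' (Z.D i) (Z.V i) (Z.F 0))

theorem covDeriv_F (i : Fin 2) :
    (∀ k, covDeriv Z.Γ' (Z.D i) (Z.V i) (Z.F 0) k = Z.β i * Z.F 1 k) ∧
      ∀ k, covDeriv Z.Γ' (Z.D i) (Z.V i) (Z.F 1) k = -Z.β i * Z.F 0 k :=
  Z.isOrthonormalFrame.covDeriv_eq (Z.isCompatible i) Z.g'_symm

/-- Because the transported frame has the connection form of the source frame, tensors on the two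
sides can be differentiated and paired in one frame. -/
theorem parallel : Z.β 0 = Z.α 0 ∧ Z.β 1 = Z.α 1 ∧
    Z.D 0 Z.q - Z.α 0 * Z.r + Z.α 0 * Z.p = Z.D 1 Z.p - 2 * Z.α 1 * Z.q ∧
    Z.D 0 Z.r + 2 * Z.α 0 * Z.q = Z.D 1 Z.q - Z.α 1 * Z.r + Z.α 1 * Z.p :=
  parallel_of_minimal Z.isOrthonormalFrame Z.det_eq (.of_mul_eq_one _ Z.p_add_r_mul_ti)
    (fun i => (Z.covDeriv_F i).1) (fun i => (Z.covDeriv_F i).2) Z.V_zero Z.V_one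
    Z.covDeriv_V_symm Z.minimal_frame

theorem β_eq (i : Fin 2) : Z.β i = Z.α i := by
  fin_cases i
  exacts [Z.parallel.1, Z.parallel.2.1]

end MapChart

/-! ### The structure equations -/

section FrameDerivatives

variable {A : Type*} [CommRing A] [Algebra ℝ A] {F : Fin 2 → Fin 2 → A}
  {Γ : Fin 2 → Fin 2 → Fin 2 → A} {D : Derivation ℝ A A} {U : Fin 2 → A} {α : A}

/-- The derivatives of the components of a differential in a frame. -/
theorem deriv_pairing_frame {d : Fin 2 → A} {H : Fin 2 → Fin 2 → A}
    (h0 : ∀ k, covDeriv Γ D U (F 0) k = α * F 1 k) (h1 : ∀ k, covDeriv Γ D U (F 1) k = -α * F 0 k)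
    (hd : ∀ k, D (d k) = ∑ c, U c * (H c k + ∑ m, Γ m c k * d m)) (a : Fin 2) :
    D (∑ k, d k * F a k) = bil H U (F a) + α * rot (fun a => ∑ k, d k * F a k) a := by
  rw [deriv_pairing hd]
  fin_cases a
  · simp only [Fin.zero_eta, h0, rot_zero, Fin.sum_univ_two]; ring
  · simp only [Fin.mk_one, h1, rot_one, Fin.sum_univ_two]; ring

/-- The derivatives of the components of a tensor in a frame. -/
theorem deriv_tensor_frame {H : Fin 2 → Fin 2 → A} {T : Fin 2 → Fin 2 → Fin 2 → A}
    (h0 : ∀ k, covDeriv Γ D U (F 0) k = α * F 1 k) (h1 : ∀ k, covDeriv Γ D U (F 1) k = -α * F 0 k)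
    (hH : ∀ i j, D (H i j) = ∑ c, U c * (T c i j + ∑ m, (Γ m c i * H m j + Γ m c j * H i m)))
    (a b : Fin 2) :
    D (bil H (F a) (F b)) = tril T U (F a) (F b)
      + α * (rot (fun c => bil H (F c) (F b)) a + rot (fun c => bil H (F a) (F c)) b) := by
  rw [deriv_tensor hH]
  have e0 : covDeriv Γ D U (F 0) = fun k => α * F 1 k := funext h0
  have e1 : covDeriv Γ D U (F 1) = fun k => -α * F 0 k := funext h1
  fin_cases a <;> fin_cases b <;>
    simp only [Fin.zero_eta, Fin.mk_one, e0, e1, rot_zero, rot_one, bil, Fin.sum_univ_two] <;> ring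

end FrameDerivatives

namespace MapChart

variable {N : Type*} [MetricSpace N] [ChartedSpace Plane N] [IsManifold 𝓘(ℝ, Plane) ∞ N]
  [Bundle.RiemannianBundle (fun p : N => TangentSpace 𝓘(ℝ, Plane) p)]
  [IsContMDiffRiemannianBundle 𝓘(ℝ, Plane) ∞ Plane (fun p : N => TangentSpace 𝓘(ℝ, Plane) p)]
  (Z : MapChart N)

theorem deriv_src_pd (i : Fin 2) (φ : Sm Z.X.region) (k : Fin 2) :
    Z.D i (Z.src (Sm.pd k φ)) = ∑ c, Z.E i c * (Z.src (Sm.hess Z.X.Γ φ c k)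
      + ∑ m, Z.Γ m c k * Z.src (Sm.pd m φ)) := by
  have := Sm.deriv_pull_pd (hv := contDiffOn_id) (hm := Z.mapsTo_id) (Z.D_apply i) Z.X.Γ φ k
  simp only [D_component_id] at this
  exact this

theorem deriv_src_hess (i : Fin 2) (φ : Sm Z.X.region) (a b : Fin 2) :
    Z.D i (Z.src (Sm.hess Z.X.Γ φ a b)) = ∑ c, Z.E i c * (Z.src (Sm.covHess Z.X.Γ φ c a b)
      + ∑ m, (Z.Γ m c a * Z.src (Sm.hess Z.X.Γ φ m b)
        + Z.Γ m c b * Z.src (Sm.hess Z.X.Γ φ a m))) := by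
  have := Sm.deriv_pull_hess (hv := contDiffOn_id) (hm := Z.mapsTo_id) (Z.D_apply i) Z.X.Γ φ a b
  simp only [D_component_id] at this
  exact this

theorem deriv_tgt (i : Fin 2) (φ : Sm Z.Y.region) :
    Z.D i (Z.tgt φ) = ∑ c, Z.V i c * Z.tgt (Sm.pd c φ) :=
  Sm.deriv_pull (Z.D_apply i) φ

theorem deriv_tgt_pd (i : Fin 2) (φ : Sm Z.Y.region) (k : Fin 2) :
    Z.D i (Z.tgt (Sm.pd k φ)) = ∑ c, Z.V i c * (Z.tgt (Sm.hess Z.Y.Γ φ c k)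
      + ∑ m, Z.Γ' m c k * Z.tgt (Sm.pd m φ)) :=
  Sm.deriv_pull_pd (Z.D_apply i) Z.Y.Γ φ k

theorem deriv_tgt_hess (i : Fin 2) (φ : Sm Z.Y.region) (a b : Fin 2) :
    Z.D i (Z.tgt (Sm.hess Z.Y.Γ φ a b)) = ∑ c, Z.V i c * (Z.tgt (Sm.covHess Z.Y.Γ φ c a b)
      + ∑ m, (Z.Γ' m c a * Z.tgt (Sm.hess Z.Y.Γ φ m b)
        + Z.Γ' m c b * Z.tgt (Sm.hess Z.Y.Γ φ a m))) :=
  Sm.deriv_pull_hess (Z.D_apply i) Z.Y.Γ φ a b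

theorem covDeriv_F_zero (i k : Fin 2) :
    covDeriv Z.Γ' (Z.D i) (Z.V i) (Z.F 0) k = Z.α i * Z.F 1 k := by
  rw [(Z.covDeriv_F i).1, β_eq]

theorem covDeriv_F_one (i k : Fin 2) :
    covDeriv Z.Γ' (Z.D i) (Z.V i) (Z.F 1) k = -Z.α i * Z.F 0 k := by
  rw [(Z.covDeriv_F i).2, β_eq]

/-- The structure equations of a minimal Lagrangian map, with a function on the source and a
function on the target. -/
def model (φ : Sm Z.X.region) (ψ : Sm Z.Y.region) : MinimalModel (Sm Z.region) where
  D := Z.D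
  α := Z.α
  p := Z.p
  q := Z.q
  r := Z.r
  h := Z.src φ
  w := Z.tgt ψ
  dh i := ∑ k, Z.src (Sm.pd k φ) * Z.E i k
  dk i := ∑ k, Z.tgt (Sm.pd k ψ) * Z.F i k
  Hh i j := bil (fun a b => Z.src (Sm.hess Z.X.Γ φ a b)) (Z.E i) (Z.E j)
  Hk i j := bil (fun a b => Z.tgt (Sm.hess Z.Y.Γ ψ a b)) (Z.F i) (Z.F j)
  Th c i j := tril (fun c a b => Z.src (Sm.covHess Z.X.Γ φ c a b)) (Z.E c) (Z.E i) (Z.E j)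
  Tk c i j := tril (fun c a b => Z.tgt (Sm.covHess Z.Y.Γ ψ c a b)) (Z.F c) (Z.F i) (Z.F j)
  comm := Z.comm
  det_eq := Z.det_eq
  codazzi₀ := Z.parallel.2.2.1
  codazzi₁ := Z.parallel.2.2.2
  deriv_h i := by
    rw [D_src, Z.X.D_apply, map_sum]
    exact Finset.sum_congr rfl fun k _ => by rw [map_mul, mul_comm]; rfl
  deriv_dh i a := deriv_pairing_frame (Z.covDeriv_E_zero i) (Z.covDeriv_E_one i)
    (Z.deriv_src_pd i φ) a
  deriv_Hh i a b := deriv_tensor_frame (Z.covDeriv_E_zero i) (Z.covDeriv_E_one i)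
    (Z.deriv_src_hess i φ) a b
  deriv_w := by
    constructor
    · simp only [deriv_tgt, V_zero, Fin.sum_univ_two]; ring
    · simp only [deriv_tgt, V_one, Fin.sum_univ_two]; ring
  deriv_dk₀ a := by
    rw [deriv_pairing_frame (Z.covDeriv_F_zero 0) (Z.covDeriv_F_one 0)
      (Z.deriv_tgt_pd 0 ψ) a]
    congr 1
    simp only [bil, V_zero, Fin.sum_univ_two]
    ring
  deriv_dk₁ a := by
    rw [deriv_pairing_frame (Z.covDeriv_F_zero 1) (Z.covDeriv_F_one 1)
      (Z.deriv_tgt_pd 1 ψ) a]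
    congr 1
    simp only [bil, V_one, Fin.sum_univ_two]
    ring
  deriv_Hk₀ a b := by
    rw [deriv_tensor_frame (Z.covDeriv_F_zero 0) (Z.covDeriv_F_one 0)
      (Z.deriv_tgt_hess 0 ψ) a b]
    congr 1
    simp only [tril, V_zero, Fin.sum_univ_two]
    ring
  deriv_Hk₁ a b := by
    rw [deriv_tensor_frame (Z.covDeriv_F_zero 1) (Z.covDeriv_F_one 1)
      (Z.deriv_tgt_hess 1 ψ) a b]
    congr 1
    simp only [tril, V_one, Fin.sum_univ_two]
    ring

/-- The curvature in the Bochner formula comes from the source alone, so its bound does not depend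
on the map. -/
theorem model_curv (φ : Sm Z.X.region) (ψ : Sm Z.Y.region) :
    (Z.model φ ψ).curv = Z.src Z.X.curv := by
  simp only [MinimalModel.curv, model, α, D_src, ChartedDomain.curv, map_add, map_sub, map_mul]

end MapChart

/-! ### Uniform bounds for the covariant derivatives of a function -/

theorem abs_mul_le_mul_abs {a b ρ : ℝ} (hb : |b| ≤ ρ) : |a * b| ≤ ρ * |a| := by
  rw [abs_mul, mul_comm]
  exact mul_le_mul_of_nonneg_right hb (abs_nonneg a)

theorem abs_pairing_le {d U : Fin 2 → ℝ} {ρ : ℝ} (hU : ∀ i, |U i| ≤ ρ) :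
    |∑ k, d k * U k| ≤ ρ * ∑ k, |d k| := by
  rw [Finset.mul_sum]
  exact (Finset.abs_sum_le_sum_abs _ _).trans
    (Finset.sum_le_sum fun k _ => abs_mul_le_mul_abs (hU k))

theorem abs_bil_le {H : Fin 2 → Fin 2 → ℝ} {U V : Fin 2 → ℝ} {ρ : ℝ} (hU : ∀ i, |U i| ≤ ρ)
    (hV : ∀ i, |V i| ≤ ρ) : |bil H U V| ≤ ρ * (ρ * ∑ i, ∑ j, |H i j|) := by
  have hρ : 0 ≤ ρ := (abs_nonneg _).trans (hU 0)
  simp only [bil, Finset.mul_sum]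
  refine (Finset.abs_sum_le_sum_abs _ _).trans (Finset.sum_le_sum fun i _ => ?_)
  refine (Finset.abs_sum_le_sum_abs _ _).trans (Finset.sum_le_sum fun j _ => ?_)
  exact (abs_mul_le_mul_abs (hV j)).trans
    (mul_le_mul_of_nonneg_left (abs_mul_le_mul_abs (hU i)) hρ)

theorem abs_tril_le {T : Fin 2 → Fin 2 → Fin 2 → ℝ} {U V W : Fin 2 → ℝ} {ρ : ℝ}
    (hU : ∀ i, |U i| ≤ ρ) (hV : ∀ i, |V i| ≤ ρ) (hW : ∀ i, |W i| ≤ ρ) :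
    |tril T U V W| ≤ ρ * (ρ * (ρ * ∑ c, ∑ i, ∑ j, |T c i j|)) := by
  have hρ : 0 ≤ ρ := (abs_nonneg _).trans (hU 0)
  simp only [tril, Finset.mul_sum]
  refine (Finset.abs_sum_le_sum_abs _ _).trans (Finset.sum_le_sum fun c _ => ?_)
  refine (Finset.abs_sum_le_sum_abs _ _).trans (Finset.sum_le_sum fun i _ => ?_)
  refine (Finset.abs_sum_le_sum_abs _ _).trans (Finset.sum_le_sum fun j _ => ?_)
  exact (abs_mul_le_mul_abs (hW j)).trans (mul_le_mul_of_nonneg_left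
    ((abs_mul_le_mul_abs (hV i)).trans
      (mul_le_mul_of_nonneg_left (abs_mul_le_mul_abs (hU c)) hρ)) hρ)

/-- A bound for the components of a unit vector. -/
theorem abs_le_of_bil_eq_one {g : Fin 2 → Fin 2 → ℝ} {U : Fin 2 → ℝ} {d : ℝ}
    (hg : g 1 0 = g 0 1) (h0 : 0 < g 0 0) (hd : d * (g 0 0 * g 1 1 - g 0 1 * g 0 1) = 1)
    (hd0 : 0 < d) (hU : bil g U U = 1) (i : Fin 2) : |U i| ≤ 1 + (g 0 0 + g 1 1) * d := by
  have hdet : 0 < g 0 0 * g 1 1 - g 0 1 * g 0 1 := by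
    refine pos_of_mul_pos_right ?_ hd0.le
    rw [hd]; exact one_pos
  have h1 : 0 < g 1 1 := by
    refine pos_of_mul_pos_right (a := g 0 0) ?_ h0.le
    linarith [mul_self_nonneg (g 0 1)]
  have key : U i ^ 2 ≤ (g 0 0 + g 1 1) * d := by
    simp only [bil, Fin.sum_univ_two, hg] at hU
    rw [← mul_one (U i ^ 2), ← hd]
    fin_cases i
    · have : U 0 ^ 2 * (g 0 0 * g 1 1 - g 0 1 * g 0 1) ≤ g 1 1 := by
        -- Completing the square in the other component of the unit vector.
        have : U 0 ^ 2 * (g 0 0 * g 1 1 - g 0 1 * g 0 1)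
            = g 1 1 - (g 0 1 * U 0 + g 1 1 * U 1) ^ 2 := by
          linear_combination g 1 1 * hU
        rw [this]
        linarith [sq_nonneg (g 0 1 * U 0 + g 1 1 * U 1)]
      have := mul_le_mul_of_nonneg_left this hd0.le
      have := mul_pos h0 hd0
      simp only [Fin.zero_eta]
      linarith
    · have : U 1 ^ 2 * (g 0 0 * g 1 1 - g 0 1 * g 0 1) ≤ g 0 0 := by
        have : U 1 ^ 2 * (g 0 0 * g 1 1 - g 0 1 * g 0 1)
            = g 0 0 - (g 0 0 * U 0 + g 0 1 * U 1) ^ 2 := by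
          linear_combination g 0 0 * hU
        rw [this]
        linarith [sq_nonneg (g 0 0 * U 0 + g 0 1 * U 1)]
      have := mul_le_mul_of_nonneg_left this hd0.le
      have := mul_pos h1 hd0
      simp only [Fin.mk_one]
      linarith
  have : |U i| ≤ 1 + U i ^ 2 := by
    rw [← sq_abs]
    nlinarith [sq_nonneg (|U i| - 1), abs_nonneg (U i)]
  linarith

theorem Sm.continuous_ev {s : Region} (φ : Sm s) : Continuous fun y : s.carrier => Sm.ev y φ := by
  have := continuousOn_iff_continuous_domRestrict.1 φ.contDiffOn.continuousOn
  refine this.congr fun y => ?_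
  exact φ.ext₀_apply y

namespace ChartedDomain

variable {N : Type*} [MetricSpace N] [ChartedSpace Plane N] [IsManifold 𝓘(ℝ, Plane) ∞ N]
  [Bundle.RiemannianBundle (fun p : N => TangentSpace 𝓘(ℝ, Plane) p)]
  [IsContMDiffRiemannianBundle 𝓘(ℝ, Plane) ∞ Plane (fun p : N => TangentSpace 𝓘(ℝ, Plane) p)]

/-- Unit vectors at a point of the chart. -/
def IsUnitVec (X : ChartedDomain N) (y : X.region.carrier) (U : Fin 2 → ℝ) : Prop :=
  bil (fun i j => Sm.ev y (X.g i j)) U U = 1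

/-- The covariant derivatives of `φ` up to order three and the curvature are bounded by `C`. -/
structure IsBoundedAt (X : ChartedDomain N) (φ : Sm X.region) (C : ℝ) (y : X.region.carrier) :
    Prop where
  curv : |Sm.ev y X.curv| ≤ C
  differential : ∀ U, X.IsUnitVec y U → |∑ k, Sm.ev y (Sm.pd k φ) * U k| ≤ C
  hess : ∀ U V, X.IsUnitVec y U → X.IsUnitVec y V →
    |bil (fun i j => Sm.ev y (Sm.hess X.Γ φ i j)) U V| ≤ C
  covHess : ∀ U V W, X.IsUnitVec y U → X.IsUnitVec y V → X.IsUnitVec y W →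
    |tril (fun c i j => Sm.ev y (Sm.covHess X.Γ φ c i j)) U V W| ≤ C

theorem IsBoundedAt.mono {X : ChartedDomain N} {φ : Sm X.region} {C C' : ℝ} {y : X.region.carrier}
    (h : X.IsBoundedAt φ C y) (hC : C ≤ C') : X.IsBoundedAt φ C' y where
  curv := h.curv.trans hC
  differential U hU := (h.differential U hU).trans hC
  hess U V hU hV := (h.hess U V hU hV).trans hC
  covHess U V W hU hV hW := (h.covHess U V W hU hV hW).trans hC

/-- A bound for the components of unit vectors. -/
def radius (X : ChartedDomain N) : Sm X.region := 1 + (X.g 0 0 + X.g 1 1) * (X.b * X.b)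

theorem IsUnitVec.abs_le {X : ChartedDomain N} {y : X.region.carrier} {U : Fin 2 → ℝ}
    (hU : X.IsUnitVec y U) (i : Fin 2) : |U i| ≤ Sm.ev y X.radius := by
  have hb := congrArg (Sm.ev y) X.b_mul
  have h0 : 0 < Sm.ev y X.b := by
    rw [b, Sm.ev_invSqrt]
    exact inv_pos.2 (Real.sqrt_pos.2 (X.ev_det_pos y))
  simp only [map_mul, map_sub, map_one] at hb
  simp only [radius, map_add, map_mul, map_one]
  exact abs_le_of_bil_eq_one (g := fun i j => Sm.ev y (X.g i j)) (congrArg (Sm.ev y) (X.g_symm 1 0))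
    (X.ev_g_zero_zero_pos y) hb (mul_pos h0 h0) hU i

/-- A continuous bound for the covariant derivatives. -/
def boundFun (X : ChartedDomain N) (φ : Sm X.region) (y : X.region.carrier) : ℝ :=
  |Sm.ev y X.curv| + |Sm.ev y X.radius| * ∑ k, |Sm.ev y (Sm.pd k φ)|
    + |Sm.ev y X.radius| * (|Sm.ev y X.radius| * ∑ i, ∑ j, |Sm.ev y (Sm.hess X.Γ φ i j)|)
    + |Sm.ev y X.radius| * (|Sm.ev y X.radius|
      * (|Sm.ev y X.radius| * ∑ c, ∑ i, ∑ j, |Sm.ev y (Sm.covHess X.Γ φ c i j)|))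

theorem continuous_boundFun (X : ChartedDomain N) (φ : Sm X.region) :
    Continuous (X.boundFun φ) := by
  have h : ∀ ψ : Sm X.region, Continuous fun y => |Sm.ev y ψ| := fun ψ => ψ.continuous_ev.abs
  refine Continuous.add (Continuous.add (Continuous.add (h _) ?_) ?_) ?_
  · exact (h _).mul (continuous_finsetSum _ fun _ _ => h _)
  · exact (h _).mul ((h _).mul (continuous_finsetSum _ fun _ _ => continuous_finsetSum _
      fun _ _ => h _))
  · exact (h _).mul ((h _).mul ((h _).mul (continuous_finsetSum _ fun _ _ =>
      continuous_finsetSum _ fun _ _ => continuous_finsetSum _ fun _ _ => h _)))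

theorem isBoundedAt_boundFun (X : ChartedDomain N) (φ : Sm X.region) (y : X.region.carrier) :
    X.IsBoundedAt φ (X.boundFun φ y) y := by
  have hρ : ∀ U, X.IsUnitVec y U → ∀ i, |U i| ≤ |Sm.ev y X.radius| := fun U hU i =>
    (hU.abs_le i).trans (le_abs_self _)
  have h0 : 0 ≤ |Sm.ev y X.curv| := abs_nonneg _
  have h1 : 0 ≤ |Sm.ev y X.radius| * ∑ k, |Sm.ev y (Sm.pd k φ)| := by positivity
  have h2 : 0 ≤ |Sm.ev y X.radius| * (|Sm.ev y X.radius|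
      * ∑ i, ∑ j, |Sm.ev y (Sm.hess X.Γ φ i j)|) := by positivity
  have h3 : 0 ≤ |Sm.ev y X.radius| * (|Sm.ev y X.radius|
      * (|Sm.ev y X.radius| * ∑ c, ∑ i, ∑ j, |Sm.ev y (Sm.covHess X.Γ φ c i j)|)) := by positivity
  refine ⟨?_, fun U hU => (abs_pairing_le (hρ U hU)).trans ?_,
    fun U V hU hV => (abs_bil_le (hρ U hU) (hρ V hV)).trans ?_,
    fun U V W hU hV hW => (abs_tril_le (hρ U hU) (hρ V hV) (hρ W hW)).trans ?_⟩ <;>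
    (rw [boundFun]; linarith)

/-- The covariant derivatives of a smooth function on a compact domain are bounded. -/
theorem exists_bound {Ω : Set N} (hΩ : IsCompact Ω) (hb : HasSmoothBoundary Ω) {h : N → ℝ}
    (hh : ContMDiffOn 𝓘(ℝ, Plane) 𝓘(ℝ, ℝ) ∞ h Ω) :
    ∃ C : ℝ, ∀ x ∈ Ω, ∃ (e : OpenPartialHomeomorph N Plane) (he : e ∈ atlas Plane N)
      (y : (ChartedDomain.mk e he Ω hb).region.carrier), e.symm y = x ∧
        (ChartedDomain.mk e he Ω hb).IsBoundedAt (fn _ h hh) C y := by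
  -- The induction runs over arbitrary subsets of `N`, so membership in `Ω` has to be part of the
  -- property.
  suffices H : ∃ C : ℝ, ∀ x ∈ Ω, x ∈ Ω →
      ∃ (e : OpenPartialHomeomorph N Plane) (he : e ∈ atlas Plane N)
      (y : (ChartedDomain.mk e he Ω hb).region.carrier), e.symm y = x ∧
        (ChartedDomain.mk e he Ω hb).IsBoundedAt (fn _ h hh) C y by
    obtain ⟨C, hC⟩ := H
    exact ⟨C, fun x hx => hC x hx hx⟩
  refine hΩ.induction_on (p := fun s => ∃ C : ℝ, ∀ x ∈ s, x ∈ Ω →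
      ∃ (e : OpenPartialHomeomorph N Plane) (he : e ∈ atlas Plane N)
      (y : (ChartedDomain.mk e he Ω hb).region.carrier), e.symm y = x ∧
        (ChartedDomain.mk e he Ω hb).IsBoundedAt (fn _ h hh) C y) ⟨0, by simp⟩ ?_ ?_ ?_
  · rintro s t hst ⟨C, hC⟩
    exact ⟨C, fun x hx => hC x (hst hx)⟩
  · rintro s t ⟨C, hC⟩ ⟨C', hC'⟩
    refine ⟨max C C', fun x hx hxΩ => ?_⟩
    rcases hx with hx | hx
    · obtain ⟨e, he, y, hy, hB⟩ := hC x hx hxΩ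
      exact ⟨e, he, y, hy, hB.mono (le_max_left _ _)⟩
    · obtain ⟨e, he, y, hy, hB⟩ := hC' x hx hxΩ
      exact ⟨e, he, y, hy, hB.mono (le_max_right _ _)⟩
  · intro x₀ hx₀
    -- Near `x₀` one fixed chart serves all points, and the continuous bound in it stays below its
    -- value at `x₀` plus one.
    set e := chartAt Plane x₀
    have he : e ∈ atlas Plane N := chart_mem_atlas Plane x₀
    have hx₀e : x₀ ∈ e.source := mem_chart_source Plane x₀
    set X := ChartedDomain.mk e he Ω hb
    have hmem : ∀ x ∈ e.source, x ∈ Ω → e x ∈ X.region.carrier := fun x hx hxΩ =>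
      ⟨e.map_source hx, by change e.symm (e x) ∈ Ω; rwa [e.left_inv hx]⟩
    set y₀ : X.region.carrier := ⟨e x₀, hmem x₀ hx₀e hx₀⟩
    have hcont := (X.continuous_boundFun (fn X h hh)).continuousAt (x := y₀)
    have hnhds := hcont.eventually_lt_const (lt_add_one (X.boundFun (fn X h hh) y₀))
    rw [nhds_subtype_eq_comap, Filter.eventually_comap] at hnhds
    have h1 := (e.continuousAt hx₀e).eventually hnhds
    refine ⟨{x | x ∈ e.source ∧ ∀ y : X.region.carrier, (y : Plane) = e x →
      X.boundFun (fn X h hh) y < X.boundFun (fn X h hh) y₀ + 1}, ?_,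
      X.boundFun (fn X h hh) y₀ + 1, ?_⟩
    · exact nhdsWithin_le_nhds (Filter.inter_mem (e.open_source.mem_nhds hx₀e) h1)
    · rintro x ⟨hxe, hx⟩ hxΩ
      exact ⟨e, he, ⟨e x, hmem x hxe hxΩ⟩, e.left_inv hxe,
        (X.isBoundedAt_boundFun _ _).mono (hx ⟨e x, hmem x hxe hxΩ⟩ rfl).le⟩

end ChartedDomain

/-! ### Orthonormal pairs in Euclidean planes -/

section OrthonormalPair

variable {E E' : Type*} [NormedAddCommGroup E] [InnerProductSpace ℝ E] {v : Fin 2 → E}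

theorem exists_orthonormalBasis_of_pair (hE : Module.finrank ℝ E = 2)
    (hv : ∀ i j, inner ℝ (v i) (v j) = if i = j then (1 : ℝ) else 0) :
    ∃ b : OrthonormalBasis (Fin 2) ℝ E, ∀ i, b i = v i := by
  have hon : Orthonormal ℝ v := orthonormal_iff_ite.2 hv
  refine ⟨(basisOfOrthonormalOfCardEqFinrank hon (by simp [hE])).toOrthonormalBasis (by simpa),
    fun i => by simp⟩

/-- The expansion of the vector that represents a functional. -/
theorem toDual_symm_eq_sum [CompleteSpace E] (hE : Module.finrank ℝ E = 2)
    (hv : ∀ i j, inner ℝ (v i) (v j) = if i = j then (1 : ℝ) else 0) (ℓ : E →L[ℝ] ℝ) :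
    (InnerProductSpace.toDual ℝ E).symm ℓ = ∑ i, ℓ (v i) • v i := by
  obtain ⟨b, hb⟩ := exists_orthonormalBasis_of_pair hE hv
  rw [← b.sum_repr ((InnerProductSpace.toDual ℝ E).symm ℓ)]
  refine Finset.sum_congr rfl fun i _ => ?_
  rw [OrthonormalBasis.repr_apply_apply, hb, real_inner_comm,
    InnerProductSpace.toDual_symm_apply]

theorem norm_sq_toDual_symm [CompleteSpace E] (hE : Module.finrank ℝ E = 2)
    (hv : ∀ i j, inner ℝ (v i) (v j) = if i = j then (1 : ℝ) else 0) (ℓ : E →L[ℝ] ℝ) :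
    ‖(InnerProductSpace.toDual ℝ E).symm ℓ‖ ^ 2 = ℓ (v 0) ^ 2 + ℓ (v 1) ^ 2 := by
  rw [← real_inner_self_eq_norm_sq, InnerProductSpace.toDual_symm_apply,
    toDual_symm_eq_sum hE hv]
  simp [Fin.sum_univ_two, sq]

variable [NormedAddCommGroup E'] [InnerProductSpace ℝ E'] [FiniteDimensional ℝ E']
  [FiniteDimensional ℝ E]

/-- The determinant of `1 + A* A` in terms of the images of an orthonormal pair. -/
theorem det_id_add_adjoint_comp (hE : Module.finrank ℝ E = 2)
    (hv : ∀ i j, inner ℝ (v i) (v j) = if i = j then (1 : ℝ) else 0) (A : E →ₗ[ℝ] E') :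
    LinearMap.det (LinearMap.id + LinearMap.adjoint A ∘ₗ A)
      = (1 + inner ℝ (A (v 0)) (A (v 0))) * (1 + inner ℝ (A (v 1)) (A (v 1)))
        - inner ℝ (A (v 0)) (A (v 1)) * inner ℝ (A (v 0)) (A (v 1)) := by
  obtain ⟨b, hb⟩ := exists_orthonormalBasis_of_pair hE hv
  rw [← LinearMap.det_toMatrix b.toBasis, Matrix.det_fin_two]
  have key : ∀ i j, LinearMap.toMatrix b.toBasis b.toBasis
      (LinearMap.id + LinearMap.adjoint A ∘ₗ A) i j
      = (if i = j then (1 : ℝ) else 0) + inner ℝ (A (v i)) (A (v j)) := by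
    intro i j
    rw [LinearMap.toMatrix_apply, OrthonormalBasis.coe_toBasis_repr_apply,
      OrthonormalBasis.repr_apply_apply, OrthonormalBasis.coe_toBasis, hb, hb]
    simp [inner_add_right, hv, LinearMap.adjoint_inner_right]
  rw [key, key, key, key, real_inner_comm (A (v 0)) (A (v 1))]
  simp

theorem adjoint_comp_eq_sum (hE : Module.finrank ℝ E = 2)
    (hv : ∀ i j, inner ℝ (v i) (v j) = if i = j then (1 : ℝ) else 0) (A : E →ₗ[ℝ] E') (x : E) :
    LinearMap.adjoint A (A x) = ∑ j, inner ℝ (A (v j)) (A x) • v j := by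
  obtain ⟨b, hb⟩ := exists_orthonormalBasis_of_pair hE hv
  rw [← b.sum_repr (LinearMap.adjoint A (A x))]
  refine Finset.sum_congr rfl fun i _ => ?_
  rw [OrthonormalBasis.repr_apply_apply, hb, LinearMap.adjoint_inner_right]

theorem apply_toDual_symm_sub [CompleteSpace E] (hE : Module.finrank ℝ E = 2)
    (hv : ∀ i j, inner ℝ (v i) (v j) = if i = j then (1 : ℝ) else 0) (A : E →ₗ[ℝ] E')
    (ℓ : E →L[ℝ] ℝ) (k : E' →L[ℝ] ℝ) (c : ℝ) :
    c * k (A ((InnerProductSpace.toDual ℝ E).symm ℓ))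
      - k (A (LinearMap.adjoint A (A ((InnerProductSpace.toDual ℝ E).symm ℓ))))
      = c * ∑ i, ℓ (v i) * k (A (v i))
        - ∑ j, ∑ i, ℓ (v i) * inner ℝ (A (v j)) (A (v i)) * k (A (v j)) := by
  rw [adjoint_comp_eq_sum hE hv, toDual_symm_eq_sum hE hv]
  simp [Fin.sum_univ_two, inner_add_right, inner_smul_right]
  ring

end OrthonormalPair

/-! ### Chart-free expressions for the gradient pairing and the determinant -/

section Pairing

variable {N : Type*} [MetricSpace N] [ChartedSpace Plane N]

theorem finrank_tan (p : N) : Module.finrank ℝ (Tan p) = 2 := finrank_euclideanSpace_fin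

variable [Bundle.RiemannianBundle (fun p : N => TangentSpace 𝓘(ℝ, Plane) p)]

/-- The inner product of the gradients of `h` and `h'`, identified by the isometric part of the
polar decomposition of the differential of the area preserving map `f`. -/
def gradPairing (Ω Ω' : Set N) (h h' : N → ℝ) (f : N → N) (p : N) : ℝ :=
  let A : Tan p →ₗ[ℝ] Tan (f p) := (diffOn f Ω p).toLinearMap
  let k : Tan (f p) →L[ℝ] ℝ := mfderivWithin 𝓘(ℝ, Plane) 𝓘(ℝ, ℝ) h' Ω' (f p)
  ((detOnePlusAdjointMul f Ω p - 1) * k (A (gradOn h Ω p))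
    - k (A (LinearMap.adjoint A (A (gradOn h Ω p))))) / √(detOnePlusAdjointMul f Ω p)

theorem gradPairing_eq (Ω Ω' : Set N) (h h' : N → ℝ) (f : N → N) (p : N) {v : Fin 2 → Plane}
    (hv : ∀ i j, innerAt p (v i) (v j) = if i = j then (1 : ℝ) else 0) :
    gradPairing Ω Ω' h h' f p = ((detOnePlusAdjointMul f Ω p - 1) * ∑ i, funDiffAt h Ω p (v i)
      * funDiffAt h' Ω' (f p) (diffAt f Ω p (v i)) - ∑ j, ∑ i, funDiffAt h Ω p (v i)
      * innerAt (f p) (diffAt f Ω p (v j)) (diffAt f Ω p (v i))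
      * funDiffAt h' Ω' (f p) (diffAt f Ω p (v j))) / √(detOnePlusAdjointMul f Ω p) := by
  exact congrArg (· / √(detOnePlusAdjointMul f Ω p)) (apply_toDual_symm_sub (E := Tan p)
    (E' := Tan (f p)) (finrank_tan p) hv (diffOn f Ω p).toLinearMap
    (mfderivWithin 𝓘(ℝ, Plane) 𝓘(ℝ, ℝ) h Ω p) (mfderivWithin 𝓘(ℝ, Plane) 𝓘(ℝ, ℝ) h' Ω' (f p)) _)

theorem detOnePlusAdjointMul_eq (Ω : Set N) (f : N → N) (p : N) {v : Fin 2 → Plane}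
    (hv : ∀ i j, innerAt p (v i) (v j) = if i = j then (1 : ℝ) else 0) :
    detOnePlusAdjointMul f Ω p = (1 + innerAt (f p) (diffAt f Ω p (v 0)) (diffAt f Ω p (v 0)))
      * (1 + innerAt (f p) (diffAt f Ω p (v 1)) (diffAt f Ω p (v 1)))
      - innerAt (f p) (diffAt f Ω p (v 0)) (diffAt f Ω p (v 1))
        * innerAt (f p) (diffAt f Ω p (v 0)) (diffAt f Ω p (v 1)) :=
  det_id_add_adjoint_comp (E := Tan p) (E' := Tan (f p)) (finrank_tan p) hv
    (diffOn f Ω p).toLinearMap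

theorem norm_sq_gradOn (Ω : Set N) (h : N → ℝ) (p : N) {v : Fin 2 → Plane}
    (hv : ∀ i j, innerAt p (v i) (v j) = if i = j then (1 : ℝ) else 0) :
    ‖gradOn h Ω p‖ ^ 2 = funDiffAt h Ω p (v 0) ^ 2 + funDiffAt h Ω p (v 1) ^ 2 :=
  norm_sq_toDual_symm (E := Tan p) (finrank_tan p) hv (mfderivWithin 𝓘(ℝ, Plane) 𝓘(ℝ, ℝ) h Ω p)

end Pairing

namespace ChartedDomain

variable {N : Type*} [MetricSpace N] [ChartedSpace Plane N] [IsManifold 𝓘(ℝ, Plane) ∞ N]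

theorem funDiffAt_symmDeriv (X : ChartedDomain N) (φ : N → ℝ)
    (hφ : ContMDiffOn 𝓘(ℝ, Plane) 𝓘(ℝ, ℝ) ∞ φ X.Ω) (y : X.region.carrier) (v : Plane) :
    funDiffAt φ X.Ω (X.e.symm y) (symmDeriv X.e y v)
      = ∑ k, Sm.ev y (Sm.pd k (X.fn φ hφ)) * v k := by
  rw [_root_.funDiffAt_symmDeriv X.mem_atlas hφ subset_rfl y.2 (X.region.uniqueDiffOn y y.2)]
  conv_lhs => rw [← Sm.sum_smul_stdVec v]
  simp only [map_sum, map_smul, ev_pd_fn, smul_eq_mul, mul_comm]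

end ChartedDomain

namespace MapChart

variable {N : Type*} [MetricSpace N] [ChartedSpace Plane N] [IsManifold 𝓘(ℝ, Plane) ∞ N]
  [Bundle.RiemannianBundle (fun p : N => TangentSpace 𝓘(ℝ, Plane) p)]
  (Z : MapChart N) (h h' : N → ℝ) (hh : ContMDiffOn 𝓘(ℝ, Plane) 𝓘(ℝ, ℝ) ∞ h Z.X.Ω)
  (hh' : ContMDiffOn 𝓘(ℝ, Plane) 𝓘(ℝ, ℝ) ∞ h' Z.Y.Ω)

theorem ev_tgt_pd (z : Z.region.carrier) (v : Fin 2 → Sm Z.region) :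
    Sm.ev z (∑ k, Z.tgt (Sm.pd k (Z.Y.fn h' hh')) * v k)
      = funDiffAt h' Z.Y.Ω (Z.f (Z.X.e.symm z))
        (symmDeriv Z.Y.e (Z.u z) (WithLp.toLp 2 fun k => Sm.ev z (v k))) := by
  have := Z.Y.funDiffAt_symmDeriv h' hh' (Z.tgtPt z) (WithLp.toLp 2 fun k => Sm.ev z (v k))
  rw [← symm_u]
  simp only [map_sum, map_mul, ev_tgt]
  exact this.symm

variable [IsContMDiffRiemannianBundle 𝓘(ℝ, Plane) ∞ Plane
  (fun p : N => TangentSpace 𝓘(ℝ, Plane) p)]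

/-- The transported frame at a point, as vectors of the plane. -/
def Fvec (z : Z.region.carrier) (i : Fin 2) : Plane := WithLp.toLp 2 fun k => Sm.ev z (Z.F i k)

theorem innerAt_Fvec (z : Z.region.carrier) (i j : Fin 2) :
    innerAt (Z.f (Z.X.e.symm z)) (symmDeriv Z.Y.e (Z.u z) (Z.Fvec z i))
      (symmDeriv Z.Y.e (Z.u z) (Z.Fvec z j)) = if i = j then 1 else 0 := by
  rw [Fvec, Fvec, innerAt_symmDeriv_tgt, Z.isOrthonormalFrame i j]
  split_ifs <;> simp

/-- The determinant of `1 + pb` is `1 + tr pb + det pb`, and `det pb = 1`. -/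
theorem ev_det (z : Z.region.carrier) :
    Sm.ev z Z.trSq = detOnePlusAdjointMul Z.f Z.X.Ω (Z.X.e.symm z) := by
  have hd := congrArg (Sm.ev z) Z.det_pb
  rw [detOnePlusAdjointMul_eq _ _ _ (Z.innerAt_Evec z), ← ev_pb, ← ev_pb, ← ev_pb]
  simp only [trSq, map_add, map_sub, map_mul, map_ofNat, map_one] at hd ⊢
  linear_combination -hd

theorem ev_tr (z : Z.region.carrier) :
    Sm.ev z (Z.p + Z.r) = √(detOnePlusAdjointMul Z.f Z.X.Ω (Z.X.e.symm z)) := by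
  have h0 := Z.ev_trSq_pos z
  rw [p_add_r, map_mul, ti, Sm.ev_invSqrt, ← ev_det, inv_mul_eq_div, Real.div_sqrt]

theorem ev_dh (z : Z.region.carrier) (i : Fin 2) (ψ : Sm Z.Y.region) :
    Sm.ev z ((Z.model (Z.X.fn h hh) ψ).dh i)
      = funDiffAt h Z.X.Ω (Z.X.e.symm z) (symmDeriv Z.X.e z (Z.Evec z i)) := by
  have := Z.X.funDiffAt_symmDeriv h hh (Z.srcPt z) (Z.Evec z i)
  simp only [model, map_sum, map_mul, ev_src]
  exact this.symm

theorem ev_deriv_w (z : Z.region.carrier) (i : Fin 2) :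
    Sm.ev z (Z.D i (Z.tgt (Z.Y.fn h' hh'))) = funDiffAt h' Z.Y.Ω (Z.f (Z.X.e.symm z))
      (diffAt Z.f Z.X.Ω (Z.X.e.symm z) (symmDeriv Z.X.e z (Z.Evec z i))) := by
  rw [diffAt_Evec, Vvec, ← Z.ev_tgt_pd h' hh', deriv_tgt]
  simp only [mul_comm]

/-- With `A = Df`, Cayley–Hamilton gives `S⁻¹ = t - S = (T - 1 - A* A) / √T` for `T = t²`. So
`gradPairing` applies the differential of `h'` to `A S⁻¹ ∇h = Q ∇h`. Being free of frames, it is one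
global function that all local models share. -/
theorem ev_pairing (z : Z.region.carrier) :
    Sm.ev z (Z.model (Z.X.fn h hh) (Z.Y.fn h' hh')).pairing
      = gradPairing Z.X.Ω Z.Y.Ω h h' Z.f (Z.X.e.symm z) := by
  set M := Z.model (Z.X.fn h hh) (Z.Y.fn h' hh') with hM
  rw [gradPairing_eq _ _ _ _ _ _ (Z.innerAt_Evec z), ← ev_tr, ← ev_det]
  simp only [← Z.ev_deriv_w h' hh', ← ev_pb, ← Z.ev_dh h hh _ _ (Z.Y.fn h' hh'), ← hM]
  have hw0 : Z.D 0 (Z.tgt (Z.Y.fn h' hh')) = Z.p * M.dk 0 + Z.q * M.dk 1 := M.deriv_w.1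
  have hw1 : Z.D 1 (Z.tgt (Z.Y.fn h' hh')) = Z.q * M.dk 0 + Z.r * M.dk 1 := M.deriv_w.2
  have ht : 0 < Sm.ev z (Z.p + Z.r) := by
    rw [map_add]; exact add_pos (Z.ev_p_pos z) (Z.ev_r_pos z)
  have hti := Z.p_add_r_mul_ti
  have b00 : Z.pb 0 0 = Z.p * (Z.p + Z.r) - 1 := by
    rw [show Z.p * (Z.p + Z.r) = (Z.pb 0 0 + 1) * ((Z.p + Z.r) * Z.ti) by rw [p]; ring, hti]; ring
  have b11 : Z.pb 1 1 = Z.r * (Z.p + Z.r) - 1 := by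
    rw [show Z.r * (Z.p + Z.r) = (Z.pb 1 1 + 1) * ((Z.p + Z.r) * Z.ti) by rw [r]; ring, hti]; ring
  have b01 : Z.pb 0 1 = Z.q * (Z.p + Z.r) := by
    rw [show Z.q * (Z.p + Z.r) = Z.pb 0 1 * ((Z.p + Z.r) * Z.ti) by rw [q]; ring, hti]; ring
  have b10 : Z.pb 1 0 = Z.q * (Z.p + Z.r) := by rw [pb_symm, b01]
  have hT : Z.trSq = (Z.p + Z.r) * (Z.p + Z.r) := by rw [trSq, b00, b11]; ring
  rw [eq_div_iff ht.ne', hT]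
  simp only [MinimalModel.pairing, Fin.sum_univ_two, hw0, hw1, b00, b01, b10, b11]
  have hdet := congrArg (Sm.ev z) Z.det_eq
  simp only [map_mul, map_add, map_sub, map_one] at hdet ⊢
  linear_combination (-(Sm.ev z Z.p + Sm.ev z Z.r) * (Sm.ev z (M.dh 0) * Sm.ev z (M.dk 0)
    + Sm.ev z (M.dh 1) * Sm.ev z (M.dk 1))) * hdet

theorem ev_dk (z : Z.region.carrier) (i : Fin 2) (φ : Sm Z.X.region) :
    Sm.ev z ((Z.model φ (Z.Y.fn h' hh')).dk i)
      = funDiffAt h' Z.Y.Ω (Z.f (Z.X.e.symm z)) (symmDeriv Z.Y.e (Z.u z) (Z.Fvec z i)) :=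
  Z.ev_tgt_pd h' hh' z (Z.F i)

theorem norm_sq_gradOn_src (z : Z.region.carrier) (ψ : Sm Z.Y.region) :
    Sm.ev z ((Z.model (Z.X.fn h hh) ψ).dh 0) ^ 2 + Sm.ev z ((Z.model (Z.X.fn h hh) ψ).dh 1) ^ 2
      = ‖gradOn h Z.X.Ω (Z.X.e.symm z)‖ ^ 2 := by
  rw [ev_dh, ev_dh, norm_sq_gradOn _ _ _ (Z.innerAt_Evec z)]

theorem norm_sq_gradOn_tgt (z : Z.region.carrier) (φ : Sm Z.X.region) :
    Sm.ev z ((Z.model φ (Z.Y.fn h' hh')).dk 0) ^ 2 + Sm.ev z ((Z.model φ (Z.Y.fn h' hh')).dk 1) ^ 2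
      = ‖gradOn h' Z.Y.Ω (Z.f (Z.X.e.symm z))‖ ^ 2 := by
  rw [ev_dk, ev_dk, norm_sq_gradOn _ _ _ (Z.innerAt_Fvec z)]

end MapChart

/-! ### Diffeomorphisms preserve the boundary -/

section Frontier

variable {N : Type*} [MetricSpace N] [ChartedSpace Plane N] [IsManifold 𝓘(ℝ, Plane) ∞ N]

/-- If `f x` were interior, the inverse map would be smooth near it with surjective differential,
hence open there. The image of a neighbourhood lies in `Ω`, so `x` would be interior as well. -/
theorem mem_frontier_of_isDiffeoOn {Ω Ω' : Set N} {f : N → N} (hΩ : HasSmoothBoundary Ω)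
    (hf : IsDiffeoOn Ω Ω' f) {x : N} (hx : x ∈ frontier Ω) : f x ∈ frontier Ω' := by
  obtain ⟨hbij, hsm, g, hg, hinv⟩ := hf
  have hxΩ : x ∈ Ω := hΩ.1.frontier_subset hx
  refine ⟨subset_closure (hbij.mapsTo hxΩ), fun hint => hx.2 ?_⟩
  set e := chartAt Plane x
  set e' := chartAt Plane (f x)
  have he : e ∈ atlas Plane N := chart_mem_atlas Plane x
  have he' : e' ∈ atlas Plane N := chart_mem_atlas Plane (f x)
  have hxe : x ∈ e.source := mem_chart_source Plane x
  have hfx : f x ∈ e'.source := mem_chart_source Plane (f x)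
  set s := mapRegion e e' he Ω hΩ f hsm.continuousOn
  have hesx : e.symm (e x) = x := e.left_inv hxe
  have hyt : e' (f x) ∈ e'.target := e'.map_source hfx
  have hesfx : e'.symm (e' (f x)) = f x := e'.left_inv hfx
  have hgfx : g (f x) = x := hinv.1 hxΩ
  have hys : e x ∈ s.carrier := ⟨e.map_source hxe, by
    change e.symm (e x) ∈ Ω ∩ f ⁻¹' e'.source
    rw [hesx]; exact ⟨hxΩ, hfx⟩⟩
  -- the inverse in the charts
  set v : Plane → Plane := e ∘ g ∘ e'.symm with hv
  have hgx : ContMDiffAt 𝓘(ℝ, Plane) 𝓘(ℝ, Plane) ∞ g (e'.symm (e' (f x))) := by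
    rw [hesfx]; exact hg.contMDiffAt (mem_interior_iff_mem_nhds.1 hint)
  have hsymm : ContMDiffAt 𝓘(ℝ, Plane) 𝓘(ℝ, Plane) ∞ e'.symm (e' (f x)) :=
    (contMDiffOn_symm_atlas he').contMDiffAt (e'.open_target.mem_nhds hyt)
  have hex : ContMDiffAt 𝓘(ℝ, Plane) 𝓘(ℝ, Plane) ∞ e (g (e'.symm (e' (f x)))) := by
    rw [hesfx, hgfx]
    exact (contMDiffOn_atlas he).contMDiffAt (e.open_source.mem_nhds hxe)
  have hvd : ContDiffAt ℝ ∞ v (e' (f x)) := by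
    rw [← contMDiffAt_iff_contDiffAt]
    exact ContMDiffAt.comp (e' (f x)) (f := g ∘ e'.symm) hex (hgx.comp _ hsymm)
  have hstrict := hvd.hasStrictFDerivAt (by simp)
  -- its differential is surjective
  set u : Plane → Plane := e' ∘ f ∘ e.symm with hu
  have hux : u (e x) = e' (f x) := by simp only [hu, Function.comp_apply, hesx]
  have hud : HasFDerivWithinAt u (fderivWithin ℝ u s.carrier (e x)) s.carrier (e x) :=
    ((contDiffOn_mapDomain he he' hsm).differentiableOn (by simp) _ hys).hasFDerivWithinAt
  have hcomp : HasFDerivWithinAt (v ∘ u)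
      ((fderiv ℝ v (e' (f x))).comp (fderivWithin ℝ u s.carrier (e x))) s.carrier (e x) := by
    refine HasFDerivAt.comp_hasFDerivWithinAt _ ?_ hud
    rw [hux]
    exact hstrict.hasFDerivAt
  have hid : ∀ z ∈ s.carrier, (v ∘ u) z = z := by
    intro z hz
    simp only [hv, hu, Function.comp_apply]
    rw [e'.left_inv hz.2.2, hinv.1 hz.2.1, e.right_inv hz.1]
  have hcomp' : HasFDerivWithinAt (v ∘ u) (ContinuousLinearMap.id ℝ Plane) s.carrier (e x) :=
    (hasFDerivWithinAt_id (e x) s.carrier).congr hid (hid _ hys)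
  -- Even at the boundary point `x` the differential within `Ω` is unique, so the differential of
  -- the inverse has a right inverse.
  have hDD := (s.uniqueDiffOn _ hys).eq hcomp hcomp'
  have hsurj : (fderiv ℝ v (e' (f x))).range = ⊤ := by
    rw [LinearMap.range_eq_top]
    intro w
    exact ⟨fderivWithin ℝ u s.carrier (e x) w, DFunLike.congr_fun hDD w⟩
  have hmap := hstrict.map_nhds_eq_of_surj hsurj
  have hvx : v (e' (f x)) = e x := by rw [← hux]; exact hid _ hys
  rw [hvx] at hmap
  have hnhds : chartImage e Ω ∈ 𝓝 (e x) := by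
    rw [← hmap, Filter.mem_map]
    have h1 : ∀ᶠ z in 𝓝 (e' (f x)), e'.symm z ∈ interior Ω' := by
      refine hsymm.continuousAt.eventually (isOpen_interior.mem_nhds ?_)
      rwa [hesfx]
    have h2 : ∀ᶠ z in 𝓝 (e' (f x)), g (e'.symm z) ∈ e.source := by
      have : ContinuousAt (g ∘ e'.symm) (e' (f x)) := (hgx.comp _ hsymm).continuousAt
      refine this.eventually (e.open_source.mem_nhds ?_)
      simpa only [Function.comp_apply, hesfx, hgfx] using hxe
    filter_upwards [h1, h2] with z hz1 hz2
    refine ⟨e.map_source hz2, ?_⟩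
    change e.symm (e (g (e'.symm z))) ∈ Ω
    rw [e.left_inv hz2]
    obtain ⟨a, ha, hfa⟩ := hbij.surjOn (interior_subset hz1)
    rw [← hfa, hinv.1 ha]
    exact ha
  rw [mem_interior_iff_mem_nhds]
  filter_upwards [(e.continuousAt hxe).preimage_mem_nhds hnhds, e.open_source.mem_nhds hxe]
    with a ha hae
  have := ha.2
  rwa [mem_preimage, e.left_inv hae] at this

end Frontier

/-! ### Local models of minimal Lagrangian maps -/

/-- A lower bound for a quadratic form, in an orthonormal frame. -/
theorem le_quad_of_isOrthonormalFrame {g H F : Fin 2 → Fin 2 → ℝ} {θ θ₀ : ℝ} (hθ : θ ≤ θ₀)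
    (hF : IsOrthonormalFrame g F) (hH : ∀ w, θ₀ * bil g w w ≤ bil H w w) (a b : ℝ) :
    θ * (a * a + b * b) ≤ quad (fun i j => bil H (F i) (F j)) a b := by
  have h := hH fun k => a * F 0 k + b * F 1 k
  rw [MapChart.bil_combination, MapChart.bil_combination, hF, hF, hF, hF] at h
  have h1 : θ * (a * a + b * b) ≤ θ₀ * (a * a + b * b) :=
    mul_le_mul_of_nonneg_right hθ (add_nonneg (mul_self_nonneg a) (mul_self_nonneg b))
  simp only [if_true, Fin.isValue, zero_ne_one, one_ne_zero, if_false] at h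
  simp only [quad]
  linarith

theorem IsOrthonormalFrame.ev {s : Region} {g F : Fin 2 → Fin 2 → Sm s}
    (h : IsOrthonormalFrame g F) (z : s.carrier) :
    IsOrthonormalFrame (fun i j => Sm.ev z (g i j)) fun i k => Sm.ev z (F i k) := by
  intro a b
  rw [← MapChart.ev_bil, h a b]
  split_ifs <;> simp

theorem MapChart.ev_tril {s : Region} (z : s.carrier) (T : Fin 2 → Fin 2 → Fin 2 → Sm s)
    (u v w : Fin 2 → Sm s) :
    Sm.ev z (tril T u v w) = tril (fun c i j => Sm.ev z (T c i j)) (fun i => Sm.ev z (u i))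
      (fun i => Sm.ev z (v i)) (fun i => Sm.ev z (w i)) := by
  simp [tril]

namespace MapChart

variable {N : Type*} [MetricSpace N] [ChartedSpace Plane N] [IsManifold 𝓘(ℝ, Plane) ∞ N]
  [Bundle.RiemannianBundle (fun p : N => TangentSpace 𝓘(ℝ, Plane) p)]
  (Z : MapChart N)

/-- Points of `Ω` near the base point stay in the chart domain of the map, so continuity of the
local expression passes to the global function. -/
theorem continuousWithinAt_of_ev (z : Z.region.carrier) (φ : Sm Z.region) (Φ : N → ℝ)
    (hΦ : ∀ z : Z.region.carrier, Sm.ev z φ = Φ (Z.X.e.symm z)) :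
    ContinuousWithinAt Φ Z.X.Ω (Z.X.e.symm z) := by
  set x := Z.X.e.symm z
  have hxs : x ∈ Z.X.e.source := Z.X.e.map_target z.2.1
  have hex : Z.X.e x = z := Z.X.e.right_inv z.2.1
  have hf : ∀ᶠ a in 𝓝[Z.X.Ω] x, Z.f a ∈ Z.Y.e.source :=
    (Z.minimal.diffeo.2.1.continuousOn x z.2.2.1).eventually (Z.Y.e.open_source.mem_nhds z.2.2.2)
  have hs : ∀ᶠ a in 𝓝[Z.X.Ω] x, a ∈ Z.X.e.source :=
    nhdsWithin_le_nhds (Z.X.e.open_source.mem_nhds hxs)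
  have hmem : ∀ a ∈ Z.X.Ω, Z.f a ∈ Z.Y.e.source → a ∈ Z.X.e.source →
      Z.X.e a ∈ Z.region.carrier := fun a ha hfa has =>
    ⟨Z.X.e.map_source has, by
      change Z.X.e.symm (Z.X.e a) ∈ Z.X.Ω ∩ Z.f ⁻¹' Z.Y.e.source
      rw [Z.X.e.left_inv has]; exact ⟨ha, hfa⟩⟩
  have htend : Filter.Tendsto Z.X.e (𝓝[Z.X.Ω] x) (𝓝[Z.region.carrier] z) := by
    refine tendsto_nhdsWithin_iff.2 ⟨?_, ?_⟩
    · have := (Z.X.e.continuousAt hxs).tendsto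
      rw [hex] at this
      exact this.mono_left nhdsWithin_le_nhds
    · filter_upwards [hf, hs, self_mem_nhdsWithin] with a h1 h2 h3 using hmem a h3 h1 h2
  have hφ : Filter.Tendsto φ.ext₀ (𝓝[Z.region.carrier] z) (𝓝 (φ.ext₀ z)) :=
    φ.contDiffOn.continuousOn z z.2
  have hx : φ.ext₀ z = Φ x := by rw [Sm.ext₀_apply, hΦ]
  rw [hx] at hφ
  refine (hφ.comp htend).congr' ?_
  filter_upwards [hf, hs, self_mem_nhdsWithin] with a h1 h2 h3
  have := hΦ ⟨Z.X.e a, hmem a h3 h1 h2⟩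
  rw [← Sm.ext₀_apply] at this
  simp only [Z.X.e.left_inv h2] at this
  exact this

theorem mem_interior_region (z : Z.region.carrier) (hz : Z.X.e.symm z ∈ interior Z.X.Ω) :
    (z : Plane) ∈ interior Z.region.carrier := by
  obtain ⟨V, hV, hVeq⟩ := exists_isOpen_inter_subset_mapDomain (e := Z.X.e) (e' := Z.Y.e)
    Z.minimal.diffeo.2.1.continuousOn
  change (z : Plane) ∈ interior (mapDomain Z.X.e Z.Y.e Z.X.Ω Z.f)
  have hz2 : (z : Plane) ∈ mapDomain Z.X.e Z.Y.e Z.X.Ω Z.f := z.2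
  rw [hVeq] at hz2
  rw [hVeq, interior_inter, hV.interior_eq]
  exact ⟨mem_interior_chartImage z.2.1 hz, hz2.2⟩

variable [IsContMDiffRiemannianBundle 𝓘(ℝ, Plane) ∞ Plane
  (fun p : N => TangentSpace 𝓘(ℝ, Plane) p)]

theorem isOrthonormalFrame_src (z : Z.region.carrier) :
    IsOrthonormalFrame (fun i j => Sm.ev (Z.srcPt z) (Z.X.g i j)) fun i k => Sm.ev z (Z.E i k) := by
  have := Z.X.isOrthonormalFrame.ev (Z.srcPt z)
  simp only [← ev_src] at this ⊢
  exact this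

theorem isOrthonormalFrame_tgt (z : Z.region.carrier) :
    IsOrthonormalFrame (fun i j => Sm.ev (Z.tgtPt z) (Z.Y.g i j)) fun i k => Sm.ev z (Z.F i k) := by
  have := Z.isOrthonormalFrame.ev z
  simp only [g', ev_tgt] at this
  exact this

theorem isUnitVec_src (z : Z.region.carrier) (i : Fin 2) :
    Z.X.IsUnitVec (Z.srcPt z) fun k => Sm.ev z (Z.E i k) := by
  simpa [ChartedDomain.IsUnitVec] using Z.isOrthonormalFrame_src z i i

theorem isUnitVec_tgt (z : Z.region.carrier) (i : Fin 2) :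
    Z.Y.IsUnitVec (Z.tgtPt z) fun k => Sm.ev z (Z.F i k) := by
  simpa [ChartedDomain.IsUnitVec] using Z.isOrthonormalFrame_tgt z i i

/-- The local model of a minimal Lagrangian map at a point. -/
def localModel {h h' : N → ℝ} (hh : IsBoundaryDefiningFunction Z.X.Ω h)
    (hh' : IsBoundaryDefiningFunction Z.Y.Ω h') {θ θ₀ θ₁ C : ℝ} (hθ₀ : θ ≤ θ₀) (hθ₁ : θ ≤ θ₁)
    (h₀ : ∀ (y : Z.X.region.carrier) (w : Fin 2 → ℝ), θ₀ * bil (metricCoeff Z.X.e y) w w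
      ≤ bil (fun i j => hessCoeff Z.X.e Z.X.Ω h i j y) w w)
    (h₁ : ∀ (y : Z.Y.region.carrier) (w : Fin 2 → ℝ), θ₁ * bil (metricCoeff Z.Y.e y) w w
      ≤ bil (fun i j => hessCoeff Z.Y.e Z.Y.Ω h' i j y) w w) (z : Z.region.carrier)
    (hX : Z.X.IsBoundedAt (Z.X.fn h hh.smooth) C (Z.srcPt z))
    (hY : Z.Y.IsBoundedAt (Z.Y.fn h' hh'.smooth) C (Z.tgtPt z)) :
    LocalModel Z.X.Ω h (h' ∘ Z.f) (gradPairing Z.X.Ω Z.Y.Ω h h' Z.f)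
      (detOnePlusAdjointMul Z.f Z.X.Ω) θ C (Z.X.e.symm z) where
  s := Z.region
  M := Z.model (Z.X.fn h hh.smooth) (Z.Y.fn h' hh'.smooth)
  E := Z.E
  c := Z.X.e.symm
  y := z
  deriv_eq := Z.D_apply
  c_y := rfl
  c_mem z := z.2.2.1
  ev_h z := Z.ev_src z _
  ev_w z := (Z.ev_tgt z _).trans (congrArg h' (Z.symm_u z))
  ev_pairing := Z.ev_pairing h h' hh.smooth hh'.smooth
  ev_tr := Z.ev_tr
  p_pos := Z.ev_p_pos
  r_pos := Z.ev_r_pos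
  continuousWithinAt := Z.continuousWithinAt_of_ev z
  mem_interior := Z.mem_interior_region z
  bound_dh a := by
    simp only [model, map_sum, map_mul, ev_src]
    exact hX.differential _ (Z.isUnitVec_src z a)
  bound_dk a := by
    simp only [model, map_sum, map_mul, ev_tgt]
    exact hY.differential _ (Z.isUnitVec_tgt z a)
  bound_Hh a b := by
    simp only [model, ev_bil, ev_src]
    exact hX.hess _ _ (Z.isUnitVec_src z a) (Z.isUnitVec_src z b)
  bound_Hk a b := by
    simp only [model, ev_bil, ev_tgt]
    exact hY.hess _ _ (Z.isUnitVec_tgt z a) (Z.isUnitVec_tgt z b)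
  bound_Th i a b := by
    simp only [model, ev_tril, ev_src]
    exact hX.covHess _ _ _ (Z.isUnitVec_src z i) (Z.isUnitVec_src z a) (Z.isUnitVec_src z b)
  bound_Tk i a b := by
    simp only [model, ev_tril, ev_tgt]
    exact hY.covHess _ _ _ (Z.isUnitVec_tgt z i) (Z.isUnitVec_tgt z a) (Z.isUnitVec_tgt z b)
  bound_curv := by
    rw [model_curv, ev_src]
    exact hX.curv
  convex_h a b := by
    simp only [model, ev_bil, ev_src, ChartedDomain.ev_hess]
    exact le_quad_of_isOrthonormalFrame hθ₀ (Z.isOrthonormalFrame_src z) (h₀ (Z.srcPt z)) a b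
  convex_k a b := by
    simp only [model, ev_bil, ev_tgt, ChartedDomain.ev_hess]
    exact le_quad_of_isOrthonormalFrame hθ₁ (Z.isOrthonormalFrame_tgt z) (h₁ (Z.tgtPt z)) a b
  boundary_h := hh.eq_zero _
  boundary_w hx :=
    hh'.eq_zero _ (mem_frontier_of_isDiffeoOn Z.X.smoothBoundary Z.minimal.diffeo hx)
  boundary_dh hx := by
    rw [norm_sq_gradOn_src, hh.norm_grad _ hx, one_pow]
  boundary_dk hx := by
    rw [norm_sq_gradOn_tgt, hh'.norm_grad _ (mem_frontier_of_isDiffeoOn Z.X.smoothBoundary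
      Z.minimal.diffeo hx), one_pow]

end MapChart

end

theorem mainTheorem5 {N : Type*} [MetricSpace N] [ChartedSpace Plane N]
    [IsManifold 𝓘(ℝ, Plane) ∞ N]
    [Bundle.RiemannianBundle (fun p : N => TangentSpace 𝓘(ℝ, Plane) p)]
    [IsContMDiffRiemannianBundle 𝓘(ℝ, Plane) ∞ Plane
      (fun p : N => TangentSpace 𝓘(ℝ, Plane) p)]
    [IsRiemannianManifold 𝓘(ℝ, Plane) N]
    [CompleteSpace N] [SimplyConnectedSpace N]
    (κ : ℝ) (hκ : κ ≤ 0) (hN : HasConstantCurvature N κ)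
    (Ω Ω' : Set N) (hΩ : IsStrictlyConvexDomain Ω) (hΩ' : IsStrictlyConvexDomain Ω')
    (h h' : N → ℝ) (hh : IsBoundaryDefiningFunction Ω h)
    (hh' : IsBoundaryDefiningFunction Ω' h') :
    ∃ C₄ : ℝ, ∀ f : N → N, IsMinimalLagrangianDiffeo Ω Ω' f →
      ∀ p ∈ Ω, detOnePlusAdjointMul f Ω p ≤ C₄ := by
  obtain ⟨C, hC⟩ := ChartedDomain.exists_bound hΩ.compact hΩ.smoothBoundary hh.smooth
  obtain ⟨C', hC'⟩ := ChartedDomain.exists_bound hΩ'.compact hΩ'.smoothBoundary hh'.smooth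
  obtain ⟨θ₀, hθ₀, h₀⟩ := hh.uniformlyConvex
  obtain ⟨θ₁, hθ₁, h₁⟩ := hh'.uniformlyConvex
  obtain ⟨B, hB⟩ := (hΩ.compact.bddBelow_image hh.smooth.continuousOn)
  -- All constants are fixed before `f` is introduced. One `C` serves source and target, and the
  -- maximum with `1` keeps it positive.
  obtain ⟨C₄, hC₄⟩ := LocalModel.exists_bound (h := h) (θ := min θ₀ θ₁) (C := max 1 (max C C'))
    (B := -B) hΩ.compact (lt_min hθ₀ hθ₁) (le_max_left _ _)
    (fun x hx => by rw [neg_neg]; exact hB ⟨x, hx, rfl⟩)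
  refine ⟨C₄, fun f hf => hC₄ (h' ∘ f) (gradPairing Ω Ω' h h' f) (detOnePlusAdjointMul f Ω) ?_⟩
  intro x hx
  obtain ⟨e, he, y, rfl, hbd⟩ := hC x hx
  obtain ⟨e', he', y', hy', hbd'⟩ := hC' (f (e.symm y)) (hf.diffeo.1.mapsTo hx)
  let Z : MapChart N := ⟨⟨e, he, Ω, hΩ.smoothBoundary⟩, ⟨e', he', Ω', hΩ'.smoothBoundary⟩, f, hf⟩
  have hz : (y : Plane) ∈ Z.region.carrier :=
    ⟨y.2.1, hx, by change f (e.symm y) ∈ e'.source; rw [← hy']; exact e'.map_target y'.2.1⟩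
  -- The derivative bound for `h'` was obtained at `y'`, which has to be recognized as the image
  -- point in the target chart.
  have htgt : Z.tgtPt ⟨y, hz⟩ = y' := by
    refine Subtype.ext ?_
    change e' (f (e.symm y)) = y'
    rw [← hy', e'.right_inv y'.2.1]
  refine ⟨Z.localModel hh hh' (min_le_left _ _) (min_le_right _ _)
    (fun y w => h₀ e he y y.2 w) (fun y w => h₁ e' he' y y.2 w) ⟨y, hz⟩
    (hbd.mono ((le_max_left _ _).trans (le_max_right _ _))) ?_⟩
  rw [htgt]
  exact hbd'.mono ((le_max_right _ _).trans (le_max_right _ _))
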